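/- **Theorem (Correctness of Glue).** Let $2\le \ell$, $\ell+2\le m$, let $c_1,\dots,c_m$ be distinct reals, and let $0<\varepsilon<|c_i-c_j|$ for all $i\neq j$. For a list $c_s,\dots,c_t$ with $t > s$, its map is the piecewise linear map on $[s-1,t+1]$ with value $c_i$ at each item $i$ and with the hooks $c_s+\varepsilon\,\mathrm{sign}(c_{s+1}-c_s)$ at $s-1$ and $c_t+\varepsilon\,\mathrm{sign}(c_{t-1}-c_t)$ at $t+1$. Let $g$, $h$ and $f=g\cdot h$ be the maps of $c_1,\dots,c_\ell$, of $c_{\ell+1},\dots,c_m$, and of $c_1,\dots,c_m$. *Up-tree.* The homological critical points of such a map are its minima (a hook counts if it is a local minimum at its end of the domain) and its interior maxima. Take the unique full binary tree whose in-order sequence is the sequence of critical points from left to right and in which values increase from leaf to root, and put a special root $\beta$, larger in value than all other nodes, above its root. Each minimum $a$ spans a *banana* with the nearest ancestor $b=\mathrm{Dth}(a)$ in whose subtree $a$ does not have the smallest value ($b=\beta$ if there is none); the nodes strictly between them on the path from $a$ to $b$ form the left trail (those to the left of $a$) and the right trail (those to the right of $a$), both ordered by value. The bananas are the up-tree $\mathrm{Up}(\cdot)$.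 Write $\mathrm{Birth}(b)=a$, and $\mathrm{Low}(u)=a$ for each interior node $u$ of the two trails; $\mathrm{Low}(\beta)=\mathrm{nil}$. If $a<b$, the left trail is the in-trail and the right trail the mid-trail; if $a>b$ it is the other way round. The left (right) spine consists of $\beta$ and the topmost interior node of each left (right) trail whose upper end is in the spine. For gluing, $\beta_g$ lies at $-\infty$ and $\beta_h$ at $+\infty$ along the interval, and $f(\mathrm{nil})=-\infty$, $f(\beta_h)<f(\beta_g)$. *Algorithm Glue.* Pre-processing, for $c_\ell<c_{\ell+1}$ (the other case is the mirror image): if $c_{\ell-1}<c_\ell$, remove $\ell$ and the hook paired with it from $\mathrm{Up}(g)$; in $\mathrm{Up}(h)$, replace by a dummy leaf $\alpha$ the hook paired with $\ell+1$ if $c_{\ell+2}<c_{\ell+1}$, and the leaf $\ell+1$ otherwise ($\alpha$ takes over its value). Let $q$ be $\mathrm{Dth}$ of the rightmost minimum of the left tree and $q'=\mathrm{Dth}(\alpha)$ in the right tree. Repeat the following, described for $f(q)<f(q')$ (if $f(q)>f(q')$, do the mirror image with the roles of $q,q'$ exchanged). Let $\mu=\mathrm{Low}(q)$, and let $\kappa=\mathrm{Birth}(q)$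 if this is not $\alpha$, and $\kappa=\mathrm{Birth}(q')$ otherwise. 1. If $f(\kappa)>f(\mu)$ and $\kappa=\mathrm{Birth}(q)$, *undo an injury*: move the nodes of value less than $f(q)$ from the mid-trail of $\alpha$ to the upper end of the in-trail between $\kappa$ and $q$. 2. If $f(\kappa)>f(\mu)$ and $\kappa=\mathrm{Birth}(q')$, *undo a fatality*: exchange $\alpha$ (paired with $q$) and $\kappa$ (paired with $q'$). The former in-trail of $\kappa$ extends the mid-trail of $q$ at its lower end, the nodes of value less than $f(q)$ on the former mid-trail of $\kappa$ extend the in-trail of $q$, and $\alpha$, now paired with $q'$, keeps the rest of that mid-trail and an empty in-trail. 3. If $f(\mu)>f(\kappa)$, *undo a scare*: set $f(\alpha)=f(\mu)-\varepsilon$ and interchange the minima $\alpha$ and $\mu$, that is, split both trails of $\mu$ at the value $f(q)$; the lower parts become the trails between $\mu$ and $q$, and the upper parts are put on top of the trails of $\alpha$, with $q$ in between on the side opposite to the trail of $\mu$ that contained $q$, so that $\alpha$ is now paired with the former $\mathrm{Dth}(\mu)$. Moved nodes take the bananas below them along. Then replace $q$ by $\mathrm{Dth}(\mathrm{Low}(q))$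 (it stays if $\mathrm{Low}(q)=\mathrm{nil}$). Stop after the first iteration after which one of the two trees consists only of its special root and $\alpha$, and discard these two nodes. *Claim.* Applied to $\mathrm{Up}(g)$ and $\mathrm{Up}(h)$, Glue terminates, and in every iteration one of the three cases applies and all pointers it needs exist. In every iteration $q$ is on the right spine of the left tree and $q'$ on the left spine of the right tree, both for the current trees and for the pre-processed trees with which the loop starts. The loop stops when one of the trees is reduced to its special root and the dummy leaf, and the remaining tree is the up-tree $\mathrm{Up}(g\cdot h)$ (with the remaining special root). -/

import Mathlib

noncomputable section

namespace BananaTree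

/-! ### Lists viewed as maps

A list `c s, c (s+1), …, c t` of at least two distinct values gives the piecewise linear map on
`[s-1, t+1]` whose values at the integers are `hookedMap c s t ε`. -/

/-- The values at the integers of the piecewise linear map of the list `c s, …, c t`; the two
artificial ends `s-1` and `t+1` are the hooks. -/
def hookedMap (c : ℕ → ℝ) (s t : ℕ) (ε : ℝ) (i : ℕ) : ℝ :=
  if i < s then c s + ε * (SignType.sign (c (s + 1) - c s) : ℝ)
  else if t < i then c t + ε * (SignType.sign (c (t - 1) - c t) : ℝ)
  else c i

/-- `i` is a minimum of a map `f` on `[s-1, t+1]`; this includes up-type endpoints. -/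
def IsMinAt (f : ℕ → ℝ) (s t i : ℕ) : Prop :=
  (s ≤ i → f i < f (i - 1)) ∧ (i ≤ t → f i < f (i + 1))

/-- `i` is a maximum in the interior of the domain `[s-1, t+1]` of `f`. -/
def IsMaxAt (f : ℕ → ℝ) (s t i : ℕ) : Prop :=
  s ≤ i ∧ i ≤ t ∧ f (i - 1) < f i ∧ f (i + 1) < f i

instance (f : ℕ → ℝ) (s t i : ℕ) : Decidable (IsMinAt f s t i) := by
  unfold IsMinAt; infer_instance

instance (f : ℕ → ℝ) (s t i : ℕ) : Decidable (IsMaxAt f s t i) := by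
  unfold IsMaxAt; infer_instance

/-- The two sides; also used to name the left tree (that of `g`) and the right tree (that of `h`). -/
inductive Side : Type
  | left
  | right
  deriving DecidableEq

/-- The opposite side. -/
def Side.opp : Side → Side
  | .left => .right
  | .right => .left

/-- The nodes of banana trees: items, hooks (both given by their integer position), the dummy
leaf `α`, and the special roots `β_g = root left` and `β_h = root right`. -/
inductive Node : Type
  | item (i : ℕ)
  | hook (i : ℕ)
  | dummy
  | root (s : Side)
  deriving DecidableEq

/-- The value of a map at a node that is an item or a hook. -/
def nodeValue (f : ℕ → ℝ) : Node → ℝ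
  | .item i => f i
  | .hook i => f i
  | _ => 0

/-- The node at the integer position `i` of the domain `[s-1, t+1]`. -/
def point (s t i : ℕ) : Node := if s ≤ i ∧ i ≤ t then .item i else .hook i

/-- The homological critical points `a₀ < b₁ < a₁ < … < bₙ < aₙ` of the map of the list
`c s, …, c t`, from left to right: minima (including up-type hooks) and maxima alternate. -/
def criticals (c : ℕ → ℝ) (s t : ℕ) (ε : ℝ) : List Node :=
  ((List.range' (s - 1) (t + 3 - s)).filter fun i =>
    IsMinAt (hookedMap c s t ε) s t i ∨ IsMaxAt (hookedMap c s t ε) s t i).map (point s t)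

/-! ### First step: the full binary tree -/

/-- Full binary trees whose leaves are minima and whose internal nodes are maxima. -/
inductive BinTree : Type
  | leaf (a : Node)
  | node (l : BinTree) (b : Node) (r : BinTree)

namespace BinTree

/-- The in-order sequence of the nodes. -/
def inorder : BinTree → List Node
  | leaf a => [a]
  | node l b r => l.inorder ++ b :: r.inorder

/-- The node at the top. -/
def top : BinTree → Node
  | leaf a => a
  | node _ b _ => b

/-- The values increase along every path from a leaf to the root. -/
def HeapOrdered (v : Node → ℝ) : BinTree → Prop
  | leaf _ => True
  | node l b r => v l.top < v b ∧ v r.top < v b ∧ l.HeapOrdered v ∧ r.HeapOrdered v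

/-- The rightmost leaf. -/
def lastLeaf : BinTree → Node
  | leaf a => a
  | node _ _ r => r.lastLeaf

/-- Add a maximum `b` and a minimum `a`, in this order, to the right of all nodes of the tree. -/
def addRight (v : Node → ℝ) (b a : Node) : BinTree → BinTree
  | leaf x => node (leaf x) b (leaf a)
  | node l b' r =>
      if v b < v b' then node l b' (addRight v b a r) else node (node l b' r) b (leaf a)

/-- Add alternating maxima and minima from left to right. -/
def addAll (v : Node → ℝ) : BinTree → List Node → BinTree
  | T, b :: a :: rest => addAll v (addRight v b a T) rest
  | T, _ => T

theorem inorder_addRight (v : Node → ℝ) (b a : Node) (T : BinTree) :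
    (addRight v b a T).inorder = T.inorder ++ [b, a] := by
  induction T with
  | leaf x => rfl
  | node l b' r _ ihr =>
    unfold addRight
    split_ifs
    · simp [inorder, ihr]
    · simp [inorder]

theorem heapOrdered_addRight (v : Node → ℝ) (b a : Node) (T : BinTree) (hT : T.HeapOrdered v)
    (hlast : v T.lastLeaf < v b) (ha : v a < v b) (hne : ∀ x ∈ T.inorder, v x ≠ v b) :
    (addRight v b a T).HeapOrdered v := by
  induction T with
  | leaf x => exact ⟨hlast, ha, trivial, trivial⟩
  | node l b' r _ ihr =>
    obtain ⟨h1, h2, h3, h4⟩ := hT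
    unfold addRight
    split_ifs with h
    · refine ⟨h1, ?_, h3, ihr h4 hlast fun x hx => hne x (by simp [inorder, hx])⟩
      cases r with
      | leaf y => exact h
      | node l2 b2 r2 =>
        unfold addRight
        split_ifs
        · exact h2
        · exact h
    · have := hne b' (by simp [inorder])
      exact ⟨lt_of_le_of_ne (not_lt.mp h) this, ha, ⟨h1, h2, h3, h4⟩, trivial⟩

end BinTree

/-- The full binary tree on an alternating sequence of minima and maxima that is determined by:
its in-order sequence is the given one, and values increase from the leaves to the root. -/
def binaryTree (v : Node → ℝ) : List Node → BinTree
  | [] => .leaf .dummy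
  | a :: rest => BinTree.addAll v (.leaf a) rest

/-! ### Second and third step: paths and trails -/

/-- A banana: its lower end (a minimum), its upper end (a maximum or a special root), and the
interior nodes of its left and its right trail, each listed from bottom to top. If the lower end
is to the left of the upper end, then the in-trail is the left and the mid-trail the right trail;
otherwise the in-trail is the right and the mid-trail the left trail. -/
@[ext]
structure Banana : Type where
  lower : Node
  upper : Node
  trail : Side → List Node

/-- The part inside a subtree of the path that starts at the leaf `lower`, split into trails. -/
structure OpenPath : Type where
  lower : Node
  trail : Side → List Node

/-- Add a new top node to one of the two trails. -/
def OpenPath.extend (P : OpenPath) (d : Side) (b : Node) : OpenPath :=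
  ⟨P.lower, fun d' => if d' = d then P.trail d' ++ [b] else P.trail d'⟩

/-- End the path at the upper end `b`. -/
def OpenPath.close (P : OpenPath) (b : Node) : Banana := ⟨P.lower, b, P.trail⟩

/-- Decompose a binary tree into paths, where the path of a leaf ends at the nearest ancestor in
whose subtree the leaf is not the smallest. The first component is the path of the smallest leaf,
which is still open at the root. An interior node `b` of a path is on the left trail if the path
comes from its right child, and on the right trail if the path comes from its left child. -/
def decompose (v : Node → ℝ) : BinTree → OpenPath × List Banana
  | .leaf a => (⟨a, fun _ => []⟩, [])
  | .node l b r =>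
      let L := decompose v l
      let R := decompose v r
      if v L.1.lower < v R.1.lower then
        (L.1.extend .right b, R.1.close b :: (L.2 ++ R.2))
      else
        (R.1.extend .left b, L.1.close b :: (L.2 ++ R.2))

/-- The up-tree of the map of the list `c s, …, c t` with special root `β`, given by its bananas.
The order in which the bananas are listed is irrelevant. -/
def upTree (c : ℕ → ℝ) (s t : ℕ) (ε : ℝ) (β : Node) : List Banana :=
  let v := nodeValue (hookedMap c s t ε)
  let D := decompose v (binaryTree v (criticals c s t ε))
  D.1.close β :: D.2

/-! ### Pointers and spines

A list of bananas may hold several trees; a tree consists of the bananas that can be reached from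
its special root. -/

/-- The banana with lower end `a`. -/
def bananaAt (S : List Banana) (a : Node) : Option Banana := S.find? fun B => B.lower = a

/-- The pointer `Dth` from a lower end to the upper end of its banana. -/
def dth (S : List Banana) (a : Node) : Option Node := (bananaAt S a).map Banana.upper

/-- The pointer `Birth` from an upper end to the lower end of its banana. -/
def birth (S : List Banana) (b : Node) : Option Node :=
  (S.find? fun B => B.upper = b).map Banana.lower

/-- The pointer `Low` from a node of a banana other than its upper end to its lower end; it is nil
for special roots. -/
def low (S : List Banana) (p : Node) : Option Node :=
  (S.find? fun B => p = B.lower ∨ p ∈ B.trail .left ∨ p ∈ B.trail .right).map Banana.lower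

/-- The first node below the upper end `b` on the trail of its banana on side `d`. Thus
`below S b left` and `below S b right` are, in some order, the pointers `In` and `Mid` of `b`. -/
def below (S : List Banana) (b : Node) (d : Side) : Option Node :=
  (S.find? fun B => B.upper = b).map fun B => ((B.trail d).getLast?).getD B.lower

/-- The spine on side `d` of the tree with special root `β`: it contains `β` and the topmost
interior node of every trail on side `d` whose upper end it contains. -/
inductive InSpine (S : List Banana) (β : Node) (d : Side) : Node → Prop
  | root : InSpine S β d β
  | next {B : Banana} {u : Node} : B ∈ S → InSpine S β d B.upper →
      (B.trail d).getLast? = some u → InSpine S β d u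

/-- Replace the banana with lower end `a`. -/
def modify (S : List Banana) (a : Node) (φ : Banana → Banana) : List Banana :=
  S.map fun B => if B.lower = a then φ B else B

/-- The pair of trails with `x` on side `d` and `y` on the other side. -/
def trails (d : Side) (x y : List Node) : Side → List Node := fun d' => if d' = d then x else y

/-! ### The algorithm -/

/-- The data on which gluing works: the bananas of the left and the right tree, the current value
of the dummy leaf, and the current maxima `q` (in the left tree) and `q'` (in the right tree). -/
@[ext]
structure GlueState : Type where
  bananas : List Banana
  alpha : ℝ
  cur : Side → Node

/-- The value of a node or of nil, with the conventions
`f(nil) = -∞ < (values of items, hooks and the dummy leaf) < f(β_h) < f(β_g)`. -/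
def height (f : ℕ → ℝ) (alpha : ℝ) : Option Node → ℤ ×ₗ ℝ
  | none => toLex (-1, 0)
  | some (.item i) => toLex (0, f i)
  | some (.hook i) => toLex (0, f i)
  | some .dummy => toLex (0, alpha)
  | some (.root .right) => toLex (1, 0)
  | some (.root .left) => toLex (2, 0)

/-- `f(u) < f(w)` for nodes, in a given state. -/
def GlueState.Below (f : ℕ → ℝ) (σ : GlueState) (u w : Option Node) : Prop :=
  height f σ.alpha u < height f σ.alpha w

instance (f : ℕ → ℝ) (σ : GlueState) (u w : Option Node) : Decidable (σ.Below f u w) := by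
  unfold GlueState.Below; infer_instance

/-- Undo an injury of the banana spanned by `κ` and `q` in tree `s`. In tree `s`, the node `q` is
on the spine that faces the other tree, so the in-trail of `κ` is on side `s.opp`; in the other
tree, the mid-trail of the dummy leaf is also on side `s.opp`. The nodes with value less than that
of `q` are removed from the mid-trail of the dummy leaf and inserted at the upper end of the
in-trail between `κ` and `q`. -/
def undoInjury (f : ℕ → ℝ) (σ : GlueState) (s : Side) (κ q : Node) : Option GlueState := do
  let A ← bananaAt σ.bananas .dummy
  let K ← bananaAt σ.bananas κ
  let t := s.opp
  let moved := (A.trail t).filter fun j => σ.Below f (some j) (some q)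
  let rest := (A.trail t).filter fun j => ¬ σ.Below f (some j) (some q)
  let S₁ := modify σ.bananas .dummy fun _ => ⟨.dummy, A.upper, trails t rest (A.trail s)⟩
  let S₂ := modify S₁ κ fun _ => ⟨κ, K.upper, trails t (K.trail t ++ moved) (K.trail s)⟩
  return { σ with bananas := S₂ }

/-- Undo a fatality of the banana spanned by `κ` and `q`, where `q` is in tree `s` and spans a
banana with the dummy leaf, while `κ` spans a banana with `q'` in the other tree, with in-trail on
side `s` and mid-trail on side `s.opp`. The lower end `κ`, the nodes of its in-trail, and the nodes
with value less than that of `q` of its mid-trail are exchanged with the dummy leaf: the former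
in-trail extends the mid-trail of `q` (on side `s`) at its lower end, the nodes from the mid-trail
extend the in-trail of `q` (on side `s.opp`), and the dummy leaf is left with `q'`, an empty
in-trail, and the rest of the mid-trail. -/
def undoFatality (f : ℕ → ℝ) (σ : GlueState) (s : Side) (κ q : Node) : Option GlueState := do
  let A ← bananaAt σ.bananas .dummy
  let K ← bananaAt σ.bananas κ
  let t := s.opp
  let moved := (K.trail t).filter fun j => σ.Below f (some j) (some q)
  let rest := (K.trail t).filter fun j => ¬ σ.Below f (some j) (some q)
  let S₁ := modify σ.bananas .dummy fun _ => ⟨.dummy, K.upper, trails t rest []⟩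
  let S₂ := modify S₁ κ fun _ =>
    ⟨κ, A.upper, trails t (A.trail t ++ moved) (K.trail s ++ A.trail s)⟩
  return { σ with bananas := S₂ }

/-- The interchange of minima `i` and `p`, which is structural if `j = Dth i` is interior to a
trail, on side `d`, of the banana spanned by `p` and its upper end. Both trails of `p` are split
at the value of `j`; the upper parts are put on top of the trails of `i`, with `j` in between on
the side other than `d`, and the lower parts become the trails between `p` and `j`. -/
def interchangeMinima (f : ℕ → ℝ) (σ : GlueState) (i p : Node) : Option GlueState := do
  let I ← bananaAt σ.bananas i
  let P ← bananaAt σ.bananas p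
  let j := I.upper
  if j ∈ P.trail .left ∨ j ∈ P.trail .right then
    let d : Side := if j ∈ P.trail .left then .left else .right
    let lo : Side → List Node := fun e =>
      (P.trail e).filter fun u => σ.Below f (some u) (some j)
    let up : Side → List Node := fun e =>
      (P.trail e).filter fun u => σ.Below f (some j) (some u)
    let S₁ := modify σ.bananas i fun _ =>
      ⟨i, P.upper, trails d (I.trail d ++ up d) (I.trail d.opp ++ j :: up d.opp)⟩
    let S₂ := modify S₁ p fun _ => ⟨p, j, lo⟩
    return { σ with bananas := S₂ }
  else
    return σ

/-- Undo a scare: lower the value of the dummy leaf to just below that of the minimum `μ`, and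
interchange the two minima. -/
def undoScare (f : ℕ → ℝ) (ε : ℝ) (σ : GlueState) (μ : Node) : Option GlueState :=
  interchangeMinima f { σ with alpha := nodeValue f μ - ε } .dummy μ

/-- One iteration of the loop. With `q` the lower of the two current maxima and `q'` the other,
the candidate minima are `μ = Low q` and `κ = Birth q`, or `κ = Birth q'` if `Birth q` is the dummy
leaf. Afterwards `q` is replaced by `Dth (Low q)`. The value is `none` if a pointer that is needed
does not exist or if none of the three cases applies. -/
def glueStep (f : ℕ → ℝ) (ε : ℝ) (σ : GlueState) : Option GlueState := do
  let s : Side := if σ.Below f (some (σ.cur .left)) (some (σ.cur .right)) then .left else .right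
  let q := σ.cur s
  let q' := σ.cur s.opp
  let μ := low σ.bananas q
  let a ← birth σ.bananas q
  let a' ← birth σ.bananas q'
  let κ := if a ≠ .dummy then a else a'
  let τ ←
    if σ.Below f μ (some κ) ∧ κ = a then undoInjury f σ s κ q
    else if σ.Below f μ (some κ) ∧ κ = a' then undoFatality f σ s κ q
    else if σ.Below f (some κ) μ then μ.bind (undoScare f ε σ)
    else none
  let qnext := ((low τ.bananas q).bind (dth τ.bananas)).getD q
  return { τ with cur := fun d => if d = s then qnext else σ.cur d }

/-- Tree `s` consists only of its special root and the dummy leaf. -/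
def GlueState.Empty (σ : GlueState) (s : Side) : Prop :=
  below σ.bananas (.root s) .left = some .dummy ∧ below σ.bananas (.root s) .right = some .dummy

instance (σ : GlueState) (s : Side) : Decidable (σ.Empty s) := by
  unfold GlueState.Empty; infer_instance

/-- The tree whose special root is not discarded after the loop. -/
def GlueState.survivor (σ : GlueState) : Side := if σ.Empty .left then .right else .left

/-- The bananas that remain after the loop, when the special root of the empty tree and the dummy
leaf are discarded. -/
def GlueState.result (σ : GlueState) : List Banana :=
  σ.bananas.filter fun B => B.lower ≠ .dummy ∧ B.upper ≠ .root σ.survivor.opp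

/-! ### Pre-processing

The list `c 1, …, c m` is the concatenation of `c 1, …, c ℓ` and `c (ℓ+1), …, c m`. In the
following, `s` names one of the two parts. -/

/-- The first item of the part. -/
def firstItem (ℓ : ℕ) : Side → ℕ
  | .left => 1
  | .right => ℓ + 1

/-- The last item of the part. -/
def lastItem (ℓ m : ℕ) : Side → ℕ
  | .left => ℓ
  | .right => m

/-- The item of the part at which the parts are connected. -/
def endItem (ℓ : ℕ) : Side → ℕ
  | .left => ℓ
  | .right => ℓ + 1

/-- The position of the hook next to the end item. -/
def endHook (ℓ : ℕ) : Side → ℕ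
  | .left => ℓ + 1
  | .right => ℓ

/-- The end item is down-type, that is, its neighbor in the part has smaller value. -/
def IsDownType (c : ℕ → ℝ) (ℓ : ℕ) : Side → Prop
  | .left => c (ℓ - 1) < c ℓ
  | .right => c (ℓ + 2) < c (ℓ + 1)

instance (c : ℕ → ℝ) (ℓ : ℕ) (s : Side) : Decidable (IsDownType c ℓ s) := by
  cases s <;> unfold IsDownType <;> infer_instance

/-- The minimum of the part, among its items, that is closest to the connection. -/
def closestMin (c : ℕ → ℝ) (ℓ m : ℕ) (ε : ℝ) (s : Side) : Option ℕ :=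
  let x := firstItem ℓ s
  let y := lastItem ℓ m s
  let mins := (List.range' x (y + 1 - x)).filter fun i => IsMinAt (hookedMap c x y ε) x y i
  match s with
  | .left => mins.getLast?
  | .right => mins.head?

/-- The part whose end item has the smaller value. -/
def lowerPart (c : ℕ → ℝ) (ℓ : ℕ) : Side := if c ℓ < c (ℓ + 1) then .left else .right

/-- Pre-processing of the tree `T` of the part with the lower end item: a down-type end item becomes
non-critical and is removed together with its hook. -/
def prepareLower (c : ℕ → ℝ) (ℓ : ℕ) (s : Side) (T : List Banana) : List Banana :=
  if IsDownType c ℓ s then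
    (T.filter fun B => B.lower ≠ .hook (endHook ℓ s)).map fun B =>
      { B with trail := fun d => (B.trail d).filter fun u => u ≠ .item (endItem ℓ s) }
  else T

/-- The leaf of the tree of the part with the higher end item that is replaced by the dummy leaf:
the hook of a down-type end item, and an up-type end item (which becomes non-critical) itself. -/
def dummyLeaf (c : ℕ → ℝ) (ℓ : ℕ) (s : Side) : Node :=
  if IsDownType c ℓ s then .hook (endHook ℓ s) else .item (endItem ℓ s)

/-- The state before the first iteration: the two trees are pre-processed, the dummy leaf takes
over the value of the leaf that it replaces, and the current maxima are the upper ends of the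
bananas of the minimum `a₀` closest to the connection in the lower part and of the dummy leaf in
the higher part. -/
def glueInit (c : ℕ → ℝ) (ℓ m : ℕ) (ε : ℝ) (T : Side → List Banana) : Option GlueState := do
  let s := lowerPart c ℓ
  let t := s.opp
  let x := dummyLeaf c ℓ t
  let S := prepareLower c ℓ s (T s) ++ modify (T t) x fun B => { B with lower := .dummy }
  let a₀ ← closestMin c ℓ m ε s
  let b₀ ← dth S (.item a₀)
  let b₀' ← dth S .dummy
  return {
    bananas := S
    alpha := nodeValue (hookedMap c (firstItem ℓ t) (lastItem ℓ m t) ε) x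
    cur := fun d => if d = s then b₀ else b₀' }

/-- A complete run of `Glue` with `N` iterations, applied to the trees `T left` and `T right`: the
loop body is executed at least once and repeated until one of the two trees is empty. -/
structure IsGlueRun (c : ℕ → ℝ) (ℓ m : ℕ) (ε : ℝ) (T : Side → List Banana) (N : ℕ)
    (run : ℕ → GlueState) : Prop where
  init : glueInit c ℓ m ε T = some (run 0)
  pos : 0 < N
  step : ∀ i < N, glueStep (hookedMap c 1 m ε) ε (run i) = some (run (i + 1))
  continues : ∀ i, 0 < i → i < N → ∀ s, ¬ (run i).Empty s
  stops : ∃ s, (run N).Empty s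

end BananaTree

end

/-!
A binary tree is built from a leaf `k` by joining, from bottom to top, the maxima on the path from
`k` to the root, each with the subtree that it separates from `k`. If `k` is the point of gluing,
these maxima form the right spine of the tree of `g` and the left spine of the tree of `h`, and the
tree of `g · h` arises from `k` by joining both sequences, merged in the order of their values.

The up-tree of a tree of this form is found by scanning the sequence: a maximum whose subtree has
only larger values than the smallest leaf `a` found so far joins the trail of `a`; otherwise it
ends the banana of `a`, and the smallest leaf of its subtree takes over. `Glue` interleaves the two
scans. At each stage, the maxima that are already merged form, together with `k`, a core whose
decomposition is final. The smallest leaf of the core carries on the scan in one of the trees, and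
the dummy leaf does so in the other. Undoing an injury or a fatality merges into the core the passed
maxima below the current one, and then the current one itself; after a fatality the core belongs to
the other tree. Undoing a scare only lets the dummy leaf pass the current maximum. When a tree is
reduced to its special root and the dummy leaf, the other carries the scan of the merged sequence.
-/

noncomputable section

namespace BananaTree

@[simp] theorem Side.opp_opp (s : Side) : s.opp.opp = s := by cases s <;> rfl

@[simp] theorem Side.opp_ne (s : Side) : s.opp ≠ s := by cases s <;> decide

@[simp] theorem Side.ne_opp (s : Side) : s ≠ s.opp := by cases s <;> decide

theorem Side.eq_or_eq_opp (s d : Side) : d = s ∨ d = s.opp := by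
  cases s <;> cases d <;> simp [Side.opp]

theorem Side.forall_iff {p : Side → Prop} (s : Side) : (∀ d, p d) ↔ p s ∧ p s.opp := by
  refine ⟨fun h => ⟨h s, h s.opp⟩, fun h d => ?_⟩
  rcases s.eq_or_eq_opp d with rfl | rfl
  exacts [h.1, h.2]

theorem Side.add_opp {M : Type*} [AddCommMonoid M] (F : Side → M) (s : Side) :
    F s + F s.opp = F .left + F .right := by
  cases s
  · rfl
  · exact add_comm _ _

theorem ne_of_nodup_map_add {α β : Type*} {v : α → β} {M N : Multiset α}
    (h : ((M + N).map v).Nodup) {x y : α} (hx : x ∈ M) (hy : y ∈ N) : v x ≠ v y := by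
  rw [Multiset.map_add] at h
  intro he
  exact Multiset.disjoint_left.mp (Multiset.nodup_add.mp h).2.2 (Multiset.mem_map_of_mem v hx)
    (he ▸ Multiset.mem_map_of_mem v hy)

theorem nodup_map_of_le {α β : Type*} {v : α → β} {M N : Multiset α} (h : (N.map v).Nodup)
    (hle : M ≤ N) : (M.map v).Nodup :=
  Multiset.nodup_of_le (Multiset.map_le_map hle) h

/-! ### Trees along a spine -/

/-- A maximum `node` on a path of a binary tree, together with the subtree `tree` that hangs off
the path there, on side `side`. -/
structure Entry : Type where
  side : Side
  node : Node
  tree : BinTree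

/-- The tree with root `b`, the subtree `O` on side `s` and the subtree `I` on the other side. -/
def BinTree.join (s : Side) (O : BinTree) (b : Node) (I : BinTree) : BinTree :=
  match s with
  | .left => .node O b I
  | .right => .node I b O

/-- Put the entries on top of a tree, one after the other. -/
def build (T : BinTree) (W : List Entry) : BinTree :=
  W.foldl (fun I e => .join e.side e.tree e.node I) T

theorem build_append (T : BinTree) (W W' : List Entry) :
    build T (W ++ W') = build (build T W) W' := by simp [build]

theorem build_concat (T : BinTree) (W : List Entry) (e : Entry) :
    build T (W ++ [e]) = .join e.side e.tree e.node (build T W) := by simp [build]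

/-- All nodes of a list of entries, including those of the subtrees. -/
def nodes (W : List Entry) : Multiset Node :=
  (W.map fun e => e.node ::ₘ (e.tree.inorder : Multiset Node)).sum

@[simp] theorem nodes_nil : nodes [] = 0 := rfl

@[simp] theorem nodes_cons (e : Entry) (W : List Entry) :
    nodes (e :: W) = e.node ::ₘ ((e.tree.inorder : Multiset Node) + nodes W) := by
  rw [nodes, List.map_cons, List.sum_cons, Multiset.cons_add]; rfl

@[simp] theorem nodes_append (W W' : List Entry) : nodes (W ++ W') = nodes W + nodes W' := by
  simp [nodes]

theorem nodes_perm {W W' : List Entry} (h : W.Perm W') : nodes W = nodes W' :=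
  (h.map _).sum_eq

theorem mem_nodes {W : List Entry} {x : Node} :
    x ∈ nodes W ↔ ∃ e ∈ W, x = e.node ∨ x ∈ e.tree.inorder := by
  induction W with
  | nil => simp
  | cons e W ih => simp [ih, or_assoc]

theorem inorder_join (s : Side) (O : BinTree) (b : Node) (I : BinTree) :
    ((BinTree.join s O b I).inorder : Multiset Node) =
      b ::ₘ ((O.inorder : Multiset Node) + (I.inorder : Multiset Node)) := by
  cases s <;> simp only [BinTree.join, BinTree.inorder, ← Multiset.coe_add, ← Multiset.cons_coe,
    Multiset.add_cons]
  rw [add_comm]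

theorem inorder_build (T : BinTree) (W : List Entry) :
    ((build T W).inorder : Multiset Node) = (T.inorder : Multiset Node) + nodes W := by
  induction W using List.reverseRecOn with
  | nil => simp [build]
  | append_singleton W e ih =>
    rw [build_concat, inorder_join, ih, nodes_append, nodes_cons, nodes_nil, add_zero,
      Multiset.add_cons, Multiset.add_cons]
    congr 1
    abel

/-! ### Decompositions along a spine -/

/-- An open path together with a multiset of bananas: a decomposition of a binary tree in which
the irrelevant order of the bananas is forgotten. -/
abbrev Deco := OpenPath × Multiset Banana

/-- The decomposition of a tree. -/
def deco (v : Node → ℝ) (T : BinTree) : Deco :=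
  ((decompose v T).1, ((decompose v T).2 : Multiset Banana))

/-- All bananas of a decomposition, with the open path closed at `β`. -/
def Deco.close (X : Deco) (β : Node) : Multiset Banana := X.1.close β ::ₘ X.2

/-- The smallest leaf of a tree whose values increase towards the root: the leaf whose path is open
at the root. -/
def BinTree.minLeaf (v : Node → ℝ) (T : BinTree) : Node := (deco v T).1.lower

/-- The smallest leaf of the subtree of an entry. -/
def Entry.minLeaf (v : Node → ℝ) (e : Entry) : Node := e.tree.minLeaf v

/-- The decomposition after a new entry whose maximum closes the open path; the path from the
subtree of the entry takes over. -/
def Deco.turn (v : Node → ℝ) (X : Deco) (e : Entry) : Deco :=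
  ((deco v e.tree).1.extend e.side.opp e.node,
    X.1.close e.node ::ₘ ((deco v e.tree).2 + X.2))

/-- The decomposition after a new entry whose maximum is passed by the open path. -/
def Deco.pass (v : Node → ℝ) (X : Deco) (e : Entry) : Deco :=
  (X.1.extend e.side e.node, (deco v e.tree).1.close e.node ::ₘ ((deco v e.tree).2 + X.2))

/-- The decomposition after a new entry: of the two paths that meet at its maximum, the one with
the smaller lower end continues. -/
def Deco.step (v : Node → ℝ) (X : Deco) (e : Entry) : Deco :=
  if v (e.minLeaf v) < v X.1.lower then X.turn v e else X.pass v e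

theorem deco_join (v : Node → ℝ) (e : Entry) (I : BinTree)
    (h : v (e.minLeaf v) ≠ v (I.minLeaf v)) :
    deco v (.join e.side e.tree e.node I) = (deco v I).step v e := by
  obtain ⟨s, b, O⟩ := e
  rcases lt_or_gt_of_ne h with h' | h'
  · refine Eq.trans ?_ (if_pos h').symm
    simp only [Entry.minLeaf, BinTree.minLeaf, deco] at h'
    cases s
    · simp [BinTree.join, deco, decompose, Deco.turn, Side.opp, if_pos h']
    · simp [BinTree.join, deco, decompose, Deco.turn, Side.opp, if_neg h'.not_gt,
        ← Multiset.coe_add, ← Multiset.cons_coe, add_comm]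
  · refine Eq.trans ?_ (if_neg h'.not_gt).symm
    simp only [Entry.minLeaf, BinTree.minLeaf, deco] at h'
    cases s
    · simp [BinTree.join, deco, decompose, Deco.pass, if_neg h'.not_gt]
    · simp [BinTree.join, deco, decompose, Deco.pass, if_pos h',
        ← Multiset.coe_add, ← Multiset.cons_coe, add_comm]

theorem BinTree.minLeaf_mem (v : Node → ℝ) (T : BinTree) : T.minLeaf v ∈ T.inorder := by
  induction T with
  | leaf a => simp [minLeaf, deco, decompose, inorder]
  | node l b r ihl ihr =>
    simp only [minLeaf, deco] at ihl ihr
    simp only [minLeaf, deco, decompose, inorder]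
    split_ifs
    · exact List.mem_append_left _ ihl
    · exact List.mem_append_right _ (List.mem_cons_of_mem _ ihr)

theorem Entry.minLeaf_mem_nodes (v : Node → ℝ) {e : Entry} {W : List Entry} (he : e ∈ W) :
    e.minLeaf v ∈ nodes W :=
  mem_nodes.mpr ⟨e, he, Or.inr (e.tree.minLeaf_mem v)⟩

theorem Entry.node_mem_nodes {e : Entry} {W : List Entry} (he : e ∈ W) : e.node ∈ nodes W :=
  mem_nodes.mpr ⟨e, he, Or.inl rfl⟩

theorem deco_build {v : Node → ℝ} {T : BinTree} {W : List Entry}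
    (h : (((T.inorder : Multiset Node) + nodes W).map v).Nodup) :
    deco v (build T W) = W.foldl (Deco.step v) (deco v T) := by
  induction W using List.reverseRecOn with
  | nil => rfl
  | append_singleton W e ih =>
    rw [nodes_append, ← add_assoc] at h
    have hne : v (e.minLeaf v) ≠ v ((build T W).minLeaf v) :=
      (ne_of_nodup_map_add h (by rw [← inorder_build]; exact (build T W).minLeaf_mem v)
        (e.minLeaf_mem_nodes v (List.mem_singleton_self e))).symm
    rw [build_concat, deco_join _ _ _ hne, List.foldl_append,
      ih (nodup_map_of_le h (Multiset.le_add_right _ _))]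
    rfl

/-- Extend an open path by all entries of a list, each on its side. -/
def OpenPath.addAll (P : OpenPath) (W : List Entry) : OpenPath :=
  ⟨P.lower, fun d => P.trail d ++ (W.filter fun e => e.side = d).map Entry.node⟩

@[simp] theorem OpenPath.addAll_nil (P : OpenPath) : P.addAll [] = P := by
  simp [OpenPath.addAll]

theorem OpenPath.addAll_cons (P : OpenPath) (e : Entry) (W : List Entry) :
    P.addAll (e :: W) = (P.extend e.side e.node).addAll W := by
  simp only [OpenPath.addAll, OpenPath.extend, OpenPath.mk.injEq, true_and]
  funext d
  by_cases h : e.side = d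
  · simp [h]
  · simp [h, Ne.symm h]

theorem OpenPath.addAll_trail_of_side (P : OpenPath) {W : List Entry} {d : Side}
    (h : ∀ e ∈ W, e.side = d) : (P.addAll W).trail d = P.trail d ++ W.map Entry.node := by
  simp only [OpenPath.addAll]
  rw [List.filter_eq_self.mpr (by simpa using h)]

theorem OpenPath.addAll_trail_of_side_ne (P : OpenPath) {W : List Entry} {d d' : Side}
    (h : ∀ e ∈ W, e.side = d) (hd : d ≠ d') : (P.addAll W).trail d' = P.trail d' := by
  have hnil : (W.filter fun e => e.side = d') = [] :=
    List.filter_eq_nil_iff.mpr fun e he => by simp [h e he, hd]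
  simp [OpenPath.addAll, hnil]

/-- The bananas in the subtrees of a list of entries that are passed by a path. -/
def hang (v : Node → ℝ) (W : List Entry) : Multiset Banana :=
  (W.map fun e => (deco v e.tree).1.close e.node ::ₘ (deco v e.tree).2).sum

@[simp] theorem hang_nil (v : Node → ℝ) : hang v [] = 0 := rfl

@[simp] theorem hang_cons (v : Node → ℝ) (e : Entry) (W : List Entry) :
    hang v (e :: W) = (deco v e.tree).1.close e.node ::ₘ ((deco v e.tree).2 + hang v W) := by
  simp [hang]

@[simp] theorem hang_append (v : Node → ℝ) (W W' : List Entry) :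
    hang v (W ++ W') = hang v W + hang v W' := by
  simp [hang]

theorem hang_perm (v : Node → ℝ) {W W' : List Entry} (h : W.Perm W') : hang v W = hang v W' :=
  (h.map _).sum_eq

theorem foldl_step_of_lt {v : Node → ℝ} (X : Deco) {W : List Entry}
    (h : ∀ e ∈ W, v X.1.lower < v (e.minLeaf v)) :
    W.foldl (Deco.step v) X = (X.1.addAll W, X.2 + hang v W) := by
  induction W generalizing X with
  | nil => simp
  | cons e W ih =>
    have hpass : X.step v e = X.pass v e := if_neg (h e List.mem_cons_self).not_gt
    rw [List.foldl_cons, hpass, ih]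
    · simp only [Deco.pass, OpenPath.addAll_cons, hang_cons, Multiset.cons_add, Multiset.add_cons]
      congr 2
      abel
    · exact fun e' he' => h e' (List.mem_cons_of_mem _ he')

theorem deco_build_of_lt {v : Node → ℝ} {T : BinTree} {W : List Entry}
    (h : ∀ e ∈ W, v (T.minLeaf v) < v (e.minLeaf v)) :
    deco v (build T W) = ((deco v T).1.addAll W, (deco v T).2 + hang v W) := by
  rw [← foldl_step_of_lt _ h]
  induction W using List.reverseRecOn with
  | nil => rfl
  | append_singleton W e ih =>
    have hW : ∀ e ∈ W, v (T.minLeaf v) < v (e.minLeaf v) := fun e' he' =>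
      h e' (List.mem_append_left _ he')
    have hmin : (build T W).minLeaf v = T.minLeaf v := by
      rw [BinTree.minLeaf, ih hW, foldl_step_of_lt _ hW]; rfl
    rw [build_concat, deco_join, ih hW, List.foldl_append]
    · rfl
    · rw [hmin]
      exact (h e (by simp)).ne'

theorem foldl_step_add (v : Node → ℝ) (P : OpenPath) (Y Z : Multiset Banana) (W : List Entry) :
    W.foldl (Deco.step v) (P, Y + Z) =
      ((W.foldl (Deco.step v) (P, Y)).1, (W.foldl (Deco.step v) (P, Y)).2 + Z) := by
  induction W generalizing P Y with
  | nil => rfl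
  | cons e W ih =>
    simp only [List.foldl_cons, Deco.step]
    split_ifs
    · simp only [Deco.turn]
      rw [← ih, Multiset.cons_add, add_assoc]
    · simp only [Deco.pass]
      rw [← ih, Multiset.cons_add, add_assoc]

/-- The node at the lower end of the rest of the spine of a tree with special root `root s`. -/
def top (s : Side) : List Entry → Node
  | [] => .root s
  | e :: _ => e.node

/-- The bananas contributed by the rest of the spine above a path that ends at its first entry. -/
def rest (v : Node → ℝ) (s : Side) : List Entry → Multiset Banana
  | [] => 0
  | e :: W =>
    let Z := W.foldl (Deco.step v) ((deco v e.tree).1.extend e.side.opp e.node, (deco v e.tree).2)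
    Z.close (.root s)

/-- The initial entries that are passed by a path with lower end `a`. -/
def near (v : Node → ℝ) (a : Node) (W : List Entry) : List Entry :=
  W.takeWhile fun e => v a < v (e.minLeaf v)

/-- The remaining entries, from the upper end of a path with lower end `a` on. -/
def far (v : Node → ℝ) (a : Node) (W : List Entry) : List Entry :=
  W.dropWhile fun e => v a < v (e.minLeaf v)

theorem near_append_far (v : Node → ℝ) (a : Node) (W : List Entry) :
    near v a W ++ far v a W = W := List.takeWhile_append_dropWhile

theorem length_far_le (v : Node → ℝ) (a : Node) (W : List Entry) :
    (far v a W).length ≤ W.length := (List.dropWhile_sublist _).length_le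

theorem lt_of_mem_near {v : Node → ℝ} {a : Node} {W : List Entry} {e : Entry}
    (h : e ∈ near v a W) : v a < v (e.minLeaf v) := by
  simpa using List.mem_takeWhile_imp h

theorem lt_of_mem_head_far {v : Node → ℝ} {a : Node} {W : List Entry}
    (hne : ∀ e ∈ W, v (e.minLeaf v) ≠ v a) {e : Entry} (he : e ∈ (far v a W).head?) :
    v (e.minLeaf v) < v a := by
  refine lt_of_le_of_ne ?_ (hne e ((List.dropWhile_sublist _).mem (List.mem_of_mem_head? he)))
  have hnot := List.head?_dropWhile_not (fun e : Entry => decide (v a < v (e.minLeaf v))) W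
  unfold far at he
  rw [Option.mem_def.mp he] at hnot
  simpa using hnot

theorem foldl_step_append_close {v : Node → ℝ} (s : Side) (X : Deco) {A T : List Entry}
    (hA : ∀ e ∈ A, v X.1.lower < v (e.minLeaf v))
    (hT : ∀ e ∈ T.head?, v (e.minLeaf v) < v X.1.lower) :
    ((A ++ T).foldl (Deco.step v) X).close (.root s) =
      (X.1.addAll A).close (top s T) ::ₘ (X.2 + hang v A + rest v s T) := by
  rw [List.foldl_append, foldl_step_of_lt X hA]
  cases T with
  | nil => simp [top, rest, Deco.close]
  | cons e T =>
    have hturn : Deco.step v (X.1.addAll A, X.2 + hang v A) e =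
        Deco.turn v (X.1.addAll A, X.2 + hang v A) e := if_pos (hT e rfl)
    rw [List.foldl_cons, hturn]
    simp only [Deco.turn, top, rest, Deco.close]
    rw [← Multiset.add_cons, foldl_step_add]
    simp only [Multiset.add_cons]
    rw [Multiset.cons_swap, add_comm]

theorem foldl_step_close {v : Node → ℝ} (s : Side) (X : Deco) {W : List Entry}
    (h : ∀ e ∈ W, v (e.minLeaf v) ≠ v X.1.lower) :
    (W.foldl (Deco.step v) X).close (.root s) =
      (X.1.addAll (near v X.1.lower W)).close (top s (far v X.1.lower W)) ::ₘ
        (X.2 + hang v (near v X.1.lower W) + rest v s (far v X.1.lower W)) := by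
  rw [← foldl_step_append_close s X (fun e he => lt_of_mem_near he)
    fun e he => lt_of_mem_head_far h he, near_append_far]

theorem rest_cons {v : Node → ℝ} (s : Side) (e : Entry) {W : List Entry}
    (h : ∀ e' ∈ W, v (e'.minLeaf v) ≠ v (e.minLeaf v)) :
    rest v s (e :: W) =
      (((deco v e.tree).1.extend e.side.opp e.node).addAll
        (near v (e.minLeaf v) W)).close (top s (far v (e.minLeaf v) W)) ::ₘ
        ((deco v e.tree).2 + hang v (near v (e.minLeaf v) W) +
          rest v s (far v (e.minLeaf v) W)) :=
  foldl_step_close s ((deco v e.tree).1.extend e.side.opp e.node, (deco v e.tree).2) h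

/-- The nodes of an open path. -/
def OpenPath.foot (P : OpenPath) : Multiset Node :=
  P.lower ::ₘ ((P.trail .left : Multiset Node) + (P.trail .right : Multiset Node))

/-- The nodes of a banana other than its upper end. -/
def Banana.foot (B : Banana) : Multiset Node :=
  B.lower ::ₘ ((B.trail .left : Multiset Node) + (B.trail .right : Multiset Node))

@[simp] theorem OpenPath.foot_close (P : OpenPath) (b : Node) : (P.close b).foot = P.foot := rfl

theorem Banana.mem_foot {B : Banana} {x : Node} :
    x ∈ B.foot ↔ x = B.lower ∨ x ∈ B.trail .left ∨ x ∈ B.trail .right := by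
  simp [Banana.foot]

theorem Banana.mem_foot_of_mem_trail {B : Banana} {x : Node} {d : Side} (h : x ∈ B.trail d) :
    x ∈ B.foot := by
  rw [Banana.mem_foot]; cases d <;> simp [h]

theorem OpenPath.mem_foot_of_mem_trail {P : OpenPath} {x : Node} {d : Side} (h : x ∈ P.trail d) :
    x ∈ P.foot := Banana.mem_foot_of_mem_trail (B := P.close x) h

@[simp] theorem OpenPath.foot_extend (P : OpenPath) (d : Side) (b : Node) :
    (P.extend d b).foot = b ::ₘ P.foot := by
  cases d <;> simp [OpenPath.foot, OpenPath.extend, ← Multiset.coe_add,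
    ← Multiset.singleton_add, add_assoc, add_left_comm, add_comm]

/-- The nodes of a multiset of bananas, without the upper ends. -/
def feet (S : Multiset Banana) : Multiset Node := (S.map Banana.foot).sum

@[simp] theorem feet_zero : feet 0 = 0 := rfl

@[simp] theorem feet_cons (B : Banana) (S : Multiset Banana) :
    feet (B ::ₘ S) = B.foot + feet S := by simp [feet]

@[simp] theorem feet_add (S S' : Multiset Banana) : feet (S + S') = feet S + feet S' := by
  simp [feet]

theorem feet_deco (v : Node → ℝ) (T : BinTree) :
    (deco v T).1.foot + feet (deco v T).2 = (T.inorder : Multiset Node) := by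
  induction T with
  | leaf a => simp [deco, decompose, OpenPath.foot, BinTree.inorder]
  | node l b r ihl ihr =>
    simp only [deco] at ihl ihr
    simp only [deco, decompose, BinTree.inorder]
    rw [← Multiset.coe_add, ← Multiset.cons_coe, ← ihl, ← ihr]
    split_ifs <;>
    · simp only [OpenPath.foot_extend, ← Multiset.cons_coe, ← Multiset.coe_add, feet_cons,
        feet_add, OpenPath.foot_close]
      simp only [← Multiset.singleton_add]
      abel

theorem upper_deco_le (v : Node → ℝ) (T : BinTree) :
    (deco v T).2.map Banana.upper ≤ (T.inorder : Multiset Node) := by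
  induction T with
  | leaf a => simp [deco, decompose]
  | node l b r ihl ihr =>
    simp only [deco] at ihl ihr
    have key : b ::ₘ (((decompose v l).2 : Multiset Banana).map Banana.upper +
        ((decompose v r).2 : Multiset Banana).map Banana.upper) ≤
        ((BinTree.node l b r).inorder : Multiset Node) := by
      rw [BinTree.inorder, ← Multiset.coe_add, ← Multiset.cons_coe, Multiset.add_cons]
      exact Multiset.cons_le_cons _ (add_le_add ihl ihr)
    simp only [deco, decompose]
    split_ifs <;>
    · rw [← Multiset.cons_coe, ← Multiset.coe_add, Multiset.map_cons, Multiset.map_add]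
      exact key

theorem feet_hang (v : Node → ℝ) (W : List Entry) :
    (W.map Entry.node : Multiset Node) + feet (hang v W) = nodes W := by
  induction W with
  | nil => simp
  | cons e W ih =>
    rw [hang_cons, nodes_cons, ← ih, ← feet_deco v e.tree]
    simp only [feet_cons, feet_add, OpenPath.foot_close, List.map_cons, ← Multiset.cons_coe]
    simp only [← Multiset.singleton_add]
    abel

theorem upper_hang_le (v : Node → ℝ) (W : List Entry) :
    (hang v W).map Banana.upper ≤ nodes W := by
  induction W with
  | nil => simp
  | cons e W ih =>
    rw [hang_cons, nodes_cons, Multiset.map_cons, Multiset.map_add]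
    exact Multiset.cons_le_cons _ (add_le_add (upper_deco_le v _) ih)

theorem feet_foldl (v : Node → ℝ) (X : Deco) (W : List Entry) :
    (W.foldl (Deco.step v) X).1.foot + feet (W.foldl (Deco.step v) X).2 =
      X.1.foot + feet X.2 + nodes W := by
  induction W generalizing X with
  | nil => simp
  | cons e W ih =>
    rw [List.foldl_cons, ih, nodes_cons, ← feet_deco v e.tree]
    unfold Deco.step
    split_ifs <;>
    · simp only [Deco.turn, Deco.pass, feet_cons, feet_add, OpenPath.foot_close,
        OpenPath.foot_extend]
      simp only [← Multiset.singleton_add]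
      abel

theorem upper_foldl_le (v : Node → ℝ) (X : Deco) (W : List Entry) :
    (W.foldl (Deco.step v) X).2.map Banana.upper ≤ X.2.map Banana.upper + nodes W := by
  induction W generalizing X with
  | nil => simp
  | cons e W ih =>
    rw [List.foldl_cons]
    refine (ih _).trans ?_
    rw [nodes_cons]
    have h := upper_deco_le v e.tree
    have key : e.node ::ₘ ((deco v e.tree).2.map Banana.upper + X.2.map Banana.upper) + nodes W ≤
        X.2.map Banana.upper + e.node ::ₘ ((e.tree.inorder : Multiset Node) + nodes W) := by
      rw [Multiset.cons_add, Multiset.add_cons]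
      refine Multiset.cons_le_cons _ ?_
      rw [add_comm (Multiset.map _ _), add_assoc]
      gcongr
    unfold Deco.step
    split_ifs <;> simpa [Deco.turn, Deco.pass, OpenPath.close] using key

theorem feet_rest (v : Node → ℝ) (s : Side) (W : List Entry) : feet (rest v s W) = nodes W := by
  cases W with
  | nil => simp [rest]
  | cons e W =>
    simp only [rest, Deco.close, feet_cons, OpenPath.foot_close]
    rw [feet_foldl, nodes_cons, OpenPath.foot_extend, Multiset.cons_add, feet_deco,
      Multiset.cons_add]

theorem upper_rest_le (v : Node → ℝ) (s : Side) (W : List Entry) :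
    top s W ::ₘ (rest v s W).map Banana.upper ≤ .root s ::ₘ nodes W := by
  cases W with
  | nil => simp [rest, top]
  | cons e W =>
    simp only [rest, Deco.close, Multiset.map_cons, top, nodes_cons]
    rw [Multiset.cons_swap]
    refine Multiset.cons_le_cons _ (Multiset.cons_le_cons _ ((upper_foldl_le v _ W).trans ?_))
    gcongr
    exact upper_deco_le v e.tree

/-! ### Following pointers -/

theorem find?_eq_some_of_unique {α : Type*} {p : α → Bool} {S : List α} {B : α} (hB : B ∈ S)
    (hp : p B) (h : ∀ B' ∈ S, p B' → B' = B) : S.find? p = some B := by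
  cases hf : S.find? p with
  | none => exact absurd hp (by simpa using List.find?_eq_none.mp hf B hB)
  | some B' => rw [h B' (List.mem_of_find?_eq_some hf) (List.find?_some hf)]

theorem mem_feet {S : Multiset Banana} {x : Node} : x ∈ feet S ↔ ∃ B ∈ S, x ∈ B.foot := by
  induction S using Multiset.induction_on with
  | empty => simp
  | cons B S ih => simp [ih]

theorem eq_of_mem_foot {S : Multiset Banana} (h : (feet S).Nodup) {B B' : Banana} (hB : B ∈ S)
    (hB' : B' ∈ S) {x : Node} (hx : x ∈ B.foot) (hx' : x ∈ B'.foot) : B = B' := by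
  by_contra hne
  obtain ⟨R, rfl⟩ := Multiset.exists_cons_of_mem hB
  have hR : B' ∈ R := (Multiset.mem_cons.mp hB').resolve_left (Ne.symm hne)
  rw [feet_cons] at h
  exact Multiset.disjoint_left.mp (Multiset.nodup_add.mp h).2.2 hx (mem_feet.mpr ⟨B', hR, hx'⟩)

theorem Banana.lower_mem_foot (B : Banana) : B.lower ∈ B.foot := Multiset.mem_cons_self _ _

theorem bananaAt_lower {S : List Banana} (h : (feet (S : Multiset Banana)).Nodup) {B : Banana}
    (hB : B ∈ S) : bananaAt S B.lower = some B := by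
  refine find?_eq_some_of_unique hB (by simp) fun B' hB' hp => ?_
  have hp : B'.lower = B.lower := by simpa using hp
  exact eq_of_mem_foot h hB' hB B'.lower_mem_foot (hp ▸ B.lower_mem_foot)

theorem dth_lower {S : List Banana} (h : (feet (S : Multiset Banana)).Nodup) {B : Banana}
    (hB : B ∈ S) : dth S B.lower = some B.upper := by
  rw [dth, bananaAt_lower h hB]; rfl

theorem low_eq_lower {S : List Banana} (h : (feet (S : Multiset Banana)).Nodup) {B : Banana}
    (hB : B ∈ S) {x : Node} (hx : x ∈ B.foot) : low S x = some B.lower := by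
  rw [low, find?_eq_some_of_unique hB (by simpa [Banana.mem_foot] using hx)
    fun B' hB' hp => eq_of_mem_foot h hB' hB (x := x) ?_ hx]
  · rfl
  · simpa [Banana.mem_foot] using hp

theorem low_eq_none {S : List Banana} {x : Node} (hx : x ∉ feet (S : Multiset Banana)) :
    low S x = none := by
  rw [low, List.find?_eq_none.mpr]
  · rfl
  · intro B hB hp
    exact hx (mem_feet.mpr ⟨B, hB, by simpa [Banana.mem_foot] using hp⟩)

theorem find?_upper {S : List Banana} (h : ((S : Multiset Banana).map Banana.upper).Nodup)
    {B : Banana} (hB : B ∈ S) : (S.find? fun B' => B'.upper = B.upper) = some B :=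
  find?_eq_some_of_unique hB (by simp) fun B' hB' hp =>
    Multiset.inj_on_of_nodup_map h B' hB' B hB (by simpa using hp)

theorem birth_upper {S : List Banana} (h : ((S : Multiset Banana).map Banana.upper).Nodup)
    {B : Banana} (hB : B ∈ S) : birth S B.upper = some B.lower := by
  rw [birth, find?_upper h hB]; rfl

theorem below_upper {S : List Banana} (h : ((S : Multiset Banana).map Banana.upper).Nodup)
    {B : Banana} (hB : B ∈ S) (d : Side) :
    below S B.upper d = some (((B.trail d).getLast?).getD B.lower) := by
  rw [below, find?_upper h hB]; rfl

theorem modify_cons {S : List Banana} {B : Banana} {R : Multiset Banana} {a : Node}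
    (hS : (S : Multiset Banana) = B ::ₘ R) (ha : B.lower = a) (hR : ∀ B' ∈ R, B'.lower ≠ a)
    (φ : Banana → Banana) : (modify S a φ : Multiset Banana) = φ B ::ₘ R := by
  rw [modify, ← Multiset.map_coe, hS, Multiset.map_cons, if_pos ha]
  congr 1
  conv_rhs => rw [← Multiset.map_id R]
  exact Multiset.map_congr rfl fun B' hB' => if_neg (hR B' hB')

theorem lower_ne_of_feet_nodup {B : Banana} {R : Multiset Banana}
    (h : (feet (B ::ₘ R)).Nodup) : ∀ B' ∈ R, B'.lower ≠ B.lower := by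
  intro B' hB' he
  rw [feet_cons] at h
  exact Multiset.disjoint_left.mp (Multiset.nodup_add.mp h).2.2 B.lower_mem_foot
    (mem_feet.mpr ⟨B', hB', he ▸ B'.lower_mem_foot⟩)

theorem modify_modify {S : List Banana} {A K A' K' : Banana} {R : Multiset Banana} {a b : Node}
    (hS : (S : Multiset Banana) = A ::ₘ K ::ₘ R) (h : (feet (S : Multiset Banana)).Nodup)
    (ha : A.lower = a) (hb : K.lower = b) (hA' : A'.lower = a) :
    (modify (modify S a fun _ => A') b fun _ => K' : Multiset Banana) =
      A' ::ₘ K' ::ₘ R := by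
  subst ha hb
  rw [hS] at h
  have hA := lower_ne_of_feet_nodup h
  have h' : (feet (K ::ₘ R)).Nodup := by
    rw [feet_cons] at h
    exact (Multiset.nodup_add.mp h).2.1
  have hK := lower_ne_of_feet_nodup h'
  rw [Multiset.cons_swap]
  refine modify_cons ?_ rfl ?_ _
  · rw [modify_cons hS rfl hA, Multiset.cons_swap]
  · intro B hB
    rcases Multiset.mem_cons.mp hB with rfl | hB
    · rw [hA']
      exact (hA K (Multiset.mem_cons_self _ _)).symm
    · exact hK B hB

/-! ### Comparing nodes -/

/-- Items and hooks. -/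
def Node.IsReal : Node → Prop
  | .item _ => True
  | .hook _ => True
  | _ => False

theorem Node.IsReal.ne_dummy {x : Node} (h : x.IsReal) : x ≠ .dummy := by
  rintro rfl; exact h

theorem Node.IsReal.ne_root {x : Node} (h : x.IsReal) (s : Side) : x ≠ .root s := by
  rintro rfl; exact h

theorem GlueState.below_real {f : ℕ → ℝ} {σ : GlueState} {x y : Node} (hx : x.IsReal)
    (hy : y.IsReal) : σ.Below f (some x) (some y) ↔ nodeValue f x < nodeValue f y := by
  unfold GlueState.Below
  cases x <;> cases y <;> simp_all [Node.IsReal, height, nodeValue, Prod.Lex.toLex_lt_toLex]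

theorem GlueState.below_root {f : ℕ → ℝ} {σ : GlueState} {x : Node} (hx : x.IsReal) (s : Side) :
    σ.Below f (some x) (some (.root s)) := by
  unfold GlueState.Below
  cases x <;> cases s <;> simp_all [Node.IsReal, height, Prod.Lex.toLex_lt_toLex]

theorem GlueState.none_below {f : ℕ → ℝ} {σ : GlueState} {x : Node} (hx : x.IsReal) :
    σ.Below f none (some x) := by
  unfold GlueState.Below
  cases x <;> simp_all [Node.IsReal, height, Prod.Lex.toLex_lt_toLex]

theorem GlueState.below_roots {f : ℕ → ℝ} {σ : GlueState} {s : Side} :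
    σ.Below f (some (.root s)) (some (.root s.opp)) ↔ s = .right := by
  unfold GlueState.Below
  cases s <;> simp [height, Side.opp, Prod.Lex.toLex_lt_toLex]

/-! ### Lists of entries -/

theorem filter_append_filter {α : Type*} {p : α → Prop} [DecidablePred p] {l : List α}
    (h : l.Pairwise fun a b => p b → p a) :
    (l.filter fun a => p a) ++ (l.filter fun a => ¬ p a) = l := by
  induction l with
  | nil => rfl
  | cons a l ih =>
    rw [List.pairwise_cons] at h
    by_cases ha : p a
    · simpa [ha] using ih h.2
    · have : ∀ b ∈ l, ¬ p b := fun b hb hpb => ha (h.1 b hb hpb)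
      rw [List.filter_eq_nil_iff.mpr, List.filter_eq_self.mpr]
      · rfl
      · simpa [ha] using this
      · simpa [ha] using this

theorem filter_side_perm (t : Side) (U : List Entry) :
    (U.filter (fun e => e.side = t) ++ U.filter (fun e => e.side = t.opp)).Perm U := by
  have : U.filter (fun e => e.side = t.opp) = U.filter (fun e => !decide (e.side = t)) := by
    refine List.filter_congr fun e _ => ?_
    rcases Side.eq_or_eq_opp t e.side with h | h <;> simp [h]
  rw [this]
  exact List.filter_append_perm _ U

/-- The maxima of the entries of a list increase. -/
abbrev Rising (v : Node → ℝ) (W : List Entry) : Prop :=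
  W.Pairwise fun e e' => v e.node < v e'.node

theorem Rising.eq_of_perm {v : Node → ℝ} {W W' : List Entry} (h : Rising v W) (h' : Rising v W')
    (hp : W.Perm W') : W = W' :=
  hp.eq_of_pairwise (fun _ _ _ _ hab hba => absurd hba hab.asymm) h h'

theorem exists_rising_filter_eq {v : Node → ℝ} {L : Side → List Entry}
    (hside : ∀ d, ∀ e ∈ L d, e.side = d) (hL : ∀ d, Rising v (L d))
    (hne : ∀ a ∈ L .left, ∀ b ∈ L .right, v a.node ≠ v b.node) :
    ∃ C : List Entry, Rising v C ∧ ∀ d, (C.filter fun e => e.side = d) = L d := by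
  let C := (L .left ++ L .right).mergeSort fun e e' => decide (v e.node ≤ v e'.node)
  have hperm : C.Perm (L .left ++ L .right) := List.mergeSort_perm _ _
  have hdistinct : (L .left ++ L .right).Pairwise fun e e' => v e.node ≠ v e'.node :=
    List.pairwise_append.mpr ⟨(hL _).imp ne_of_lt, (hL _).imp ne_of_lt, hne⟩
  have hle : C.Pairwise fun e e' => v e.node ≤ v e'.node := by
    refine (List.pairwise_mergeSort ?_ ?_ _).imp fun h => of_decide_eq_true h
    · exact fun a b c hab hbc =>
        decide_eq_true ((of_decide_eq_true hab).trans (of_decide_eq_true hbc))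
    · exact fun a b => by simpa using le_total (v a.node) (v b.node)
  have hC : Rising v C :=
    (hle.and ((hperm.pairwise_iff fun h => h.symm).mpr hdistinct)).imp fun h =>
      lt_of_le_of_ne h.1 h.2
  refine ⟨C, hC, fun d => Rising.eq_of_perm (hC.filter _) (hL d)
    ((hperm.filter _).trans (.of_eq ?_))⟩
  have hnil : ∀ d, ((L d.opp).filter fun e => e.side = d) = [] := fun d =>
    List.filter_eq_nil_iff.mpr fun e he => by simp [hside _ e he]
  have hself : ((L d).filter fun e => e.side = d) = L d :=
    List.filter_eq_self.mpr fun e he => by simp [hside d e he]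
  rw [List.filter_append]
  cases d
  · rw [hself, show (L .right).filter _ = [] from hnil .left, List.append_nil]
  · rw [hself, show (L .left).filter _ = [] from hnil .right, List.nil_append]

theorem nodes_filter_add (t : Side) (U : List Entry) :
    nodes (U.filter fun e => e.side = t) + nodes (U.filter fun e => e.side = t.opp) = nodes U := by
  rw [← nodes_append, nodes_perm (filter_side_perm t U)]

theorem hang_filter_add (v : Node → ℝ) (t : Side) (U : List Entry) :
    hang v (U.filter fun e => e.side = t) + hang v (U.filter fun e => e.side = t.opp) =
      hang v U := by
  rw [← hang_append, hang_perm v (filter_side_perm t U)]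

/-! ### Partially merged spines -/

/-- The leaf `k` at which two trees are glued, and the two spines that are merged, each from bottom
to top. -/
structure Frame (v : Node → ℝ) (k : Node) (W : Side → List Entry) : Prop where
  side : ∀ d, ∀ e ∈ W d, e.side = d
  real : ∀ x ∈ k ::ₘ (nodes (W .left) + nodes (W .right)), x.IsReal
  nodup : ((k ::ₘ (nodes (W .left) + nodes (W .right))).map v).Nodup
  rising : ∀ d, Rising v (W d)
  heap : ∀ d, ∀ e ∈ W d, ∀ x ∈ e.tree.inorder, v x < v e.node
  leaf : ∀ d, ∀ e ∈ W d, v k < v e.node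

/-- The tree that consists of the leaf `k` and the merged entries `U`. -/
def core (k : Node) (U : List Entry) : BinTree := build (.leaf k) U

/-- A partial merge of the spines `W`: the entries of `U` are merged, and of the others on side `d`,
those of `P d` are passed by the path that ends at the first entry of `T d`. -/
structure Merge (v : Node → ℝ) (k : Node) (W : Side → List Entry) (U : List Entry)
    (P T : Side → List Entry) : Prop where
  split : ∀ d, (U.filter fun e => e.side = d) ++ (P d ++ T d) = W d
  rising : Rising v U
  sep : ∀ u ∈ U, ∀ d, ∀ e ∈ P d ++ T d, v u.node < v e.node
  passed : ∀ d, ∀ e ∈ P d, v ((core k U).minLeaf v) < v (e.minLeaf v)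

theorem inorder_core (k : Node) (U : List Entry) :
    ((core k U).inorder : Multiset Node) = k ::ₘ nodes U := by
  rw [core, inorder_build]; rfl

section

variable {v : Node → ℝ} {k : Node} {W : Side → List Entry}

theorem Frame.nodup_nodes (hF : Frame v k W) :
    (k ::ₘ (nodes (W .left) + nodes (W .right))).Nodup := Multiset.Nodup.of_map _ hF.nodup

theorem Frame.real_of_mem (hF : Frame v k W) {d : Side} {x : Node} (hx : x ∈ nodes (W d)) :
    x.IsReal := by
  refine hF.real x (Multiset.mem_cons_of_mem ?_)
  rw [← Side.add_opp (fun d => nodes (W d)) d]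
  exact Multiset.mem_add.mpr (Or.inl hx)

theorem Frame.real_node (hF : Frame v k W) {d : Side} {e : Entry} (he : e ∈ W d) :
    e.node.IsReal := hF.real_of_mem (e.node_mem_nodes he)

theorem Frame.real_minLeaf (hF : Frame v k W) {d : Side} {e : Entry} (he : e ∈ W d) :
    (e.minLeaf v).IsReal := hF.real_of_mem (e.minLeaf_mem_nodes v he)

theorem Frame.node_ne (hF : Frame v k W) {d : Side} {a b : Entry} (ha : a ∈ W d)
    (hb : b ∈ W d.opp) : v a.node ≠ v b.node := by
  have h := nodup_map_of_le hF.nodup (Multiset.le_cons_self _ _)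
  rw [← Side.add_opp (fun d => nodes (W d)) d] at h
  exact ne_of_nodup_map_add h (a.node_mem_nodes ha) (b.node_mem_nodes hb)

theorem Frame.minLeaf_ne_of_append (hF : Frame v k W) {d : Side} {e : Entry} {V V' : List Entry}
    (hV : V' ++ e :: V = W d) : ∀ e' ∈ V, v (e'.minLeaf v) ≠ v (e.minLeaf v) := by
  intro e' he'
  have hle : nodes [e] + nodes V ≤ k ::ₘ (nodes (W .left) + nodes (W .right)) := by
    rw [← Side.add_opp (fun d => nodes (W d)) d, ← hV, ← nodes_append, nodes_append V']
    exact ((Multiset.le_add_left _ _).trans (Multiset.le_add_right _ _)).trans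
      (Multiset.le_cons_self _ _)
  exact (ne_of_nodup_map_add (nodup_map_of_le hF.nodup hle)
    (e.minLeaf_mem_nodes v (List.mem_singleton_self e)) (e'.minLeaf_mem_nodes v he')).symm

variable {U : List Entry} {P T : Side → List Entry}

theorem Merge.mem (h : Merge v k W U P T) {d : Side} {e : Entry} (he : e ∈ P d ++ T d) :
    e ∈ W d := by
  rw [← h.split d]; exact List.mem_append_right _ he

theorem Merge.mem_of_passed (h : Merge v k W U P T) {d : Side} {e : Entry} (he : e ∈ P d) :
    e ∈ W d := h.mem (List.mem_append_left _ he)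

theorem Merge.mem_of_ahead (h : Merge v k W U P T) {d : Side} {e : Entry} (he : e ∈ T d) :
    e ∈ W d := h.mem (List.mem_append_right _ he)

theorem Merge.mem_of_merged (h : Merge v k W U P T) {e : Entry} (he : e ∈ U) : e ∈ W e.side := by
  rw [← h.split]; simp [he]

theorem Merge.split_ahead (h : Merge v k W U P T) (d : Side) :
    ((U.filter fun e => e.side = d) ++ P d) ++ T d = W d := by
  rw [List.append_assoc, h.split]

theorem Merge.rising_append (hF : Frame v k W) (h : Merge v k W U P T) (d : Side) :
    Rising v (P d ++ T d) :=
  (hF.rising d).sublist (h.split d ▸ List.sublist_append_right _ _)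

theorem Merge.inorder_core_add (h : Merge v k W U P T) (d : Side) :
    ((core k U).inorder : Multiset Node) + (nodes (P d ++ T d) + nodes (P d.opp ++ T d.opp)) =
      k ::ₘ (nodes (W .left) + nodes (W .right)) := by
  rw [← Side.add_opp (fun d => nodes (W d)) d, ← h.split d, ← h.split d.opp, inorder_core,
    ← nodes_filter_add d U, Multiset.cons_add]
  simp only [nodes_append]
  congr 1
  abel

theorem Merge.real_of_mem_core (hF : Frame v k W) (h : Merge v k W U P T) {x : Node}
    (hx : x ∈ (core k U).inorder) : x.IsReal := by
  refine hF.real x ?_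
  rw [← h.inorder_core_add .left]
  exact Multiset.mem_add.mpr (Or.inl hx)

theorem Merge.real_minLeaf (hF : Frame v k W) (h : Merge v k W U P T) :
    ((core k U).minLeaf v).IsReal := h.real_of_mem_core hF ((core k U).minLeaf_mem v)

theorem Merge.minLeaf_ne (hF : Frame v k W) (h : Merge v k W U P T) {d : Side} {e : Entry}
    (he : e ∈ P d ++ T d) : v ((core k U).minLeaf v) ≠ v (e.minLeaf v) := by
  have hnd := hF.nodup
  rw [← h.inorder_core_add d] at hnd
  exact ne_of_nodup_map_add hnd ((core k U).minLeaf_mem v)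
    (Multiset.mem_add.mpr (Or.inl (e.minLeaf_mem_nodes v he)))

theorem Merge.lt_of_mem_core (hF : Frame v k W) (h : Merge v k W U P T) {d : Side} {e : Entry}
    (he : e ∈ P d ++ T d) {x : Node} (hx : x ∈ (core k U).inorder) : v x < v e.node := by
  have hx' : x ∈ k ::ₘ nodes U := inorder_core k U ▸ hx
  rcases Multiset.mem_cons.mp hx' with rfl | hx'
  · exact hF.leaf d e (h.mem he)
  · obtain ⟨u, hu, rfl | hxu⟩ := mem_nodes.mp hx'
    · exact h.sep u hu d e he
    · exact (hF.heap _ u (h.mem_of_merged hu) x hxu).trans (h.sep u hu d e he)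

theorem Merge.exists_absorb (hF : Frame v k W) {P₁ P₂ : Side → List Entry}
    (h : Merge v k W U (fun d => P₁ d ++ P₂ d) T)
    (hsep : ∀ d d', ∀ x ∈ P₁ d, ∀ e ∈ P₂ d' ++ T d', v x.node < v e.node) :
    ∃ C : List Entry, (∀ d, (C.filter fun e => e.side = d) = P₁ d) ∧
      Merge v k W (U ++ C) P₂ T ∧
      deco v (core k (U ++ C)) =
        ((deco v (core k U)).1.addAll C, (deco v (core k U)).2 + hang v C) := by
  have hmemW : ∀ {d e}, e ∈ P₁ d → e ∈ W d := fun he =>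
    h.mem_of_passed (List.mem_append_left _ he)
  obtain ⟨C, hC, hCP⟩ := exists_rising_filter_eq (L := P₁)
    (fun d e he => hF.side d e (hmemW he))
    (fun d => (h.rising_append hF d).sublist
      ((List.sublist_append_left _ _).trans (List.sublist_append_left _ _)))
    (fun a ha b hb => hF.node_ne (hmemW ha) (hmemW hb))
  have hmem : ∀ c ∈ C, c ∈ P₁ c.side := fun c hc => by rw [← hCP]; simp [hc]
  have hdeco : deco v (core k (U ++ C)) =
      ((deco v (core k U)).1.addAll C, (deco v (core k U)).2 + hang v C) := by
    rw [core, build_append]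
    exact deco_build_of_lt fun c hc => h.passed _ c (List.mem_append_left _ (hmem c hc))
  have hmin : (core k (U ++ C)).minLeaf v = (core k U).minLeaf v := by
    rw [BinTree.minLeaf, hdeco]; rfl
  refine ⟨C, hCP, ⟨fun d => ?_, ?_, ?_, fun d e he => ?_⟩, hdeco⟩
  · rw [List.filter_append, hCP, ← h.split d]
    simp only [List.append_assoc]
  · exact List.pairwise_append.mpr ⟨h.rising, hC, fun u hu c hc => h.sep u hu c.side c (by
      simp [hmem c hc])⟩
  · intro u hu d e he
    rcases List.mem_append.mp hu with hu | hu
    · exact h.sep u hu d e (by rw [List.append_assoc]; exact List.mem_append_right _ he)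
    · exact hsep _ d u (hmem u hu) e he
  · rw [hmin]
    exact h.passed d e (List.mem_append_right _ he)

theorem Merge.advance (hF : Frame v k W) (h : Merge v k W U P T) {t : Side} {e : Entry}
    {V : List Entry} (hP : P t = []) (hT : T t = e :: V)
    (he : v (e.minLeaf v) < v ((core k U).minLeaf v))
    (hsep : ∀ e' ∈ P t.opp ++ T t.opp, v e.node < v e'.node) :
    deco v (core k (U ++ [e])) = (deco v (core k U)).turn v e ∧
      Merge v k W (U ++ [e]) (Function.update P t (near v (e.minLeaf v) V))
        (Function.update T t (far v (e.minLeaf v) V)) := by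
  have hdeco : deco v (core k (U ++ [e])) = (deco v (core k U)).turn v e := by
    rw [core, build_concat]
    exact (deco_join v e (core k U) he.ne).trans (if_pos he)
  have hmin : (core k (U ++ [e])).minLeaf v = e.minLeaf v := by
    rw [BinTree.minLeaf, hdeco]; rfl
  have hside : e.side = t := hF.side t e (h.mem_of_ahead (by simp [hT]))
  have hV := near_append_far v (e.minLeaf v) V
  have hVlt : ∀ e' ∈ V, v e.node < v e'.node := by
    have hrising := h.rising_append hF t
    rw [hP, hT] at hrising
    exact (List.pairwise_cons.mp hrising).1
  refine ⟨hdeco, (Side.forall_iff t).mpr ⟨?_, ?_⟩, ?_, ?_, (Side.forall_iff t).mpr ⟨?_, ?_⟩⟩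
  · rw [← h.split t, Function.update_self, Function.update_self, hV]
    simp [hside, hP, hT]
  · rw [← h.split t.opp]
    simp [hside]
  · refine List.pairwise_append.mpr ⟨h.rising, List.pairwise_singleton _ _, fun u hu e' he' => ?_⟩
    exact h.sep u hu t e' (by simp_all)
  · rw [List.forall_mem_append, List.forall_mem_singleton]
    refine ⟨fun u hu => (Side.forall_iff t).mpr ⟨?_, ?_⟩, (Side.forall_iff t).mpr ⟨?_, ?_⟩⟩
    · rw [Function.update_self, Function.update_self, hV]
      exact fun e' he' => h.sep u hu t e' (by simp [hT, he'])
    · simpa using h.sep u hu t.opp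
    · rwa [Function.update_self, Function.update_self, hV]
    · simpa using hsep
  · rw [hmin, Function.update_self]
    exact fun e' he' => lt_of_mem_near he'
  · rw [hmin, Function.update_of_ne (Side.opp_ne t)]
    exact fun e' he' => he.trans (h.passed _ e' he')

end

@[simp] theorem trails_self (d : Side) (x y : List Node) : trails d x y d = x := if_pos rfl

@[simp] theorem trails_opp (d : Side) (x y : List Node) : trails d x y d.opp = y :=
  if_neg (Side.opp_ne d)

@[simp] theorem trails_opp_self (d : Side) (x y : List Node) : trails d.opp x y d = y :=
  if_neg (Side.ne_opp d)

theorem Banana.ext_of_side {X Y : Banana} (s : Side) (hl : X.lower = Y.lower)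
    (hu : X.upper = Y.upper) (hs : X.trail s = Y.trail s) (ho : X.trail s.opp = Y.trail s.opp) :
    X = Y :=
  Banana.ext hl hu (funext ((Side.forall_iff s).mpr ⟨hs, ho⟩))

/-- The path of a dummy leaf that has not passed any node. -/
def dummyPath : OpenPath := ⟨.dummy, fun _ => []⟩

/-- The banana of a path that continues along the spine of the tree `s`: it passes the entries of
`B` and ends at the first entry of `T`. -/
def OpenPath.endOn (P : OpenPath) (s : Side) (B T : List Entry) : Banana :=
  ⟨P.lower, top s T, trails s (P.trail s ++ B.map Entry.node) (P.trail s.opp)⟩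

theorem OpenPath.addAll_close_top (P : OpenPath) {s : Side} {B : List Entry}
    (hB : ∀ e ∈ B, e.side = s) (T : List Entry) :
    (P.addAll B).close (top s T) = P.endOn s B T :=
  Banana.ext_of_side s rfl rfl ((P.addAll_trail_of_side hB).trans (trails_self ..).symm)
    ((P.addAll_trail_of_side_ne hB (Side.ne_opp s)).trans (trails_opp ..).symm)

theorem OpenPath.close_node (P : OpenPath) (s : Side) (e : Entry) (T : List Entry) :
    P.close e.node = P.endOn s [] (e :: T) :=
  Banana.ext_of_side s rfl rfl (by simp [close, endOn]) (by simp [close, endOn])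

theorem OpenPath.foot_endOn (P : OpenPath) (s : Side) (B T : List Entry) :
    (P.endOn s B T).foot = P.foot + (B.map Entry.node : Multiset Node) := by
  cases s <;> simp [endOn, foot, Banana.foot, trails, Side.opp, ← Multiset.coe_add,
    add_assoc, add_left_comm, add_comm]

/-- The bananas of a partial merge, other than those of the smallest leaf of the core and of the
dummy leaf. -/
def remainder (v : Node → ℝ) (k : Node) (U : List Entry) (P T : Side → List Entry) :
    Multiset Banana :=
  (deco v (core k U)).2 + (hang v (P .left) + hang v (P .right)) +
    (rest v .left (T .left) + rest v .right (T .right))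

/-- The bananas of a partial merge. The core belongs to the tree `t`, where the path of its smallest
leaf passes `P t`; in the other tree, the path of the dummy leaf passes `P t.opp`. -/
def stageBananas (v : Node → ℝ) (k : Node) (t : Side) (U : List Entry) (P T : Side → List Entry) :
    Multiset Banana :=
  dummyPath.endOn t.opp (P t.opp) (T t.opp) ::ₘ (deco v (core k U)).1.endOn t (P t) (T t) ::ₘ
    remainder v k U P T

theorem remainder_eq (v : Node → ℝ) (k : Node) (U : List Entry) (P T : Side → List Entry)
    (s : Side) : remainder v k U P T = (deco v (core k U)).2 +
      (hang v (P s) + hang v (P s.opp)) + (rest v s (T s) + rest v s.opp (T s.opp)) := by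
  rw [remainder, Side.add_opp (fun d => hang v (P d)), Side.add_opp (fun d => rest v d (T d))]

/-- The bananas `S` of a stage of gluing, which starts with the bananas `S₀`. -/
structure Stage (v : Node → ℝ) (k : Node) (W : Side → List Entry) (S₀ : Multiset Banana)
    (S : List Banana) (t : Side) (U : List Entry) (P T : Side → List Entry) : Prop
    extends Merge v k W U P T where
  bananas : (S : Multiset Banana) = stageBananas v k t U P T
  rest_le_init : ∀ d, rest v d (T d) ≤ S₀

section

variable {v : Node → ℝ} {k : Node} {W : Side → List Entry} {S₀ : Multiset Banana}
  {S : List Banana} {t : Side} {U : List Entry} {P T : Side → List Entry}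

theorem Frame.rest_cons (hF : Frame v k W) {d : Side} {e : Entry} {V' V : List Entry}
    (hV : V' ++ e :: V = W d) :
    rest v d (e :: V) =
      ((deco v e.tree).1.extend d.opp e.node).endOn d (near v (e.minLeaf v) V)
        (far v (e.minLeaf v) V) ::ₘ
      ((deco v e.tree).2 + hang v (near v (e.minLeaf v) V) + rest v d (far v (e.minLeaf v) V)) := by
  have hside : ∀ e' ∈ e :: V, e'.side = d := fun e' he' => hF.side d e' (by
    rw [← hV]; exact List.mem_append_right _ he')
  rw [BananaTree.rest_cons d e (hF.minLeaf_ne_of_append hV), OpenPath.addAll_close_top,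
    hside e List.mem_cons_self]
  exact fun e' he' => hside e' (List.mem_cons_of_mem _ ((List.takeWhile_sublist _).mem he'))

theorem Stage.feet_eq (h : Stage v k W S₀ S t U P T) :
    feet (S : Multiset Banana) = .dummy ::ₘ k ::ₘ (nodes (W .left) + nodes (W .right)) := by
  have hcore := feet_deco v (core k U)
  have hdummy : dummyPath.foot = {.dummy} := rfl
  rw [h.bananas, stageBananas, remainder_eq v k U P T t, ← h.inorder_core_add t, ← hcore]
  simp only [feet_cons, feet_add, OpenPath.foot_endOn, feet_rest, nodes_append, ← feet_hang v (P _),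
    hdummy]
  simp only [← Multiset.singleton_add]
  abel

theorem Stage.feet_nodup (hF : Frame v k W) (h : Stage v k W S₀ S t U P T) :
    (feet (S : Multiset Banana)).Nodup := by
  rw [h.feet_eq, Multiset.nodup_cons]
  exact ⟨fun hd => (hF.real _ hd).ne_dummy rfl, hF.nodup_nodes⟩

theorem Stage.upper_le (h : Stage v k W S₀ S t U P T) :
    (S : Multiset Banana).map Banana.upper ≤
      .root t.opp ::ₘ .root t ::ₘ k ::ₘ (nodes (W .left) + nodes (W .right)) := by
  have hle := add_le_add (add_le_add (upper_deco_le v (core k U))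
    (add_le_add (upper_hang_le v (P t)) (upper_hang_le v (P t.opp))))
    (add_le_add (upper_rest_le v t (T t)) (upper_rest_le v t.opp (T t.opp)))
  rw [h.bananas, stageBananas, remainder_eq v k U P T t, ← h.inorder_core_add t]
  refine le_trans (le_of_eq ?_) (hle.trans (le_of_eq ?_)) <;>
  · simp only [Multiset.map_cons, Multiset.map_add, OpenPath.endOn, nodes_append]
    simp only [← Multiset.singleton_add]
    abel

theorem Stage.upper_nodup (hF : Frame v k W) (h : Stage v k W S₀ S t U P T) :
    ((S : Multiset Banana).map Banana.upper).Nodup := by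
  refine Multiset.nodup_of_le h.upper_le ?_
  have hroot : ∀ d, .root d ∉ k ::ₘ (nodes (W .left) + nodes (W .right)) :=
    fun d hd => (hF.real _ hd).ne_root d rfl
  rw [Multiset.nodup_cons, Multiset.nodup_cons, Multiset.mem_cons, not_or]
  exact ⟨⟨by simp, hroot _⟩, hroot _, hF.nodup_nodes⟩

theorem Stage.dummy_mem (h : Stage v k W S₀ S t U P T) :
    dummyPath.endOn t.opp (P t.opp) (T t.opp) ∈ S := by
  rw [← Multiset.mem_coe, h.bananas]; exact Multiset.mem_cons_self _ _

theorem Stage.core_mem (h : Stage v k W S₀ S t U P T) :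
    (deco v (core k U)).1.endOn t (P t) (T t) ∈ S := by
  rw [← Multiset.mem_coe, h.bananas]
  exact Multiset.mem_cons_of_mem (Multiset.mem_cons_self _ _)

theorem Stage.rest_le (h : Stage v k W S₀ S t U P T) (d : Side) : rest v d (T d) ≤ S := by
  rw [h.bananas, stageBananas, remainder_eq v k U P T d]
  exact ((Multiset.le_add_right _ _).trans (Multiset.le_add_left _ _)).trans
    ((Multiset.le_cons_self _ _).trans (Multiset.le_cons_self _ _))

theorem Stage.low_root (hF : Frame v k W) (h : Stage v k W S₀ S t U P T) (d : Side) :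
    low S (.root d) = none := by
  refine low_eq_none ?_
  rw [h.feet_eq, Multiset.mem_cons, not_or]
  exact ⟨Node.noConfusion, fun hd => (hF.real _ hd).ne_root d rfl⟩

theorem Frame.restHead_mem (hF : Frame v k W) {d : Side} {e : Entry} {V' V : List Entry}
    (hV : V' ++ e :: V = W d) {M : Multiset Banana} (hM : rest v d (e :: V) ≤ M) :
    ((deco v e.tree).1.extend d.opp e.node).endOn d (near v (e.minLeaf v) V)
      (far v (e.minLeaf v) V) ∈ M :=
  Multiset.mem_of_le hM (hF.rest_cons hV ▸ Multiset.mem_cons_self _ _)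

theorem Frame.rest_far_le (hF : Frame v k W) {d : Side} {e : Entry} {V' V : List Entry}
    (hV : V' ++ e :: V = W d) : rest v d (far v (e.minLeaf v) V) ≤ rest v d (e :: V) := by
  rw [hF.rest_cons hV]
  exact (Multiset.le_add_left _ _).trans (Multiset.le_cons_self _ _)

theorem Stage.low_top (hF : Frame v k W) (h : Stage v k W S₀ S t U P T) {d : Side} {e : Entry}
    {V : List Entry} (hT : T d = e :: V) : low S e.node = some (e.minLeaf v) := by
  refine low_eq_lower (h.feet_nodup hF) (hF.restHead_mem (hT ▸ h.split_ahead d)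
    (hT ▸ h.rest_le d)) ?_
  rw [OpenPath.foot_endOn, OpenPath.foot_extend]
  simp

theorem Stage.dth_minLeaf_top (hF : Frame v k W) (h : Stage v k W S₀ S t U P T) {d : Side}
    {e : Entry} {V : List Entry} (hT : T d = e :: V) :
    dth S (e.minLeaf v) = some (top d (far v (e.minLeaf v) V)) :=
  dth_lower (h.feet_nodup hF) (hF.restHead_mem (hT ▸ h.split_ahead d) (hT ▸ h.rest_le d))

theorem Frame.inSpine_top (hF : Frame v k W) {d : Side} {V' V : List Entry} (hV : V' ++ V = W d)
    (hS : rest v d V ≤ (S : Multiset Banana)) : InSpine S (.root d) d.opp (top d V) := by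
  induction hn : V.length using Nat.strong_induction_on generalizing V V' with
  | _ n ih =>
  cases V with
  | nil => exact .root
  | cons e V =>
    have hfar : (V' ++ e :: near v (e.minLeaf v) V) ++ far v (e.minLeaf v) V = W d := by
      rw [List.append_assoc, List.cons_append, near_append_far, hV]
    have hlen : (far v (e.minLeaf v) V).length < n :=
      hn ▸ Nat.lt_succ_of_le (length_far_le v _ V)
    refine .next (Multiset.mem_coe.mp (hF.restHead_mem hV hS))
      (ih _ hlen hfar ((hF.rest_far_le hV).trans hS) rfl) ?_
    simp [OpenPath.endOn, OpenPath.extend, top]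

theorem Stage.advance (hF : Frame v k W) (h : Stage v k W S₀ S t U P T) {e : Entry}
    {V : List Entry} (hP : P t = []) (hT : T t = e :: V)
    (he : v (e.minLeaf v) < v ((core k U).minLeaf v))
    (hsep : ∀ e' ∈ P t.opp ++ T t.opp, v e.node < v e'.node) :
    (core k (U ++ [e])).minLeaf v = e.minLeaf v ∧
      Stage v k W S₀ S t (U ++ [e]) (Function.update P t (near v (e.minLeaf v) V))
        (Function.update T t (far v (e.minLeaf v) V)) := by
  obtain ⟨hdeco, hmerge⟩ := h.toMerge.advance hF hP hT he hsep
  have hV := hT ▸ h.split_ahead t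
  have hside : e.side = t := hF.side t e (h.mem_of_ahead (by simp [hT]))
  refine ⟨by rw [BinTree.minLeaf, hdeco]; rfl, hmerge, ?_, (Side.forall_iff t).mpr ⟨?_, ?_⟩⟩
  · rw [h.bananas, stageBananas, stageBananas, remainder_eq _ _ _ _ _ t, remainder_eq _ _ _ _ _ t,
      hdeco, hP, hT, hF.rest_cons hV, ← OpenPath.close_node]
    simp only [Deco.turn, hside, Function.update_self, Function.update_of_ne (Side.opp_ne t),
      hang_nil, ← Multiset.singleton_add]
    abel
  · rw [Function.update_self]
    exact (hF.rest_far_le hV).trans (hT ▸ h.rest_le_init t)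
  · rw [Function.update_of_ne (Side.opp_ne t)]
    exact h.rest_le_init _

end

/-! ### Undoing injuries, fatalities and scares -/

theorem filter_map_node (p : Node → Bool) (B : List Entry) :
    (B.map Entry.node).filter (fun j => p j) = (B.filter fun e => p e.node).map Entry.node := by
  rw [List.filter_map]; rfl

section

variable {f : ℕ → ℝ} {k : Node} {W : Side → List Entry} {S₀ : Multiset Banana}
  {t : Side} {U : List Entry} {P T : Side → List Entry}

theorem GlueState.Below.asymm {σ : GlueState} {x y : Option Node} (h : σ.Below f x y) :
    ¬ σ.Below f y x := lt_asymm h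

theorem GlueState.Below.trans {σ : GlueState} {x y z : Option Node} (h : σ.Below f x y)
    (h' : σ.Below f y z) : σ.Below f x z := lt_trans h h'

theorem Frame.below_top (hF : Frame (nodeValue f) k W) (σ : GlueState) {d : Side}
    {V' V : List Entry} (hV : V' ++ V = W d) {x : Node} (hx : x.IsReal)
    (hlt : ∀ e ∈ V, nodeValue f x < nodeValue f e.node) :
    σ.Below f (some x) (some (top d V)) := by
  cases V with
  | nil => exact GlueState.below_root hx d
  | cons e V =>
    exact (GlueState.below_real hx (hF.real_node (by rw [← hV]; simp))).mpr (hlt e (by simp))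

theorem Merge.below_top_of_passed (hF : Frame (nodeValue f) k W)
    (h : Merge (nodeValue f) k W U P T) (σ : GlueState) {d : Side} {x : Entry} (hx : x ∈ P d) :
    σ.Below f (some x.node) (some (top d (T d))) :=
  hF.below_top σ (h.split_ahead d) (hF.real_node (h.mem_of_passed hx))
    ((List.pairwise_append.mp (h.rising_append hF d)).2.2 x hx)

theorem Merge.below_top_of_core (hF : Frame (nodeValue f) k W)
    (h : Merge (nodeValue f) k W U P T) (σ : GlueState) (d : Side) {x : Node}
    (hx : x ∈ (core k U).inorder) : σ.Below f (some x) (some (top d (T d))) :=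
  hF.below_top σ (h.split_ahead d) (h.real_of_mem_core hF hx) fun _ he =>
    h.lt_of_mem_core hF (List.mem_append_right _ he) hx

theorem Merge.not_below_top (hF : Frame (nodeValue f) k W) (h : Merge (nodeValue f) k W U P T)
    (σ : GlueState) {d : Side} {x : Entry} (hx : x ∈ T d) :
    ¬ σ.Below f (some x.node) (some (top d (T d))) := by
  have hrising := (List.pairwise_append.mp (h.rising_append hF d)).2.1
  have hreal : ∀ y ∈ T d, y.node.IsReal := fun y hy => hF.real_node (h.mem_of_ahead hy)
  cases hT : T d with
  | nil => simp [hT] at hx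
  | cons e V =>
    rw [hT] at hrising hreal hx
    rw [top, GlueState.below_real (hreal x hx) (hreal e (by simp)), not_lt]
    rcases List.mem_cons.mp hx with rfl | hx
    · exact le_rfl
    · exact ((List.pairwise_cons.mp hrising).1 x hx).le

theorem Merge.below_or_below (hF : Frame (nodeValue f) k W) (h : Merge (nodeValue f) k W U P T)
    (σ : GlueState) (d : Side) : σ.Below f (some (top d (T d))) (some (top d.opp (T d.opp))) ∨
      σ.Below f (some (top d.opp (T d.opp))) (some (top d (T d))) := by
  have hreal : ∀ {d e V}, T d = e :: V → e.node.IsReal := fun hT =>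
    hF.real_node (h.mem_of_ahead (by rw [hT]; exact List.mem_cons_self))
  cases hT : T d with
  | nil =>
    cases hT' : T d.opp with
    | nil =>
      have hopp := GlueState.below_roots (f := f) (σ := σ) (s := d.opp)
      rw [Side.opp_opp] at hopp
      rw [top, top, GlueState.below_roots, hopp]
      cases d <;> simp [Side.opp]
    | cons e' V' => exact Or.inr (GlueState.below_root (hreal hT') d)
  | cons e V =>
    cases hT' : T d.opp with
    | nil => exact Or.inl (GlueState.below_root (hreal hT) d.opp)
    | cons e' V' =>
      rw [top, top, GlueState.below_real (hreal hT) (hreal hT'),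
        GlueState.below_real (hreal hT') (hreal hT)]
      exact lt_or_gt_of_ne (hF.node_ne (h.mem_of_ahead (hT ▸ List.mem_cons_self))
        (h.mem_of_ahead (hT' ▸ List.mem_cons_self)))

theorem Merge.filter_below_top (hF : Frame (nodeValue f) k W)
    (h : Merge (nodeValue f) k W U P T) (σ : GlueState) (d : Side) :
    ((P d).filter fun e => σ.Below f (some e.node) (some (top d (T d)))) = P d :=
  List.filter_eq_self.mpr fun _ he => decide_eq_true (h.below_top_of_passed hF σ he)

theorem Merge.exists_absorb_below (hF : Frame (nodeValue f) k W)
    (h : Merge (nodeValue f) k W U P T) {σ : GlueState} {s : Side} {q : Node}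
    (hs : top s (T s) = q) (hq : σ.Below f (some q) (some (top s.opp (T s.opp)))) :
    ∃ U' P', Merge (nodeValue f) k W U' P' T ∧
      (∀ d, P' d = (P d).filter fun e => ¬ σ.Below f (some e.node) (some q)) ∧ P' s = [] ∧
      (deco (nodeValue f) (core k U')).1 = ⟨(core k U).minLeaf (nodeValue f), fun d =>
        (deco (nodeValue f) (core k U)).1.trail d ++
          ((P d).filter fun e => σ.Below f (some e.node) (some q)).map Entry.node⟩ ∧
      remainder (nodeValue f) k U' P' T = remainder (nodeValue f) k U P T := by
  subst hs
  set q := top s (T s)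
  have hahead : ∀ d, ∀ e ∈ T d, ¬ σ.Below f (some e.node) (some q) :=
    (Side.forall_iff s).mpr ⟨fun e he => h.not_below_top hF σ he, fun e he hb =>
      h.not_below_top hF σ he (hb.trans hq)⟩
  set P₁ : Side → List Entry := fun d => (P d).filter fun e => σ.Below f (some e.node) (some q)
  set P₂ : Side → List Entry := fun d => (P d).filter fun e => ¬ σ.Below f (some e.node) (some q)
  have hreal : ∀ {d e}, e ∈ P d ++ T d → e.node.IsReal := fun he => hF.real_node (h.mem he)
  have hP : (fun d => P₁ d ++ P₂ d) = P := funext fun d => filter_append_filter <|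
    ((h.rising_append hF d).sublist (List.sublist_append_left _ _)).imp_of_mem
      fun ha hb hab hbq => GlueState.Below.trans ((GlueState.below_real
        (hreal (List.mem_append_left _ ha)) (hreal (List.mem_append_left _ hb))).mpr hab) hbq
  have hsep : ∀ d d', ∀ x ∈ P₁ d, ∀ e ∈ P₂ d' ++ T d',
      nodeValue f x.node < nodeValue f e.node := by
    intro d d' x hx e he
    obtain ⟨hxP, hxq⟩ := List.mem_filter.mp hx
    have heq : e ∈ P d' ++ T d' ∧ ¬ σ.Below f (some e.node) (some q) := by
      rcases List.mem_append.mp he with he | he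
      · exact ⟨List.mem_append_left _ (List.mem_filter.mp he).1, by
          simpa using (List.mem_filter.mp he).2⟩
      · exact ⟨List.mem_append_right _ he, hahead d' e he⟩
    rw [← GlueState.below_real (σ := σ) (hreal (List.mem_append_left _ hxP)) (hreal heq.1)]
    exact lt_of_lt_of_le (of_decide_eq_true hxq) (not_lt.mp heq.2)
  obtain ⟨C, hC, hmerge, hdeco⟩ := Merge.exists_absorb hF (hP.symm ▸ h) hsep
  refine ⟨U ++ C, P₂, hmerge, fun _ => rfl, List.filter_eq_nil_iff.mpr ?_, ?_, ?_⟩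
  · simpa using fun e he => h.below_top_of_passed hF σ he
  · rw [hdeco, OpenPath.addAll]
    simp only [hC]
    rfl
  · rw [remainder, remainder, hdeco, ← hP]
    rw [← hang_filter_add _ .left C, hC .left,
      show (C.filter fun e => e.side = Side.left.opp) = P₁ .right from hC .right]
    simp only [hang_append]
    abel

theorem Stage.undo (hF : Frame (nodeValue f) k W) {S S' : List Banana}
    (h : Stage (nodeValue f) k W S₀ S t U P T) {s : Side} {U' : List Entry}
    {P' : Side → List Entry} (hmerge : Merge (nodeValue f) k W U' P' T) {D K : Banana}
    (hrem : remainder (nodeValue f) k U' P' T = remainder (nodeValue f) k U P T)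
    (hS' : S' = modify (modify S .dummy fun _ => D) ((core k U).minLeaf (nodeValue f))
      fun _ => K)
    (hD : D = dummyPath.endOn s.opp (P' s.opp) (T s.opp))
    (hK : K = (deco (nodeValue f) (core k U')).1.endOn s (P' s) (T s)) :
    Stage (nodeValue f) k W S₀ S' s U' P' T where
  toMerge := hmerge
  bananas := by
    subst hS'
    refine (modify_modify (a := .dummy) (b := (core k U).minLeaf (nodeValue f)) h.bananas
      (h.feet_nodup hF) rfl rfl (hD ▸ rfl)).trans ?_
    rw [hD, hK, ← hrem, stageBananas]
  rest_le_init := h.rest_le_init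

theorem Stage.undoInjury (hF : Frame (nodeValue f) k W) {σ : GlueState}
    (h : Stage (nodeValue f) k W S₀ σ.bananas t U P T)
    (hq : σ.Below f (some (top t (T t))) (some (top t.opp (T t.opp)))) :
    ∃ τ, undoInjury f σ t ((core k U).minLeaf (nodeValue f)) (top t (T t)) = some τ ∧
      ∃ U' P', Stage (nodeValue f) k W S₀ τ.bananas t U' P' T ∧
        (core k U').minLeaf (nodeValue f) = (core k U).minLeaf (nodeValue f) ∧ P' t = [] ∧
        ∀ x d, x ∈ P' d → ¬ σ.Below f (some x.node) (some (top t (T t))) := by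
  obtain ⟨U', P', hmerge, hP', hnil, hdeco, hrem⟩ := h.toMerge.exists_absorb_below hF rfl hq
  have hfilter := h.filter_below_top hF σ t
  simp only [BananaTree.undoInjury,
    show bananaAt σ.bananas ((core k U).minLeaf (nodeValue f)) = _ from
      bananaAt_lower (h.feet_nodup hF) h.core_mem,
    show bananaAt σ.bananas .dummy = _ from bananaAt_lower (h.feet_nodup hF) h.dummy_mem,
    Option.bind_eq_bind, Option.bind_some, Option.pure_def]
  refine ⟨_, rfl, U', P', h.undo hF hmerge hrem rfl (Banana.ext_of_side t rfl rfl ?_ ?_)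
    (Banana.ext_of_side t ?_ rfl ?_ ?_), by rw [BinTree.minLeaf, hdeco], hnil, ?_⟩
  · simp [OpenPath.endOn, dummyPath]
  · simp [OpenPath.endOn, dummyPath, filter_map_node, hP']
  · rw [hdeco]; rfl
  · simp [OpenPath.endOn, hdeco, hfilter, hnil]
  · simp [OpenPath.endOn, dummyPath, filter_map_node, hdeco]
  · intro x d hx
    rw [hP'] at hx
    exact of_decide_eq_true (List.mem_filter.mp hx).2

theorem Stage.undoFatality (hF : Frame (nodeValue f) k W) {σ : GlueState}
    (h : Stage (nodeValue f) k W S₀ σ.bananas t U P T)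
    (hq : σ.Below f (some (top t.opp (T t.opp))) (some (top t (T t)))) :
    ∃ τ, undoFatality f σ t.opp ((core k U).minLeaf (nodeValue f)) (top t.opp (T t.opp)) = some τ ∧
      ∃ U' P', Stage (nodeValue f) k W S₀ τ.bananas t.opp U' P' T ∧
        (core k U').minLeaf (nodeValue f) = (core k U).minLeaf (nodeValue f) ∧ P' t.opp = [] ∧
        ∀ x d, x ∈ P' d → ¬ σ.Below f (some x.node) (some (top t.opp (T t.opp))) := by
  obtain ⟨U', P', hmerge, hP', hnil, hdeco, hrem⟩ :=
    h.toMerge.exists_absorb_below (s := t.opp) hF rfl (by simpa using hq)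
  have hfilter := h.filter_below_top hF σ t.opp
  have hcore : ∀ x ∈ (deco (nodeValue f) (core k U)).1.trail t,
      σ.Below f (some x) (some (top t.opp (T t.opp))) := fun x hx =>
    h.below_top_of_core hF σ t.opp <| Multiset.mem_coe.mp <|
      feet_deco (nodeValue f) (core k U) ▸
        Multiset.mem_add.mpr (Or.inl (OpenPath.mem_foot_of_mem_trail hx))
  have hmoved : ((deco (nodeValue f) (core k U)).1.trail t).filter
      (fun x => σ.Below f (some x) (some (top t.opp (T t.opp)))) =
      (deco (nodeValue f) (core k U)).1.trail t := by
    rw [List.filter_eq_self]; simpa using hcore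
  have hstay : ((deco (nodeValue f) (core k U)).1.trail t).filter
      (fun x => !decide (σ.Below f (some x) (some (top t.opp (T t.opp))))) = [] := by
    rw [List.filter_eq_nil_iff]; simpa using hcore
  simp only [BananaTree.undoFatality,
    show bananaAt σ.bananas ((core k U).minLeaf (nodeValue f)) = _ from
      bananaAt_lower (h.feet_nodup hF) h.core_mem,
    show bananaAt σ.bananas .dummy = _ from bananaAt_lower (h.feet_nodup hF) h.dummy_mem,
    Option.bind_eq_bind, Option.bind_some, Option.pure_def]
  refine ⟨_, rfl, U', P', h.undo hF hmerge hrem rfl (Banana.ext_of_side t rfl ?_ ?_ ?_)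
    (Banana.ext_of_side t ?_ rfl ?_ ?_), by rw [BinTree.minLeaf, hdeco], hnil, ?_⟩
  · simp [OpenPath.endOn]
  · simp [OpenPath.endOn, dummyPath, filter_map_node, hP', hstay]
  · simp [OpenPath.endOn, dummyPath]
  · rw [hdeco]; rfl
  · simp [OpenPath.endOn, dummyPath, filter_map_node, hdeco, hmoved]
  · simp [OpenPath.endOn, dummyPath, hdeco, hfilter, hnil]
  · intro x d hx
    rw [hP'] at hx
    exact of_decide_eq_true (List.mem_filter.mp hx).2

theorem interchangeMinima_eq {σ : GlueState} {i p : Node} {I M : Banana}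
    (hI : bananaAt σ.bananas i = some I) (hM : bananaAt σ.bananas p = some M) {d : Side}
    {lo up : Side → List Node}
    (htrail : M.trail = trails d (lo d ++ I.upper :: up d) (lo d.opp ++ up d.opp))
    (hlo : ∀ e, ∀ x ∈ lo e, σ.Below f (some x) (some I.upper))
    (hup : ∀ e, ∀ x ∈ up e, σ.Below f (some I.upper) (some x)) :
    interchangeMinima f σ i p = some { σ with
      bananas := modify (modify σ.bananas i fun _ =>
        ⟨i, M.upper, trails d (I.trail d ++ up d) (I.trail d.opp ++ I.upper :: up d.opp)⟩) p
        fun _ => ⟨p, I.upper, lo⟩ } := by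
  have hirrefl : ¬ σ.Below f (some I.upper) (some I.upper) := lt_irrefl _
  have hd : I.upper ∈ M.trail d := by simp [htrail]
  have hopp : I.upper ∉ M.trail d.opp := by
    rw [htrail, trails_opp, List.mem_append, not_or]
    exact ⟨fun hx => hirrefl (hlo _ _ hx), fun hx => hirrefl (hup _ _ hx)⟩
  have hside : (if I.upper ∈ M.trail .left then Side.left else Side.right) = d := by
    cases d
    · exact if_pos hd
    · exact if_neg hopp
  have hfilter_lo : (fun e => (M.trail e).filter fun x => σ.Below f (some x) (some I.upper)) =
      lo := by
    have hself : ∀ e, (lo e).filter (fun x => σ.Below f (some x) (some I.upper)) = lo e :=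
      fun e => List.filter_eq_self.mpr (by simpa using hlo e)
    have hnil : ∀ e, (up e).filter (fun x => σ.Below f (some x) (some I.upper)) = [] :=
      fun e => List.filter_eq_nil_iff.mpr (by simpa using fun x hx => (hup e x hx).asymm)
    exact funext ((Side.forall_iff d).mpr (by simp [htrail, hself, hnil, hirrefl]))
  have hfilter_up : ∀ e, ((M.trail e).filter fun x => σ.Below f (some I.upper) (some x)) =
      up e := by
    have hself : ∀ e, (up e).filter (fun x => σ.Below f (some I.upper) (some x)) = up e :=
      fun e => List.filter_eq_self.mpr (by simpa using hup e)
    have hnil : ∀ e, (lo e).filter (fun x => σ.Below f (some I.upper) (some x)) = [] :=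
      fun e => List.filter_eq_nil_iff.mpr (by simpa using fun x hx => (hlo e x hx).asymm)
    exact (Side.forall_iff d).mpr (by simp [htrail, hself, hnil, hirrefl])
  have hor : I.upper ∈ M.trail .left ∨ I.upper ∈ M.trail .right := by
    cases d <;> simp [hd]
  simp only [interchangeMinima, hI, hM, Option.bind_eq_bind, Option.bind_some, hor, if_true,
    hside, hfilter_lo, hfilter_up, Option.pure_def]

theorem Stage.interchangeMinima (hF : Frame (nodeValue f) k W) {σ : GlueState}
    (h : Stage (nodeValue f) k W S₀ σ.bananas t U P T) {e : Entry} {V : List Entry}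
    (hT : T t.opp = e :: V) :
    BananaTree.interchangeMinima f σ .dummy (e.minLeaf (nodeValue f)) = some { σ with
      bananas := modify (modify σ.bananas .dummy fun _ =>
        dummyPath.endOn t.opp (P t.opp ++ e :: near (nodeValue f) (e.minLeaf (nodeValue f)) V)
          (far (nodeValue f) (e.minLeaf (nodeValue f)) V)) (e.minLeaf (nodeValue f))
        fun _ => (deco (nodeValue f) e.tree).1.close e.node } := by
  have hmem : ∀ {e'}, e' ∈ e :: V → e' ∈ W t.opp := fun he => h.mem_of_ahead (hT ▸ he)
  have he : e ∈ W t.opp := hmem List.mem_cons_self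
  have hrising := hT ▸ (List.pairwise_append.mp (h.rising_append hF t.opp)).2.1
  have hM := hF.restHead_mem (hT ▸ h.split_ahead t.opp) (hT ▸ h.rest_le t.opp)
  have hdummy := h.dummy_mem
  rw [hT] at hdummy
  rw [interchangeMinima_eq (d := t) (lo := (deco (nodeValue f) e.tree).1.trail)
    (up := trails t [] ((near (nodeValue f) (e.minLeaf (nodeValue f)) V).map Entry.node))
    (show bananaAt σ.bananas .dummy = _ from bananaAt_lower (h.feet_nodup hF) hdummy)
    (show bananaAt σ.bananas (e.minLeaf (nodeValue f)) = _ from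
      bananaAt_lower (h.feet_nodup hF) hM)]
  · congr 4
    funext _
    exact Banana.ext_of_side t rfl rfl (by simp [OpenPath.endOn, dummyPath, top])
      (by simp [OpenPath.endOn, dummyPath, top])
  · exact funext ((Side.forall_iff t).mpr (by simp [OpenPath.endOn, OpenPath.extend, top]))
  · intro d x hx
    have hx' : x ∈ e.tree.inorder := by
      rw [← Multiset.mem_coe, ← feet_deco (nodeValue f)]
      exact Multiset.mem_add.mpr (Or.inl (OpenPath.mem_foot_of_mem_trail hx))
    exact (GlueState.below_real (hF.real_of_mem (mem_nodes.mpr ⟨e, he, Or.inr hx'⟩))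
      (hF.real_node he)).mpr (hF.heap _ e he x hx')
  · refine (Side.forall_iff t).mpr ⟨by simp, ?_⟩
    rw [trails_opp, List.forall_mem_map]
    intro e' he'
    have heV : e' ∈ V := (List.takeWhile_sublist _).mem he'
    exact (GlueState.below_real (hF.real_node he)
      (hF.real_node (hmem (List.mem_cons_of_mem _ heV)))).mpr
      ((List.pairwise_cons.mp hrising).1 e' heV)

theorem Stage.undoScare (hF : Frame (nodeValue f) k W) {σ : GlueState} (ε : ℝ)
    (h : Stage (nodeValue f) k W S₀ σ.bananas t U P T) {e : Entry} {V : List Entry}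
    (hT : T t.opp = e :: V)
    (he : nodeValue f ((core k U).minLeaf (nodeValue f)) <
      nodeValue f (e.minLeaf (nodeValue f))) :
    ∃ τ, undoScare f ε σ (e.minLeaf (nodeValue f)) = some τ ∧
      Stage (nodeValue f) k W S₀ τ.bananas t U
        (Function.update P t.opp
          (P t.opp ++ e :: near (nodeValue f) (e.minLeaf (nodeValue f)) V))
        (Function.update T t.opp (far (nodeValue f) (e.minLeaf (nodeValue f)) V)) := by
  have hV := near_append_far (nodeValue f) (e.minLeaf (nodeValue f)) V
  have hsplit := hT ▸ h.split_ahead t.opp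
  have hlist : ∀ d, Function.update P t.opp
      (P t.opp ++ e :: near (nodeValue f) (e.minLeaf (nodeValue f)) V) d ++
      Function.update T t.opp (far (nodeValue f) (e.minLeaf (nodeValue f)) V) d = P d ++ T d := by
    refine (Side.forall_iff t).mpr ⟨by simp, ?_⟩
    simp only [Function.update_self, List.append_assoc, List.cons_append, hV, hT]
  refine ⟨_, Stage.interchangeMinima hF (σ := { σ with
    alpha := nodeValue f (e.minLeaf (nodeValue f)) - ε }) h hT, ⟨fun d => ?_, h.rising,
    fun u hu d => ?_, (Side.forall_iff t).mpr ⟨?_, ?_⟩⟩, ?_, (Side.forall_iff t).mpr ⟨?_, ?_⟩⟩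
  · rw [hlist, h.split]
  · rw [hlist]; exact h.sep u hu d
  · simpa using h.passed t
  · rw [Function.update_self, List.forall_mem_append, List.forall_mem_cons]
    exact ⟨h.passed _, he, fun e' he' => he.trans (lt_of_mem_near he')⟩
  · have hbananas := h.bananas
    rw [stageBananas, remainder_eq _ _ _ _ _ t.opp, hT, hF.rest_cons hsplit, Multiset.cons_add,
      Multiset.add_cons, Multiset.cons_swap _ (OpenPath.endOn _ t.opp _ _)] at hbananas
    refine (modify_modify (S := σ.bananas) (a := .dummy)
      (b := e.minLeaf (nodeValue f)) hbananas (h.feet_nodup hF) rfl rfl rfl).trans ?_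
    rw [stageBananas, remainder_eq _ _ _ _ _ t.opp]
    simp only [Side.opp_opp, Function.update_self, Function.update_of_ne (Side.ne_opp t),
      hang_append, hang_cons, ← Multiset.singleton_add]
    abel
  · simpa using h.rest_le_init t
  · rw [Function.update_self]
    exact (hF.rest_far_le hsplit).trans (hT ▸ h.rest_le_init t.opp)

end

/-! ### The loop -/

section

variable {f : ℕ → ℝ} {k : Node} {W : Side → List Entry} {S₀ : Multiset Banana}
  {t : Side} {U : List Entry} {P T : Side → List Entry}

/-- The state after a step at the current maximum on side `d`. -/
def GlueState.withNext (τ : GlueState) (cur : Side → Node) (d : Side) : GlueState :=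
  { τ with cur := fun d' =>
      if d' = d then ((low τ.bananas (cur d)).bind (dth τ.bananas)).getD (cur d) else cur d' }

theorem GlueState.lower_side {σ : GlueState} {d : Side}
    (h : σ.Below f (some (σ.cur d)) (some (σ.cur d.opp))) :
    (if σ.Below f (some (σ.cur .left)) (some (σ.cur .right)) then Side.left else Side.right) =
      d := by
  cases d
  · exact if_pos h
  · exact if_neg (lt_asymm h)

theorem glueStep_injury {ε : ℝ} {σ τ : GlueState} {d : Side}
    (h : σ.Below f (some (σ.cur d)) (some (σ.cur d.opp))) {a a' : Node}
    (ha : birth σ.bananas (σ.cur d) = some a) (ha' : birth σ.bananas (σ.cur d.opp) = some a')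
    (hne : a ≠ .dummy) (hμ : σ.Below f (low σ.bananas (σ.cur d)) (some a))
    (hτ : undoInjury f σ d a (σ.cur d) = some τ) :
    glueStep f ε σ = some (τ.withNext σ.cur d) := by
  simp only [glueStep, GlueState.lower_side h, ha, ha', Option.bind_eq_bind, Option.bind_some,
    Option.pure_def]
  simp [hne, hμ, hτ, GlueState.withNext]

theorem glueStep_fatality {ε : ℝ} {σ τ : GlueState} {d : Side}
    (h : σ.Below f (some (σ.cur d)) (some (σ.cur d.opp))) {a' : Node}
    (ha : birth σ.bananas (σ.cur d) = some .dummy)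
    (ha' : birth σ.bananas (σ.cur d.opp) = some a')
    (hne : a' ≠ .dummy) (hμ : σ.Below f (low σ.bananas (σ.cur d)) (some a'))
    (hτ : undoFatality f σ d a' (σ.cur d) = some τ) :
    glueStep f ε σ = some (τ.withNext σ.cur d) := by
  simp only [glueStep, GlueState.lower_side h, ha, ha', Option.bind_eq_bind, Option.bind_some,
    Option.pure_def]
  simp [hne, hμ, hτ, GlueState.withNext]

theorem glueStep_scare {ε : ℝ} {σ τ : GlueState} {d : Side}
    (h : σ.Below f (some (σ.cur d)) (some (σ.cur d.opp))) {a' μ : Node}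
    (ha : birth σ.bananas (σ.cur d) = some .dummy)
    (ha' : birth σ.bananas (σ.cur d.opp) = some a')
    (hlow : low σ.bananas (σ.cur d) = some μ) (hμ : σ.Below f (some a') (some μ))
    (hτ : undoScare f ε σ μ = some τ) :
    glueStep f ε σ = some (τ.withNext σ.cur d) := by
  have hμ' : ¬ σ.Below f (some μ) (some a') := hμ.asymm
  simp only [glueStep, GlueState.lower_side h, ha, ha', Option.bind_eq_bind, Option.bind_some,
    Option.pure_def, hlow]
  simp [hμ, hμ', hτ, GlueState.withNext]

/-- The next maximum ahead, if any, ends the life of the smallest leaf of the core. -/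
def EndsCore (v : Node → ℝ) (k : Node) (U V : List Entry) : Prop :=
  ∀ e ∈ V.head?, v (e.minLeaf v) < v ((core k U).minLeaf v)

/-- The invariant of the loop, with the number of maxima that are still ahead. -/
def GlueInv (f : ℕ → ℝ) (k : Node) (W : Side → List Entry) (S₀ : Multiset Banana)
    (σ : GlueState) (n : ℕ) : Prop :=
  ∃ t U P T, Stage (nodeValue f) k W S₀ σ.bananas t U P T ∧ EndsCore (nodeValue f) k U (T t) ∧
    (∀ d, σ.cur d = top d (T d)) ∧ (T .left).length + (T .right).length = n

theorem Stage.birth_top (hF : Frame (nodeValue f) k W) {S : List Banana}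
    (h : Stage (nodeValue f) k W S₀ S t U P T) :
    birth S (top t (T t)) = some ((core k U).minLeaf (nodeValue f)) :=
  birth_upper (h.upper_nodup hF) h.core_mem

theorem Stage.birth_top_opp (hF : Frame (nodeValue f) k W) {S : List Banana}
    (h : Stage (nodeValue f) k W S₀ S t U P T) : birth S (top t.opp (T t.opp)) = some .dummy :=
  birth_upper (h.upper_nodup hF) h.dummy_mem

theorem Stage.low_below_iff (hF : Frame (nodeValue f) k W) {σ : GlueState}
    (h : Stage (nodeValue f) k W S₀ σ.bananas t U P T) (d : Side) :
    σ.Below f (low σ.bananas (top d (T d))) (some ((core k U).minLeaf (nodeValue f))) ↔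
      EndsCore (nodeValue f) k U (T d) := by
  cases hT : T d with
  | nil =>
    simpa [EndsCore, top, h.low_root hF] using GlueState.none_below (h.real_minLeaf hF)
  | cons e V =>
    have he : e ∈ W d := h.mem_of_ahead (hT ▸ List.mem_cons_self)
    simp [EndsCore, top, h.low_top hF hT,
      GlueState.below_real (hF.real_minLeaf he) (h.real_minLeaf hF)]

theorem Stage.empty (hF : Frame (nodeValue f) k W) {σ : GlueState}
    (h : Stage (nodeValue f) k W S₀ σ.bananas t U P T) (hP : P t.opp = []) (hT : T t.opp = []) :
    σ.Empty t.opp := by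
  have hmem := h.dummy_mem
  rw [hP, hT] at hmem
  have hbelow := below_upper (h.upper_nodup hF) hmem
  constructor <;> refine (hbelow _).trans ?_ <;> cases t <;> rfl

theorem Stage.glueInv_withNext (hF : Frame (nodeValue f) k W) {σ τ : GlueState}
    (h : Stage (nodeValue f) k W S₀ τ.bananas t U P T) (hP : P t = [])
    (hends : EndsCore (nodeValue f) k U (T t))
    (hq : σ.Below f (some (top t (T t))) (some (top t.opp (T t.opp))))
    (hhigh : ∀ x d, x ∈ P d → ¬ σ.Below f (some x.node) (some (top t (T t))))
    {cur : Side → Node} (hcur : ∀ d, cur d = top d (T d)) :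
    ∃ m, GlueInv f k W S₀ (τ.withNext cur t) m ∧
      (m < (T .left).length + (T .right).length ∨ ∃ s, (τ.withNext cur t).Empty s) := by
  have hhigh' : ∀ e ∈ P t.opp ++ T t.opp, ¬ σ.Below f (some e.node) (some (top t (T t))) :=
    List.forall_mem_append.mpr ⟨fun e he => hhigh e _ he,
      fun e he hb => h.not_below_top hF σ he (hb.trans hq)⟩
  cases hT : T t with
  | nil =>
    have hnil : P t.opp ++ T t.opp = [] := List.eq_nil_iff_forall_not_mem.mpr fun e he =>
      hhigh' e he (by rw [hT]; exact GlueState.below_root (hF.real_node (h.mem he)) t)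
    obtain ⟨hP', hT'⟩ := List.append_eq_nil_iff.mp hnil
    refine ⟨_, ⟨t, U, P, T, h, hends, (Side.forall_iff t).mpr ⟨?_, ?_⟩, rfl⟩,
      Or.inr ⟨_, Stage.empty hF (σ := τ.withNext cur t) h hP' hT'⟩⟩
    · simp [GlueState.withNext, hcur, hT, top, h.low_root hF]
    · simp [GlueState.withNext, hcur]
  | cons e V =>
    have he : e ∈ T t := hT ▸ List.mem_cons_self
    have hsep : ∀ e' ∈ P t.opp ++ T t.opp, nodeValue f e.node < nodeValue f e'.node := by
      intro e' he'
      refine lt_of_le_of_ne (not_lt.mp fun hlt => hhigh' e' he' ?_)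
        (hF.node_ne (h.mem_of_ahead he) (h.mem he'))
      rw [hT]
      exact (GlueState.below_real (hF.real_node (h.mem he'))
        (hF.real_node (h.mem_of_ahead he))).mpr hlt
    obtain ⟨hmin, h'⟩ := h.advance hF hP hT (hends e (by simp [hT])) hsep
    refine ⟨_, ⟨t, _, _, _, h', ?_, (Side.forall_iff t).mpr ⟨?_, ?_⟩, rfl⟩, Or.inl ?_⟩
    · intro e' he'
      rw [Function.update_self] at he'
      rw [hmin]
      exact lt_of_mem_head_far (hF.minLeaf_ne_of_append (hT ▸ h.split_ahead t)) he'
    · simp [GlueState.withNext, hcur, hT, top, h.low_top hF hT, h.dth_minLeaf_top hF hT]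
    · simp [GlueState.withNext, hcur]
    · rw [← Side.add_opp (fun d => (T d).length) t, ← Side.add_opp (fun d => List.length _) t]
      have := length_far_le (nodeValue f) (e.minLeaf (nodeValue f)) V
      simp only [Function.update_self, Function.update_of_ne (Side.opp_ne t), hT, List.length_cons]
      omega

theorem Stage.exists_glueStep_injury (hF : Frame (nodeValue f) k W) (ε : ℝ) {σ : GlueState}
    (h : Stage (nodeValue f) k W S₀ σ.bananas t U P T)
    (hends : EndsCore (nodeValue f) k U (T t)) (hcur : ∀ d, σ.cur d = top d (T d))
    (hq : σ.Below f (some (top t (T t))) (some (top t.opp (T t.opp)))) :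
    ∃ τ m, glueStep f ε σ = some τ ∧ GlueInv f k W S₀ τ m ∧
      (m < (T .left).length + (T .right).length ∨ ∃ s, τ.Empty s) := by
  obtain ⟨τ, hτ, U', P', h', hmin, hP', hhigh⟩ := h.undoInjury hF hq
  obtain ⟨m, hinv, hm⟩ :=
    h'.glueInv_withNext hF hP' (by rwa [EndsCore, hmin]) hq (hhigh · ·) hcur
  rw [← hcur t] at hτ
  refine ⟨_, m, glueStep_injury (a' := .dummy) ?_ ?_ ?_ (h.real_minLeaf hF).ne_dummy ?_ hτ,
    hinv, hm⟩
  · rwa [hcur, hcur]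
  · rw [hcur, h.birth_top hF]
  · rw [hcur, h.birth_top_opp hF]
  · rwa [hcur, h.low_below_iff hF]

theorem Stage.exists_glueStep_fatality (hF : Frame (nodeValue f) k W) (ε : ℝ) {σ : GlueState}
    (h : Stage (nodeValue f) k W S₀ σ.bananas t U P T)
    (hends : EndsCore (nodeValue f) k U (T t.opp)) (hcur : ∀ d, σ.cur d = top d (T d))
    (hq : σ.Below f (some (top t.opp (T t.opp))) (some (top t (T t)))) :
    ∃ τ m, glueStep f ε σ = some τ ∧ GlueInv f k W S₀ τ m ∧
      (m < (T .left).length + (T .right).length ∨ ∃ s, τ.Empty s) := by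
  obtain ⟨τ, hτ, U', P', h', hmin, hP', hhigh⟩ := h.undoFatality hF hq
  obtain ⟨m, hinv, hm⟩ := h'.glueInv_withNext hF hP' (by rwa [EndsCore, hmin])
    (by rwa [Side.opp_opp]) (hhigh · ·) hcur
  rw [← hcur t.opp] at hτ
  refine ⟨_, m, glueStep_fatality ?_ ?_ ?_ (h.real_minLeaf hF).ne_dummy ?_ hτ, hinv, hm⟩
  · rwa [Side.opp_opp, hcur, hcur]
  · rw [hcur, h.birth_top_opp hF]
  · rw [Side.opp_opp, hcur, h.birth_top hF]
  · rwa [hcur, h.low_below_iff hF]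

theorem Stage.exists_glueStep_scare (hF : Frame (nodeValue f) k W) (ε : ℝ) {σ : GlueState}
    (h : Stage (nodeValue f) k W S₀ σ.bananas t U P T)
    (hends : EndsCore (nodeValue f) k U (T t)) (hopp : ¬ EndsCore (nodeValue f) k U (T t.opp))
    (hcur : ∀ d, σ.cur d = top d (T d))
    (hq : σ.Below f (some (top t.opp (T t.opp))) (some (top t (T t)))) :
    ∃ τ m, glueStep f ε σ = some τ ∧ GlueInv f k W S₀ τ m ∧
      (m < (T .left).length + (T .right).length ∨ ∃ s, τ.Empty s) := by
  cases hT : T t.opp with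
  | nil => exact absurd (by simp [EndsCore, hT]) hopp
  | cons e V =>
    have he : e ∈ T t.opp := hT ▸ List.mem_cons_self
    have hlt : nodeValue f ((core k U).minLeaf (nodeValue f)) <
        nodeValue f (e.minLeaf (nodeValue f)) :=
      lt_of_le_of_ne (by simpa [EndsCore, hT] using hopp)
        (h.minLeaf_ne hF (List.mem_append_right _ he))
    obtain ⟨τ, hτ, h'⟩ := h.undoScare hF ε hT hlt
    have hdummy := h'.dummy_mem
    rw [Function.update_self, Function.update_self] at hdummy
    have hlow : low τ.bananas e.node = some .dummy := by
      refine low_eq_lower (h'.feet_nodup hF) hdummy ?_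
      rw [OpenPath.foot_endOn]
      simp
    have hdth : dth τ.bananas .dummy =
        some (top t.opp (far (nodeValue f) (e.minLeaf (nodeValue f)) V)) :=
      dth_lower (h'.feet_nodup hF) hdummy
    refine ⟨_, _, glueStep_scare (d := t.opp) (by rwa [Side.opp_opp, hcur, hcur])
      (by rw [hcur, h.birth_top_opp hF]) (by rw [Side.opp_opp, hcur, h.birth_top hF])
      (by rw [hcur, hT, top, h.low_top hF hT])
      ((GlueState.below_real (h.real_minLeaf hF) (hF.real_minLeaf (h.mem_of_ahead he))).mpr hlt)
      hτ, ⟨t, _, _, _, h', ?_, (Side.forall_iff t).mpr ⟨?_, ?_⟩, rfl⟩, Or.inl ?_⟩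
    · rwa [Function.update_of_ne (Side.ne_opp t)]
    · simp [GlueState.withNext, hcur]
    · simp [GlueState.withNext, hcur, hT, top, hlow, hdth]
    · rw [← Side.add_opp (fun d => (T d).length) t, ← Side.add_opp (fun d => List.length _) t]
      have := length_far_le (nodeValue f) (e.minLeaf (nodeValue f)) V
      simp only [Function.update_self, Function.update_of_ne (Side.ne_opp t), hT, List.length_cons]
      omega

theorem GlueInv.step (hF : Frame (nodeValue f) k W) (ε : ℝ) {σ : GlueState} {n : ℕ}
    (h : GlueInv f k W S₀ σ n) :
    ∃ τ m, glueStep f ε σ = some τ ∧ GlueInv f k W S₀ τ m ∧ (m < n ∨ ∃ s, τ.Empty s) := by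
  obtain ⟨t, U, P, T, h, hends, hcur, rfl⟩ := h
  rcases h.below_or_below hF σ t with hq | hq
  · exact h.exists_glueStep_injury hF ε hends hcur hq
  · by_cases hopp : EndsCore (nodeValue f) k U (T t.opp)
    · exact h.exists_glueStep_fatality hF ε hopp hcur hq
    · exact h.exists_glueStep_scare hF ε hends hopp hcur hq

theorem GlueInv.inSpine (hF : Frame (nodeValue f) k W) {S : List Banana} {σ : GlueState} {n : ℕ}
    (h : GlueInv f k W (S : Multiset Banana) σ n) (s : Side) :
    InSpine S (.root s) s.opp (σ.cur s) ∧ InSpine σ.bananas (.root s) s.opp (σ.cur s) := by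
  obtain ⟨t, U, P, T, h, -, hcur, -⟩ := h
  rw [hcur]
  exact ⟨hF.inSpine_top (h.split_ahead s) (h.rest_le_init s),
    hF.inSpine_top (h.split_ahead s) (h.rest_le s)⟩

theorem GlueInv.exists_run (hF : Frame (nodeValue f) k W) (ε : ℝ) {n : ℕ} : ∀ {σ : GlueState},
    GlueInv f k W S₀ σ n → ∃ (N : ℕ) (run : ℕ → GlueState), run 0 = σ ∧ 0 < N ∧
      (∀ i < N, glueStep f ε (run i) = some (run (i + 1))) ∧
      (∀ i, 0 < i → i < N → ∀ s, ¬ (run i).Empty s) ∧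
      (∃ s, (run N).Empty s) ∧ ∀ i ≤ N, ∃ m, GlueInv f k W S₀ (run i) m := by
  induction n using Nat.strong_induction_on with
  | _ n ih =>
  intro σ h
  obtain ⟨τ, m, hτ, hinv, hm⟩ := h.step hF ε
  by_cases he : ∃ s, τ.Empty s
  · refine ⟨1, fun i => if i = 0 then σ else τ, rfl, one_pos, ?_, by omega, he, ?_⟩
    · intro i hi
      obtain rfl : i = 0 := by omega
      exact hτ
    · intro i _
      by_cases h0 : i = 0
      · exact ⟨n, by simpa [h0] using h⟩
      · exact ⟨m, by simpa [h0] using hinv⟩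
  · obtain ⟨N, run, h0, -, hstep, hcontinues, hstops, hrun⟩ := ih m (hm.resolve_right he) hinv
    refine ⟨N + 1, fun i => if i = 0 then σ else run (i - 1), rfl, Nat.succ_pos _, ?_, ?_, ?_, ?_⟩
    · rintro (_ | i) hi
      · simpa [h0] using hτ
      · simpa using hstep i (by omega)
    · rintro (_ | _ | i) hi0 hi
      · omega
      · simpa [h0] using fun s hs => he ⟨s, hs⟩
      · simpa using hcontinues (i + 1) (by omega) (by omega)
    · simpa using hstops
    · rintro (_ | i) hi
      · exact ⟨n, by simpa using h⟩
      · simpa using hrun i (by omega)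

theorem exists_mem_of_below_eq {S : List Banana} {b x : Node} {d : Side}
    (h : below S b d = some x) :
    ∃ B ∈ S, B.upper = b ∧ ((B.trail d).getLast?).getD B.lower = x := by
  obtain ⟨B, hB, hx⟩ := Option.map_eq_some_iff.mp h
  exact ⟨B, List.mem_of_find?_eq_some hB, by simpa using List.find?_some hB, hx⟩

theorem Banana.getLast_mem_foot (B : Banana) (d : Side) :
    ((B.trail d).getLast?).getD B.lower ∈ B.foot := by
  cases h : (B.trail d).getLast? with
  | none => exact B.lower_mem_foot
  | some y => exact Banana.mem_foot_of_mem_trail (List.mem_of_mem_getLast? h)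

theorem Stage.eq_of_empty (hF : Frame (nodeValue f) k W) {σ : GlueState}
    (h : Stage (nodeValue f) k W S₀ σ.bananas t U P T) {d : Side} (hd : σ.Empty d) :
    d = t.opp ∧ P t.opp = [] ∧ T t.opp = [] := by
  obtain ⟨X, hX, hupper, hlast⟩ := exists_mem_of_below_eq hd.1
  have hdummy : .dummy ∈ X.foot := by simpa only [hlast] using X.getLast_mem_foot .left
  obtain rfl : X = dummyPath.endOn t.opp (P t.opp) (T t.opp) :=
    eq_of_mem_foot (h.feet_nodup hF) hX h.dummy_mem hdummy (Banana.lower_mem_foot _)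
  have hT : T t.opp = [] := by
    cases hT : T t.opp with
    | nil => rfl
    | cons e V =>
      rw [hT] at hupper
      exact absurd hupper ((hF.real_node (h.mem_of_ahead (hT ▸ List.mem_cons_self))).ne_root d)
  rw [hT] at hupper
  obtain rfl : t.opp = d := Node.root.inj hupper
  refine ⟨rfl, ?_, hT⟩
  have hbelow : below σ.bananas (.root t.opp) t.opp = some .dummy := by
    cases t
    exacts [hd.2, hd.1]
  have hroot := below_upper (h.upper_nodup hF) h.dummy_mem t.opp
  rw [hT, hupper, hbelow] at hroot
  rcases List.eq_nil_or_concat (P t.opp) with hP | ⟨V, e, hP⟩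
  · exact hP
  · have he : e ∈ P t.opp := by simp [hP]
    exact absurd (by simpa [OpenPath.endOn, hP] using hroot.symm)
      (hF.real_node (h.mem_of_passed he)).ne_dummy

theorem Stage.survivor_eq (hF : Frame (nodeValue f) k W) {σ : GlueState}
    (h : Stage (nodeValue f) k W S₀ σ.bananas t U P T) (he : σ.Empty t.opp) : σ.survivor = t := by
  have hnot : ¬ σ.Empty t := fun ht => Side.ne_opp t (h.eq_of_empty hF ht).1
  cases t
  exacts [if_neg hnot, if_pos he]

theorem Merge.filter_append_eq (hF : Frame (nodeValue f) k W)
    (h : Merge (nodeValue f) k W U P T) (hopp : P t.opp ++ T t.opp = []) (d : Side) :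
    (U ++ (P t ++ T t)).filter (fun e => e.side = d) = W d := by
  have hside : ∀ e ∈ P t ++ T t, e.side = t := fun e he => hF.side t e (h.mem he)
  rw [List.filter_append, ← h.split d]
  congr 1
  rcases Side.eq_or_eq_opp t d with rfl | rfl
  · rw [List.filter_eq_self]
    simpa using hside
  · rw [hopp, List.filter_eq_nil_iff]
    intro e he
    simp [hside e he]

theorem Merge.deco_build_append (hF : Frame (nodeValue f) k W)
    (h : Merge (nodeValue f) k W U P T) (t : Side) :
    deco (nodeValue f) (build (.leaf k) (U ++ (P t ++ T t))) =
      (P t ++ T t).foldl (Deco.step (nodeValue f)) (deco (nodeValue f) (core k U)) := by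
  rw [build_append, ← core, deco_build]
  refine nodup_map_of_le hF.nodup ?_
  rw [← h.inorder_core_add t, ← add_assoc]
  exact Multiset.le_add_right _ _

theorem Stage.result_eq (hF : Frame (nodeValue f) k W) {σ : GlueState}
    (h : Stage (nodeValue f) k W S₀ σ.bananas t U P T)
    (hends : EndsCore (nodeValue f) k U (T t)) (hsurv : σ.survivor = t)
    (hP : P t.opp = []) (hT : T t.opp = []) :
    (σ.result : Multiset Banana) =
      (deco (nodeValue f) (build (.leaf k) (U ++ (P t ++ T t)))).close (.root t) := by
  have hfeet := h.feet_nodup hF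
  have hupper := h.upper_nodup hF
  have hbananas := h.bananas
  rw [stageBananas, remainder_eq _ k U P T t, hP, hT] at hbananas
  rw [hbananas] at hfeet hupper
  rw [Multiset.map_cons, Multiset.nodup_cons] at hupper
  rw [h.deco_build_append hF, foldl_step_append_close t _ (h.passed t) hends,
    OpenPath.addAll_close_top _ fun e he => hF.side t e (h.mem_of_passed he),
    GlueState.result, hsurv,
    ← Multiset.filter_coe, hbananas, Multiset.filter_cons_of_neg _ fun hX => hX.1 rfl,
    Multiset.filter_eq_self.mpr]
  · simp [hang, rest]
  · exact fun X hX => ⟨lower_ne_of_feet_nodup hfeet X hX,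
      fun hu => hupper.1 (Multiset.mem_map.mpr ⟨X, hX, hu⟩)⟩

theorem GlueInv.exists_result_eq (hF : Frame (nodeValue f) k W) {σ : GlueState} {n : ℕ}
    (h : GlueInv f k W S₀ σ n) (he : ∃ s, σ.Empty s) :
    ∃ U : List Entry, (∀ d, (U.filter fun e => e.side = d) = W d) ∧ Rising (nodeValue f) U ∧
      (σ.result : Multiset Banana) =
        (deco (nodeValue f) (build (.leaf k) U)).close (.root σ.survivor) := by
  obtain ⟨t, U, P, T, h, hends, -, -⟩ := h
  obtain ⟨d, hd⟩ := he
  obtain ⟨rfl, hP, hT⟩ := h.eq_of_empty hF hd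
  have hsurv := h.survivor_eq hF hd
  refine ⟨U ++ (P t ++ T t), h.filter_append_eq hF (by simp [hP, hT]), ?_,
    hsurv.symm ▸ h.result_eq hF hends hsurv hP hT⟩
  exact List.pairwise_append.mpr
    ⟨h.rising, h.rising_append hF t, fun u hu e he => h.sep u hu t e he⟩

end

/-! ### Heap-ordered trees -/

namespace BinTree

variable {v v' : Node → ℝ}

theorem top_mem_inorder (T : BinTree) : T.top ∈ T.inorder := by
  cases T <;> simp [top, inorder]

theorem inorder_ne_nil (T : BinTree) : T.inorder ≠ [] := List.ne_nil_of_mem T.top_mem_inorder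

theorem HeapOrdered.eq_top_or_lt {T : BinTree} (h : T.HeapOrdered v) :
    ∀ x ∈ T.inorder, x = T.top ∨ v x < v T.top := by
  induction T with
  | leaf a => simp [inorder, top]
  | node l b r ihl ihr =>
    obtain ⟨h1, h2, h3, h4⟩ := h
    simp only [inorder, List.mem_append, List.mem_cons]
    rintro x (hx | rfl | hx)
    · right
      rcases ihl h3 x hx with rfl | hx
      exacts [h1, hx.trans h1]
    · exact Or.inl rfl
    · right
      rcases ihr h4 x hx with rfl | hx
      exacts [h2, hx.trans h2]

theorem HeapOrdered.le_top {T : BinTree} (h : T.HeapOrdered v) {x : Node} (hx : x ∈ T.inorder) :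
    v x ≤ v T.top := by
  rcases h.eq_top_or_lt x hx with rfl | h'
  exacts [le_rfl, h'.le]

theorem HeapOrdered.eq_of_inorder_eq {T T' : BinTree} (h : T.HeapOrdered v)
    (h' : T'.HeapOrdered v) (he : T.inorder = T'.inorder) : T = T' := by
  induction T generalizing T' with
  | leaf a =>
    cases T' with
    | leaf a' => simpa [inorder] using he
    | node l b r =>
      have := congrArg List.length he
      have := List.length_pos_iff.mpr l.inorder_ne_nil
      simp [inorder] at *
      omega
  | node l b r ihl ihr =>
    cases T' with
    | leaf a' =>
      have := congrArg List.length he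
      have := List.length_pos_iff.mpr l.inorder_ne_nil
      simp [inorder] at *
      omega
    | node l' b' r' =>
      obtain rfl : b' = b := by
        rcases h.eq_top_or_lt b' (by rw [he]; simp [inorder]) with h1 | h1
        · exact h1
        · rcases h'.eq_top_or_lt b (by rw [← he]; simp [inorder]) with h2 | h2
          exacts [h2.symm, absurd h1 h2.not_gt]
      obtain ⟨h1, h2, h3, h4⟩ := h
      have hl : b' ∉ l.inorder := fun hb => ((h3.le_top hb).trans_lt h1).false
      have hr : b' ∉ r.inorder := fun hb => ((h4.le_top hb).trans_lt h2).false
      obtain ⟨hel, -, her⟩ := (List.append_cons_inj_of_notMem hl hr).mp he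
      rw [ihl h3 h'.2.2.1 hel, ihr h4 h'.2.2.2 her]

theorem HeapOrdered.congr {T : BinTree} (hT : T.HeapOrdered v)
    (h : ∀ x ∈ T.inorder, v x = v' x) : T.HeapOrdered v' := by
  induction T with
  | leaf a => trivial
  | node l b r ihl ihr =>
    simp only [inorder, List.mem_append, List.mem_cons] at h
    obtain ⟨h1, h2, h3, h4⟩ := hT
    have hb := h b (Or.inr (Or.inl rfl))
    refine ⟨?_, ?_, ihl h3 fun x hx => h x (Or.inl hx),
      ihr h4 fun x hx => h x (Or.inr (Or.inr hx))⟩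
    · rwa [← hb, ← h _ (Or.inl l.top_mem_inorder)]
    · rwa [← hb, ← h _ (Or.inr (Or.inr r.top_mem_inorder))]

theorem heapOrdered_join {s : Side} {O I : BinTree} {b : Node} :
    (join s O b I).HeapOrdered v ↔
      (v O.top < v b ∧ O.HeapOrdered v) ∧ v I.top < v b ∧ I.HeapOrdered v := by
  cases s <;> simp only [join, HeapOrdered] <;> tauto

@[simp] theorem top_join (s : Side) (O : BinTree) (b : Node) (I : BinTree) :
    (join s O b I).top = b := by
  cases s <;> rfl

theorem HeapOrdered.minLeaf_le {T : BinTree} (hT : T.HeapOrdered v) :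
    ∀ x ∈ T.inorder, v (T.minLeaf v) ≤ v x := by
  induction T with
  | leaf a => simp [minLeaf, deco, decompose, inorder]
  | node l b r ihl ihr =>
    obtain ⟨h1, h2, h3, h4⟩ := hT
    have hl := ihl h3
    have hr := ihr h4
    have hb := (hl _ l.top_mem_inorder).trans h1.le
    have hb' := (hr _ r.top_mem_inorder).trans h2.le
    simp only [minLeaf, deco] at hl hr hb hb'
    simp only [minLeaf, deco, decompose, inorder, List.mem_append, List.mem_cons]
    split_ifs with hlt
    · rintro x (hx | rfl | hx)
      exacts [hl x hx, hb, hlt.le.trans (hr x hx)]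
    · rintro x (hx | rfl | hx)
      exacts [(not_lt.mp hlt).trans (hl x hx), hb', hr x hx]

end BinTree

theorem heapOrdered_build {v : Node → ℝ} {T : BinTree} {W : List Entry} :
    (build T W).HeapOrdered v ↔ T.HeapOrdered v ∧
      (∀ e ∈ W, v e.tree.top < v e.node ∧ e.tree.HeapOrdered v ∧ v T.top < v e.node) ∧
      Rising v W := by
  induction W generalizing T with
  | nil => simp [build, Rising]
  | cons e W ih =>
    change (build (.join e.side e.tree e.node T) W).HeapOrdered v ↔ _
    rw [ih, BinTree.heapOrdered_join, BinTree.top_join, List.forall_mem_cons, Rising, Rising,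
      List.pairwise_cons]
    constructor
    · rintro ⟨⟨⟨h1, h2⟩, h3, h4⟩, h5, h6⟩
      exact ⟨h4, ⟨⟨h1, h2, h3⟩, fun e' he' =>
        ⟨(h5 e' he').1, (h5 e' he').2.1, h3.trans (h5 e' he').2.2⟩⟩, fun e' he' =>
        (h5 e' he').2.2, h6⟩
    · rintro ⟨h4, ⟨⟨h1, h2, h3⟩, h5⟩, h6, h7⟩
      exact ⟨⟨⟨h1, h2⟩, h3, h4⟩, fun e' he' => ⟨(h5 e' he').1, (h5 e' he').2.1, h6 e' he'⟩, h7⟩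

/-! ### In-order sequences along a spine -/

theorem exists_build_eq (d : Side) (T : BinTree) :
    ∃ k W, build (.leaf k) W = T ∧ ∀ e ∈ W, e.side = d := by
  induction T with
  | leaf a => exact ⟨a, [], rfl, by simp⟩
  | node l b r ihl ihr =>
    have hconcat : ∀ {W : List Entry} {e : Entry}, (∀ e ∈ W, e.side = d) → e.side = d →
        ∀ e' ∈ W ++ [e], e'.side = d := fun hW he =>
      List.forall_mem_append.mpr ⟨hW, by simpa using he⟩
    cases d
    · obtain ⟨k, W, hr, hW⟩ := ihr
      exact ⟨k, W ++ [⟨.left, b, l⟩], by rw [build_concat, hr]; rfl, hconcat hW rfl⟩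
    · obtain ⟨k, W, hl, hW⟩ := ihl
      exact ⟨k, W ++ [⟨.right, b, r⟩], by rw [build_concat, hl]; rfl, hconcat hW rfl⟩

/-- The in-order sequence of the entries on side `d`, which precedes (`d = left`) or follows
(`d = right`) that of the tree to which the entries are added. -/
def outer (d : Side) : List Entry → List Node
  | [] => []
  | e :: W =>
    match d with
    | .left => if e.side = .left then outer .left W ++ (e.tree.inorder ++ [e.node])
        else outer .left W
    | .right => if e.side = .right then e.node :: (e.tree.inorder ++ outer .right W)
        else outer .right W

theorem inorder_build_eq (T : BinTree) (W : List Entry) :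
    (build T W).inorder = outer .left W ++ T.inorder ++ outer .right W := by
  induction W generalizing T with
  | nil => simp [build, outer]
  | cons e W ih =>
    change (build (.join e.side e.tree e.node T) W).inorder = _
    rw [ih]
    cases hs : e.side <;> simp [BinTree.join, BinTree.inorder, outer, hs]

theorem outer_filter (d : Side) (W : List Entry) :
    outer d (W.filter fun e => e.side = d) = outer d W := by
  induction W with
  | nil => rfl
  | cons e W ih =>
    cases d
    · by_cases hs : e.side = .left <;> simp [outer, hs, ih]
    · by_cases hs : e.side = .right <;> simp [outer, hs, ih]

theorem outer_opp {d : Side} {W : List Entry} (h : ∀ e ∈ W, e.side = d) : outer d.opp W = [] := by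
  rw [← outer_filter, List.filter_eq_nil_iff.mpr fun e he => by simp [h e he]]
  rfl

/-- Attach the nodes `Y`, listed from outside to inside, at the inner end of the in-order sequence
`X` of a tree on side `d`. -/
def attach (d : Side) (X Y : List Node) : List Node :=
  match d with
  | .left => X ++ Y
  | .right => Y.reverse ++ X

theorem coe_attach (d : Side) (X Y : List Node) :
    (attach d X Y : Multiset Node) = (X : Multiset Node) + (Y : Multiset Node) := by
  cases d
  · rfl
  · rw [attach, ← Multiset.coe_add, Multiset.coe_reverse, add_comm]

theorem attach_inj {d : Side} {X X' Y Y' : List Node} (h : attach d X Y = attach d X' Y')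
    (hl : Y.length = Y'.length) : X = X' ∧ Y = Y' := by
  cases d
  · exact List.append_inj' h hl
  · obtain ⟨h1, h2⟩ := List.append_inj h (by simpa using hl)
    exact ⟨h2, List.reverse_injective h1⟩

theorem attach_pair (d : Side) (X : List Node) (b a : Node) :
    attach d X [b, a] = attach d (attach d X [b]) [a] := by
  cases d <;> simp [attach]

theorem inorder_build_of_side {d : Side} {W : List Entry} (h : ∀ e ∈ W, e.side = d) (k : Node) :
    (build (.leaf k) W).inorder = attach d (outer d W) [k] := by
  have := outer_opp h
  rw [inorder_build_eq]
  cases d <;> simp_all [attach, BinTree.inorder, Side.opp]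

theorem inorder_build_join {d : Side} {W : List Entry} (h : ∀ e ∈ W, e.side = d) (O : BinTree)
    (b k : Node) : (build (.join d O b (.leaf k)) W).inorder =
      attach d (build O W).inorder [b, k] := by
  have := outer_opp h
  rw [inorder_build_eq, inorder_build_eq]
  cases d <;> simp_all [attach, BinTree.inorder, Side.opp, BinTree.join]

theorem nodes_eq_outer {d : Side} {W : List Entry} (h : ∀ e ∈ W, e.side = d) :
    nodes W = (outer d W : Multiset Node) := by
  have hbuild := inorder_build (.leaf .dummy) W
  rw [inorder_build_of_side h, coe_attach, add_comm] at hbuild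
  exact (add_left_cancel hbuild).symm

theorem mem_of_inorder_build_eq_attach {d : Side} {O : BinTree} {W : List Entry}
    (h : ∀ e ∈ W, e.side = d) {X : List Node} {k : Node}
    (hk : (build O W).inorder = attach d X [k]) : k ∈ O.inorder := by
  obtain ⟨k', W', rfl, hside⟩ := exists_build_eq d O
  rw [← build_append, inorder_build_of_side (List.forall_mem_append.mpr ⟨hside, h⟩)] at hk
  obtain rfl : k' = k := by simpa using (attach_inj hk rfl).2
  rw [inorder_build_of_side hside]
  cases d <;> simp [attach]

/-! ### Dependence on the values -/

section

variable {v v' : Node → ℝ}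

theorem decompose_congr {T : BinTree} (h : ∀ x ∈ T.inorder, v x = v' x) :
    decompose v T = decompose v' T := by
  induction T with
  | leaf a => rfl
  | node l b r ihl ihr =>
    simp only [BinTree.inorder, List.mem_append, List.mem_cons] at h
    have hl := ihl fun x hx => h x (Or.inl hx)
    have hr := ihr fun x hx => h x (Or.inr (Or.inr hx))
    have hvl := h _ (Or.inl (l.minLeaf_mem v))
    have hvr := h _ (Or.inr (Or.inr (r.minLeaf_mem v)))
    simp only [BinTree.minLeaf, deco, hl, hr] at hvl hvr
    simp only [decompose, hl, hr, hvl, hvr]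

theorem deco_congr {T : BinTree} (h : ∀ x ∈ T.inorder, v x = v' x) : deco v T = deco v' T := by
  simp only [deco, decompose_congr h]

theorem BinTree.minLeaf_congr {T : BinTree} (h : ∀ x ∈ T.inorder, v x = v' x) :
    v (T.minLeaf v) = v' (T.minLeaf v') := by
  rw [h _ (T.minLeaf_mem v), BinTree.minLeaf, deco_congr h]; rfl

theorem hang_congr {W : List Entry} (h : ∀ e ∈ W, ∀ x ∈ e.tree.inorder, v x = v' x) :
    hang v W = hang v' W :=
  congrArg List.sum (List.map_congr_left fun e he => by rw [deco_congr (h e he)])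

theorem lower_step (v : Node → ℝ) (X : Deco) (e : Entry) :
    (X.step v e).1.lower = if v (e.minLeaf v) < v X.1.lower then e.minLeaf v else X.1.lower := by
  unfold Deco.step
  split_ifs <;> rfl

theorem foldl_step_congr {W : List Entry} {X : Deco}
    (h : ∀ e ∈ W, ∀ x ∈ e.tree.inorder, v x = v' x) (hX : v X.1.lower = v' X.1.lower) :
    W.foldl (Deco.step v) X = W.foldl (Deco.step v') X := by
  induction W generalizing X with
  | nil => rfl
  | cons e W ih =>
    rw [List.forall_mem_cons] at h
    have hstep : X.step v e = X.step v' e := by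
      simp only [Deco.step, Entry.minLeaf, BinTree.minLeaf_congr h.1, hX, Deco.turn, Deco.pass,
        deco_congr h.1]
      rfl
    rw [List.foldl_cons, List.foldl_cons, ← hstep]
    refine ih h.2 ?_
    rw [lower_step]
    split_ifs
    exacts [h.1 _ (e.tree.minLeaf_mem v), hX]

theorem rest_congr (s : Side) {W : List Entry} (h : ∀ e ∈ W, ∀ x ∈ e.tree.inorder, v x = v' x) :
    rest v s W = rest v' s W := by
  cases W with
  | nil => rfl
  | cons e W =>
    rw [List.forall_mem_cons] at h
    simp only [rest]
    rw [foldl_step_congr (X := ((deco v e.tree).1.extend e.side.opp e.node, (deco v e.tree).2)) h.2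
      (h.1 _ (e.tree.minLeaf_mem v)), deco_congr h.1]

end

/-! ### Removing a pair of nodes -/

/-- Remove the node `b` from the trails. -/
def OpenPath.erase (b : Node) (P : OpenPath) : OpenPath :=
  ⟨P.lower, fun d => (P.trail d).filter fun u => u ≠ b⟩

/-- Remove the node `b` from the trails. -/
def Banana.erase (b : Node) (B : Banana) : Banana :=
  { B with trail := fun d => (B.trail d).filter fun u => u ≠ b }

/-- Remove the banana with lower end `h`, and the node `b` from all trails. -/
def eraseBananas (b h : Node) (M : Multiset Banana) : Multiset Banana :=
  (M.filter fun B => B.lower ≠ h).map (Banana.erase b)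

/-- Remove a maximum `b` and a minimum `h` from a decomposition. -/
def Deco.erase (b h : Node) (X : Deco) : Deco := (X.1.erase b, eraseBananas b h X.2)

section

variable {v : Node → ℝ} {b h : Node}

@[simp] theorem eraseBananas_add (M M' : Multiset Banana) :
    eraseBananas b h (M + M') = eraseBananas b h M + eraseBananas b h M' := by
  simp [eraseBananas]

theorem eraseBananas_cons {B : Banana} (M : Multiset Banana) (hB : B.lower ≠ h) :
    eraseBananas b h (B ::ₘ M) = B.erase b ::ₘ eraseBananas b h M := by
  simp [eraseBananas, hB]

theorem OpenPath.erase_of_notMem {P : OpenPath} (hb : b ∉ P.foot) : P.erase b = P := by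
  have : ∀ d, (P.trail d).filter (fun u => u ≠ b) = P.trail d := fun d =>
    List.filter_eq_self.mpr fun u hu => by
      simpa using fun hub : u = b => hb (hub ▸ OpenPath.mem_foot_of_mem_trail hu)
  simp only [OpenPath.erase, this]

theorem Banana.erase_of_notMem {B : Banana} (hb : b ∉ B.foot) : B.erase b = B := by
  have := congrArg OpenPath.trail (OpenPath.erase_of_notMem (P := ⟨B.lower, B.trail⟩) hb)
  exact Banana.ext rfl rfl this

theorem eraseBananas_of_notMem {M : Multiset Banana} (hb : b ∉ feet M) (hh : h ∉ feet M) :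
    eraseBananas b h M = M := by
  rw [eraseBananas, Multiset.filter_eq_self.mpr]
  · conv_rhs => rw [← Multiset.map_id M]
    exact Multiset.map_congr rfl fun B hB =>
      Banana.erase_of_notMem fun hx => hb (mem_feet.mpr ⟨B, hB, hx⟩)
  · exact fun B hB he => hh (mem_feet.mpr ⟨B, hB, he ▸ B.lower_mem_foot⟩)

theorem OpenPath.erase_extend_self (P : OpenPath) (d : Side) :
    (P.extend d b).erase b = P.erase b := by
  simp only [OpenPath.erase, OpenPath.extend, OpenPath.mk.injEq, true_and]
  funext d'
  split_ifs <;> simp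

theorem OpenPath.erase_extend_of_ne (P : OpenPath) (d : Side) {c : Node} (hc : c ≠ b) :
    (P.extend d c).erase b = (P.erase b).extend d c := by
  simp only [OpenPath.erase, OpenPath.extend, OpenPath.mk.injEq, true_and]
  funext d'
  split_ifs <;> simp [hc]

theorem notMem_feet_deco {T : BinTree} {x : Node} (hx : x ∉ T.inorder) :
    x ∉ (deco v T).1.foot ∧ x ∉ feet (deco v T).2 := by
  rwa [← Multiset.mem_coe, ← feet_deco v T, Multiset.mem_add, not_or] at hx

theorem Deco.erase_deco {T : BinTree} (hb : b ∉ T.inorder) (hh : h ∉ T.inorder) :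
    (deco v T).erase b h = deco v T :=
  Prod.ext (OpenPath.erase_of_notMem (notMem_feet_deco hb).1)
    (eraseBananas_of_notMem (notMem_feet_deco hb).2 (notMem_feet_deco hh).2)

theorem Deco.step_erase {e : Entry} {X : Deco} (hne : e.node ≠ b) (hb : b ∉ e.tree.inorder)
    (hh : h ∉ e.tree.inorder) (hX : X.1.lower ≠ h) :
    (X.erase b h).step v e = (X.step v e).erase b h := by
  have hlow : (X.erase b h).1.lower = X.1.lower := rfl
  have htree := Deco.erase_deco (v := v) hb hh
  have hpath : (deco v e.tree).1.erase b = (deco v e.tree).1 := congrArg Prod.fst htree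
  have hbananas : eraseBananas b h (deco v e.tree).2 = (deco v e.tree).2 := congrArg Prod.snd htree
  have hclosed : ((deco v e.tree).1.close e.node).erase b = (deco v e.tree).1.close e.node :=
    Banana.erase_of_notMem (notMem_feet_deco hb).1
  have hleaf : ((deco v e.tree).1.close e.node).lower ≠ h := fun he =>
    hh (he ▸ e.tree.minLeaf_mem v)
  unfold Deco.step
  rw [hlow]
  split_ifs
  · simp only [Deco.turn, Deco.erase, OpenPath.erase_extend_of_ne _ _ hne, hpath]
    rw [eraseBananas_cons _ hX, eraseBananas_add, hbananas]
    rfl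
  · simp only [Deco.pass, Deco.erase, OpenPath.erase_extend_of_ne _ _ hne]
    rw [eraseBananas_cons _ hleaf, eraseBananas_add, hbananas, hclosed]

theorem foldl_step_erase {W : List Entry} {X : Deco} (hb : b ∉ nodes W) (hh : h ∉ nodes W)
    (hX : X.1.lower ≠ h) :
    W.foldl (Deco.step v) (X.erase b h) = (W.foldl (Deco.step v) X).erase b h ∧
      (W.foldl (Deco.step v) X).1.lower ≠ h := by
  induction W generalizing X with
  | nil => exact ⟨rfl, hX⟩
  | cons e W ih =>
    simp only [nodes_cons, Multiset.mem_cons, Multiset.mem_add, Multiset.mem_coe, not_or]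
      at hb hh
    rw [List.foldl_cons, List.foldl_cons, Deco.step_erase (Ne.symm hb.1) hb.2.1 hh.2.1 hX]
    refine ih hb.2.2 hh.2.2 ?_
    rw [lower_step]
    split_ifs
    exacts [fun he => hh.2.1 (he ▸ e.tree.minLeaf_mem v), hX]

theorem deco_join_leaf {d : Side} {O : BinTree} (hlt : v (O.minLeaf v) < v h) :
    deco v (.join d O b (.leaf h)) =
      ((deco v O).1.extend d.opp b, (⟨h, b, fun _ => []⟩ : Banana) ::ₘ (deco v O).2) := by
  refine (deco_join v ⟨d, b, O⟩ (.leaf h) hlt.ne).trans ((if_pos hlt).trans ?_)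
  rw [Deco.turn, show (deco v (.leaf h)).2 = 0 from rfl, add_zero]
  rfl

theorem deco_build_erase {d : Side} {O : BinTree} {W : List Entry}
    (hnd : ((b ::ₘ h ::ₘ ((O.inorder : Multiset Node) + nodes W)).map v).Nodup)
    (hlt : v (O.minLeaf v) < v h) (β : Node) :
    eraseBananas b h ((deco v (build (.join d O b (.leaf h)) W)).close β) =
      (deco v (build O W)).close β := by
  have hjoin : ((BinTree.join d O b (.leaf h)).inorder : Multiset Node) + nodes W =
      b ::ₘ h ::ₘ ((O.inorder : Multiset Node) + nodes W) := by
    have hleaf : ((BinTree.leaf h).inorder : Multiset Node) = {h} := rfl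
    rw [inorder_join, hleaf, Multiset.cons_add, add_right_comm, add_comm _ ({h} : Multiset Node),
      Multiset.singleton_add]
  obtain ⟨⟨-, hbO, hbW⟩, ⟨hhO, hhW⟩, -⟩ := by
    simpa only [Multiset.nodup_cons, Multiset.mem_cons, Multiset.mem_add, Multiset.mem_coe, not_or]
      using Multiset.Nodup.of_map _ hnd
  have hlow : ((deco v O).1.extend d.opp b).lower ≠ h := fun he => hhO (he ▸ O.minLeaf_mem v)
  have hpair : (deco v (.join d O b (.leaf h))).erase b h = deco v O := by
    rw [deco_join_leaf hlt]
    conv_rhs => rw [← Deco.erase_deco (v := v) hbO hhO]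
    exact Prod.ext (OpenPath.erase_extend_self _ _) (by simp [Deco.erase, eraseBananas])
  have hfold := foldl_step_erase (v := v) (X := deco v (.join d O b (.leaf h))) hbW hhW
    (by rwa [deco_join_leaf hlt])
  rw [hpair] at hfold
  rw [deco_build (hjoin ▸ hnd), deco_build (nodup_map_of_le hnd
    ((Multiset.le_cons_self _ _).trans (Multiset.le_cons_self _ _))), hfold.1]
  exact eraseBananas_cons _ hfold.2

end

/-! ### The binary tree of an alternating sequence -/

/-- A sequence that continues a sequence with last minimum `a`, alternating between maxima and
minima. -/
def Zigzag (v : Node → ℝ) : Node → List Node → Prop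
  | _, [] => True
  | _, [_] => False
  | a, b :: a' :: L => v a < v b ∧ v a' < v b ∧ Zigzag v a' L

section

variable {v : Node → ℝ}

theorem lastLeaf_addRight (v : Node → ℝ) (b a : Node) (T : BinTree) :
    (T.addRight v b a).lastLeaf = a := by
  induction T with
  | leaf x => rfl
  | node l b' r _ ihr =>
    unfold BinTree.addRight
    split_ifs
    exacts [ihr, rfl]

theorem heapOrdered_addAll : ∀ {T : BinTree} {L : List Node}, T.HeapOrdered v →
    Zigzag v T.lastLeaf L → ((T.inorder ++ L).map v).Nodup →
    (T.addAll v L).HeapOrdered v ∧ (T.addAll v L).inorder = T.inorder ++ L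
  | T, [], hT, _, _ => ⟨hT, by simp [BinTree.addAll]⟩
  | T, b :: a :: L, hT, ⟨hlast, ha, hL⟩, hnd => by
    have hin := BinTree.inorder_addRight v b a T
    have hne : ∀ x ∈ T.inorder, v x ≠ v b := fun x hx he => by
      rw [List.map_append, List.nodup_append] at hnd
      exact hnd.2.2 (v x) (List.mem_map_of_mem hx) (v b) (by simp) he
    obtain ⟨hheap, hL'⟩ := heapOrdered_addAll (L := L)
      (BinTree.heapOrdered_addRight v b a T hT hlast ha hne) (by rwa [lastLeaf_addRight])
      (by simpa [hin] using hnd)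
    exact ⟨hheap, hL'.trans (by simp [hin])⟩

theorem binaryTree_spec {a : Node} {L : List Node} (hL : Zigzag v a L)
    (hnd : ((a :: L).map v).Nodup) :
    (binaryTree v (a :: L)).HeapOrdered v ∧ (binaryTree v (a :: L)).inorder = a :: L :=
  heapOrdered_addAll (T := .leaf a) trivial hL hnd

end

/-! ### The critical points of a list -/

theorem nodeValue_point (f : ℕ → ℝ) (s t i : ℕ) : nodeValue f (point s t i) = f i := by
  unfold point
  split_ifs <;> rfl

theorem isReal_point (s t i : ℕ) : (point s t i).IsReal := by
  unfold point
  split_ifs <;> trivial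

theorem point_item {s t i : ℕ} (hs : s ≤ i) (ht : i ≤ t) : point s t i = .item i :=
  if_pos ⟨hs, ht⟩

theorem point_hook {s t i : ℕ} (h : ¬ (s ≤ i ∧ i ≤ t)) : point s t i = .hook i := if_neg h

/-- `i` is a homological critical point of a map `f` on `[s-1, t+1]`. -/
abbrev IsCrit (f : ℕ → ℝ) (s t i : ℕ) : Prop := IsMinAt f s t i ∨ IsMaxAt f s t i

section

variable {f : ℕ → ℝ} {s t i : ℕ}

theorem isCrit_iff_of_mem (hs : s ≤ i) (ht : i ≤ t) (hl : f (i - 1) ≠ f i)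
    (hr : f i ≠ f (i + 1)) : IsCrit f s t i ↔ (f (i - 1) < f i ↔ f (i + 1) < f i) := by
  simp only [IsCrit, IsMinAt, IsMaxAt, hs, ht, forall_const, true_and]
  rcases hl.lt_or_gt with h | h <;> rcases hr.lt_or_gt with h' | h' <;>
    simp [h, h', h.not_gt, h'.not_gt]

theorem isCrit_left_end_iff (hs : 1 ≤ s) (hst : s ≤ t + 1) :
    IsCrit f s t (s - 1) ↔ f (s - 1) < f s := by
  have hpred : ¬ s ≤ s - 1 := by omega
  simp [IsCrit, IsMinAt, IsMaxAt, hpred, Nat.sub_add_cancel hs, show s - 1 ≤ t by omega]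

theorem isCrit_right_end_iff (hst : s ≤ t + 1) : IsCrit f s t (t + 1) ↔ f (t + 1) < f t := by
  simp [IsCrit, IsMinAt, IsMaxAt, hst]

end

/-- The homological critical points among the `n` positions from `i` on. -/
def crit (f : ℕ → ℝ) (s t i n : ℕ) : List Node :=
  ((List.range' i n).filter fun i => IsCrit f s t i).map (point s t)

theorem crit_add (f : ℕ → ℝ) (s t i n n' : ℕ) :
    crit f s t i (n + n') = crit f s t i n ++ crit f s t (i + n) n' := by
  simp only [crit, ← List.range'_append_1, List.filter_append, List.map_append]

theorem crit_succ_of_isCrit {f : ℕ → ℝ} {s t i : ℕ} (n : ℕ) (h : IsCrit f s t i) :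
    crit f s t i (n + 1) = point s t i :: crit f s t (i + 1) n := by
  simp [crit, List.range'_succ, h]

theorem crit_succ_of_not_isCrit {f : ℕ → ℝ} {s t i : ℕ} (n : ℕ) (h : ¬ IsCrit f s t i) :
    crit f s t i (n + 1) = crit f s t (i + 1) n := by
  simp [crit, List.range'_succ, h]

theorem crit_one (f : ℕ → ℝ) (s t i : ℕ) :
    crit f s t i 1 = if IsCrit f s t i then [point s t i] else [] := by
  split_ifs with h
  exacts [crit_succ_of_isCrit 0 h, crit_succ_of_not_isCrit 0 h]

theorem crit_congr {f g : ℕ → ℝ} {s t s' t' i n : ℕ}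
    (hfg : ∀ j, i - 1 ≤ j → j ≤ i + n → f j = g j)
    (hs : ∀ j, i ≤ j → j < i + n → (s ≤ j ↔ s' ≤ j))
    (ht : ∀ j, i ≤ j → j < i + n → (j ≤ t ↔ j ≤ t')) :
    crit f s t i n = crit g s' t' i n := by
  rw [crit, crit, List.filter_congr (q := fun j => decide (IsCrit g s' t' j))]
  · refine List.map_congr_left fun j hj => ?_
    rw [List.mem_filter, List.mem_range'_1] at hj
    simp only [point, hs j hj.1.1 hj.1.2, ht j hj.1.1 hj.1.2]
  · intro j hj
    rw [List.mem_range'_1] at hj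
    rw [decide_eq_decide]
    simp only [IsCrit, IsMinAt, IsMaxAt, hs j hj.1 hj.2, ht j hj.1 hj.2,
      hfg j (by omega) (by omega), hfg (j - 1) (by omega) (by omega),
      hfg (j + 1) (by omega) (by omega)]

theorem crit_eq_nil {f : ℕ → ℝ} {s t i n : ℕ}
    (h : ∀ j, i ≤ j → j < i + n → ¬ IsCrit f s t j) : crit f s t i n = [] := by
  rw [crit, List.filter_eq_nil_iff.mpr, List.map_nil]
  intro j hj
  rw [List.mem_range'_1] at hj
  simpa using h j hj.1 hj.2

theorem zigzag_crit {f : ℕ → ℝ} {s t : ℕ} (hne : ∀ i, s - 1 ≤ i → i ≤ t → f i ≠ f (i + 1))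
    (n : ℕ) : ∀ k, k + n = t + 1 → 1 ≤ k → s ≤ k →
    (f (k - 1) < f k → ∀ a, nodeValue f a ≤ f (k - 1) →
      Zigzag (nodeValue f) a (crit f s t k (n + 1))) ∧
    (f k < f (k - 1) → ∃ a L, crit f s t k (n + 1) = a :: L ∧ nodeValue f a ≤ f k ∧
      Zigzag (nodeValue f) a L) := by
  induction n with
  | zero =>
    rintro k rfl - hsk
    have hcrit := isCrit_right_end_iff (f := f) hsk
    refine ⟨fun hup a _ => ?_, fun hdown => ⟨_, _, crit_succ_of_isCrit 0 (hcrit.mpr hdown),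
      (nodeValue_point f s t _).le, trivial⟩⟩
    rw [crit_succ_of_not_isCrit 0 (mt hcrit.mp hup.not_gt)]
    trivial
  | succ n ih =>
    intro k hk h1k hsk
    obtain ⟨ihup, ihdown⟩ := ih (k + 1) (by omega) (by omega) (by omega)
    have hprev := hne (k - 1) (by omega) (by omega)
    have hnext := hne k (by omega) (by omega)
    rw [Nat.sub_add_cancel h1k] at hprev
    rw [Nat.add_sub_cancel] at ihup ihdown
    have hcrit := isCrit_iff_of_mem (t := t) hsk (by omega) hprev hnext
    rcases hnext.lt_or_gt with hup' | hdown'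
    · refine ⟨fun hup a ha => ?_, fun hdown => ?_⟩
      · rw [crit_succ_of_not_isCrit _ fun h => ((hcrit.mp h).mp hup).not_gt hup']
        exact ihup hup' a (ha.trans hup.le)
      · exact ⟨_, _, crit_succ_of_isCrit _ (hcrit.mpr (iff_of_false hdown.not_gt hup'.not_gt)),
          (nodeValue_point f s t k).le, ihup hup' _ (nodeValue_point f s t k).le⟩
    · obtain ⟨a', L, hL, ha', hzig⟩ := ihdown hdown'
      refine ⟨fun hup a ha => ?_, fun hdown => ⟨a', L, ?_, ha'.trans hdown'.le, hzig⟩⟩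
      · rw [crit_succ_of_isCrit _ (hcrit.mpr (iff_of_true hup hdown')), hL]
        exact ⟨(nodeValue_point f s t k).symm ▸ ha.trans_lt hup,
          (nodeValue_point f s t k).symm ▸ ha'.trans_lt hdown', hzig⟩
      · rw [crit_succ_of_not_isCrit _ fun h => ((hcrit.mp h).mpr hdown').not_gt hdown, hL]

theorem exists_zigzag_crit {f : ℕ → ℝ} {s t : ℕ} (hs : 1 ≤ s) (hst : s ≤ t + 1)
    (hne : ∀ i, s - 1 ≤ i → i ≤ t → f i ≠ f (i + 1)) :
    ∃ a L, crit f s t (s - 1) (t + 3 - s) = a :: L ∧ Zigzag (nodeValue f) a L := by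
  obtain ⟨n, hn⟩ : ∃ n, s + n = t + 1 := ⟨t + 1 - s, by omega⟩
  obtain ⟨hup, hdown⟩ := zigzag_crit hne n s hn hs le_rfl
  have hfirst := hne (s - 1) le_rfl (by omega)
  have hcrit := isCrit_left_end_iff (f := f) hs hst
  rw [show t + 3 - s = (n + 1) + 1 by omega]
  rw [Nat.sub_add_cancel hs] at hfirst
  rcases hfirst.lt_or_gt with h | h
  · refine ⟨_, _, crit_succ_of_isCrit _ (hcrit.mpr h), ?_⟩
    rw [Nat.sub_add_cancel hs]
    exact hup h _ (nodeValue_point f s t _).le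
  · obtain ⟨a, L, hL, -, hzig⟩ := hdown h
    refine ⟨a, L, ?_, hzig⟩
    rw [crit_succ_of_not_isCrit _ (mt hcrit.mp h.not_gt), Nat.sub_add_cancel hs, hL]

/-! ### Hooks -/

/-- Any two values of the list `c s, …, c t` differ by more than `ε`, so that the hooks lie
strictly between consecutive values. -/
structure Gapped (c : ℕ → ℝ) (s t : ℕ) (ε : ℝ) : Prop where
  one_le : 1 ≤ s
  lt : s < t
  pos : 0 < ε
  gap : ∀ i, s ≤ i → i ≤ t → ∀ j, s ≤ j → j ≤ t → i ≠ j → ε < |c i - c j|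

theorem hookedMap_item (c : ℕ → ℝ) (ε : ℝ) {s t i : ℕ} (hs : s ≤ i) (ht : i ≤ t) :
    hookedMap c s t ε i = c i := by
  rw [hookedMap, if_neg hs.not_gt, if_neg ht.not_gt]

namespace Gapped

variable {c : ℕ → ℝ} {s t : ℕ} {ε : ℝ}

theorem mono (h : Gapped c s t ε) {s' t' : ℕ} (hs : s ≤ s') (hst : s' < t') (ht : t' ≤ t) :
    Gapped c s' t' ε :=
  ⟨h.one_le.trans hs, hst, h.pos, fun i hi hi' j hj hj' =>
    h.gap i (hs.trans hi) (hi'.trans ht) j (hs.trans hj) (hj'.trans ht)⟩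

theorem ne (h : Gapped c s t ε) {i j : ℕ} (hi : s ≤ i) (hi' : i ≤ t) (hj : s ≤ j) (hj' : j ≤ t)
    (hij : i ≠ j) : c i ≠ c j := fun he => by
  have := h.gap i hi hi' j hj hj' hij
  rw [he, sub_self, abs_zero] at this
  exact this.not_gt h.pos

theorem ne_sub (h : Gapped c s t ε) {i j : ℕ} (hi : s ≤ i) (hi' : i ≤ t) (hj : s ≤ j)
    (hj' : j ≤ t) : c i ≠ c j - ε := fun he => by
  by_cases hij : i = j
  · rw [hij] at he
    linarith [h.pos]
  · have := h.gap i hi hi' j hj hj' hij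
    rw [he, sub_sub_cancel_left, abs_neg, abs_of_pos h.pos] at this
    exact this.false

theorem hook_left_of_lt (h : Gapped c s t ε) (hc : c s < c (s + 1)) :
    hookedMap c s t ε (s - 1) = c s + ε := by
  have := h.one_le
  rw [hookedMap, if_pos (by omega), sign_pos (sub_pos.mpr hc)]
  simp

theorem hook_left_of_gt (h : Gapped c s t ε) (hc : c (s + 1) < c s) :
    hookedMap c s t ε (s - 1) = c s - ε := by
  have := h.one_le
  rw [hookedMap, if_pos (by omega), sign_neg (sub_neg.mpr hc)]
  simp [sub_eq_add_neg]

theorem hook_right_of_lt (h : Gapped c s t ε) (hc : c t < c (t - 1)) :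
    hookedMap c s t ε (t + 1) = c t + ε := by
  have := h.lt
  rw [hookedMap, if_neg (by omega), if_pos (by omega), sign_pos (sub_pos.mpr hc)]
  simp

theorem hook_right_of_gt (h : Gapped c s t ε) (hc : c (t - 1) < c t) :
    hookedMap c s t ε (t + 1) = c t - ε := by
  have := h.lt
  rw [hookedMap, if_neg (by omega), if_pos (by omega), sign_neg (sub_neg.mpr hc)]
  simp [sub_eq_add_neg]

theorem ne_second (h : Gapped c s t ε) : c s ≠ c (s + 1) :=
  h.ne le_rfl h.lt.le (by omega) h.lt (by omega)

theorem ne_second_last (h : Gapped c s t ε) : c (t - 1) ≠ c t := by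
  have := h.lt
  exact h.ne (by omega) (by omega) h.lt.le le_rfl (by omega)

theorem hook_left_lt_iff (h : Gapped c s t ε) :
    hookedMap c s t ε (s - 1) < hookedMap c s t ε s ↔ c (s + 1) < c s := by
  have := h.pos
  rw [hookedMap_item c ε le_rfl h.lt.le]
  rcases h.ne_second.lt_or_gt with hc | hc
  · rw [h.hook_left_of_lt hc]
    exact iff_of_false (by linarith) hc.not_gt
  · rw [h.hook_left_of_gt hc]
    exact iff_of_true (by linarith) hc

theorem hook_right_lt_iff (h : Gapped c s t ε) :
    hookedMap c s t ε (t + 1) < hookedMap c s t ε t ↔ c (t - 1) < c t := by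
  have := h.pos
  rw [hookedMap_item c ε h.lt.le le_rfl]
  rcases h.ne_second_last.lt_or_gt with hc | hc
  · rw [h.hook_right_of_gt hc]
    exact iff_of_true (by linarith) hc
  · rw [h.hook_right_of_lt hc]
    exact iff_of_false (by linarith) hc.not_gt

theorem hookedMap_ne (h : Gapped c s t ε) : ∀ i, s - 1 ≤ i → i ≤ t →
    hookedMap c s t ε i ≠ hookedMap c s t ε (i + 1) := by
  intro i hi hi'
  have h1 := h.one_le
  have h2 := h.lt
  have h3 := h.pos
  obtain rfl | rfl | ⟨hs, ht⟩ : i = s - 1 ∨ i = t ∨ s ≤ i ∧ i + 1 ≤ t := by omega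
  · rw [Nat.sub_add_cancel h1, hookedMap_item c ε le_rfl h2.le]
    rcases h.ne_second.lt_or_gt with hc | hc
    · rw [h.hook_left_of_lt hc]; linarith
    · rw [h.hook_left_of_gt hc]; linarith
  · rw [hookedMap_item c ε h2.le le_rfl]
    rcases h.ne_second_last.lt_or_gt with hc | hc
    · rw [h.hook_right_of_gt hc]; linarith
    · rw [h.hook_right_of_lt hc]; linarith
  · rw [hookedMap_item c ε hs hi', hookedMap_item c ε (by omega) ht]
    exact h.ne hs hi' (by omega) ht (by omega)

theorem hookedMap_of_isCrit (h : Gapped c s t ε) {i : ℕ} (hi : s - 1 ≤ i) (hi' : i ≤ t + 1)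
    (hc : IsCrit (hookedMap c s t ε) s t i) :
    (s ≤ i ∧ i ≤ t ∧ hookedMap c s t ε i = c i) ∨
      ∃ x, (i = s - 1 ∧ x = s ∨ i = t + 1 ∧ x = t) ∧ hookedMap c s t ε i = c x - ε := by
  have h1 := h.one_le
  have h2 := h.lt
  obtain rfl | rfl | ⟨hs, ht⟩ : i = s - 1 ∨ i = t + 1 ∨ s ≤ i ∧ i ≤ t := by omega
  · rw [isCrit_left_end_iff h1 (by omega), h.hook_left_lt_iff] at hc
    exact .inr ⟨s, .inl ⟨rfl, rfl⟩, h.hook_left_of_gt hc⟩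
  · rw [isCrit_right_end_iff (by omega), h.hook_right_lt_iff] at hc
    exact .inr ⟨t, .inr ⟨rfl, rfl⟩, h.hook_right_of_gt hc⟩
  · exact .inl ⟨hs, ht, hookedMap_item c ε hs ht⟩

theorem nodup_values (h : Gapped c s t ε) :
    ((criticals c s t ε).map (nodeValue (hookedMap c s t ε))).Nodup := by
  have h1 := h.one_le
  have h2 := h.lt
  rw [criticals, List.map_map]
  refine List.Nodup.map_on ?_ ((List.nodup_range' (step := 1)).filter _)
  intro i hi j hj hij
  simp only [Function.comp, nodeValue_point] at hij
  simp only [List.mem_filter, List.mem_range'_1, decide_eq_true_eq] at hi hj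
  rcases h.hookedMap_of_isCrit hi.1.1 (by omega) hi.2 with ⟨hsi, hit, hi'⟩ | ⟨x, hx, hi'⟩ <;>
  rcases h.hookedMap_of_isCrit hj.1.1 (by omega) hj.2 with ⟨hsj, hjt, hj'⟩ | ⟨y, hy, hj'⟩ <;>
  rw [hi', hj'] at hij
  · by_contra hne
    exact h.ne hsi hit hsj hjt hne hij
  · exact absurd hij (h.ne_sub hsi hit (by omega) (by omega))
  · exact absurd hij.symm (h.ne_sub hsj hjt (by omega) (by omega))
  · have hxy : x = y := by
      by_contra hne
      exact h.ne (by omega) (by omega) (by omega) (by omega) hne (sub_left_injective hij)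
    omega

theorem binaryTree_spec (h : Gapped c s t ε) :
    (binaryTree (nodeValue (hookedMap c s t ε)) (criticals c s t ε)).HeapOrdered
        (nodeValue (hookedMap c s t ε)) ∧
      (binaryTree (nodeValue (hookedMap c s t ε)) (criticals c s t ε)).inorder =
        criticals c s t ε := by
  obtain ⟨a, L, hcrit, hzig⟩ :=
    exists_zigzag_crit h.one_le (h.lt.le.trans t.le_succ) h.hookedMap_ne
  have hnd := h.nodup_values
  change criticals c s t ε = a :: L at hcrit
  rw [hcrit] at hnd ⊢
  exact BananaTree.binaryTree_spec hzig hnd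

end Gapped

theorem isReal_of_mem_criticals {c : ℕ → ℝ} {s t : ℕ} {ε : ℝ} {x : Node}
    (hx : x ∈ criticals c s t ε) : x.IsReal := by
  obtain ⟨i, -, rfl⟩ := List.mem_map.mp hx
  exact isReal_point s t i

/-! ### The two parts of a list -/

namespace Gapped

variable {c : ℕ → ℝ} {s t : ℕ} {ε : ℝ}

theorem crit_first (h : Gapped c s t ε) : crit (hookedMap c s t ε) s t (s - 1) 2 =
    if c (s + 1) < c s then [.hook (s - 1), .item s] else [.item s] := by
  have h1 := h.one_le
  have h2 := h.lt
  have hl := h.hookedMap_ne (s - 1) le_rfl (by omega)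
  rw [Nat.sub_add_cancel h1] at hl
  have hitem : IsCrit (hookedMap c s t ε) s t s := by
    rw [isCrit_iff_of_mem le_rfl h2.le hl (h.hookedMap_ne s (by omega) h2.le), h.hook_left_lt_iff,
      hookedMap_item c ε le_rfl h2.le, hookedMap_item c ε (by omega) h2]
  have hhook : IsCrit (hookedMap c s t ε) s t (s - 1) ↔ c (s + 1) < c s := by
    rw [isCrit_left_end_iff h1 (by omega), h.hook_left_lt_iff]
  rw [crit_add _ _ _ _ 1 1, Nat.sub_add_cancel h1, crit_one, crit_one, if_pos hitem,
    point_item le_rfl h2.le, point_hook (by omega)]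
  simp only [hhook]
  split_ifs <;> rfl

theorem crit_last (h : Gapped c s t ε) : crit (hookedMap c s t ε) s t t 2 =
    if c (t - 1) < c t then [.item t, .hook (t + 1)] else [.item t] := by
  have h1 := h.one_le
  have h2 := h.lt
  have hl := h.hookedMap_ne (t - 1) (by omega) (by omega)
  rw [Nat.sub_add_cancel (by omega)] at hl
  have hitem : IsCrit (hookedMap c s t ε) s t t := by
    rw [isCrit_iff_of_mem h2.le le_rfl hl (h.hookedMap_ne t (by omega) le_rfl),
      h.hook_right_lt_iff, hookedMap_item c ε (by omega) (by omega),
      hookedMap_item c ε h2.le le_rfl]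
  have hhook : IsCrit (hookedMap c s t ε) s t (t + 1) ↔ c (t - 1) < c t := by
    rw [isCrit_right_end_iff (by omega), h.hook_right_lt_iff]
  rw [crit_add _ _ _ _ 1 1, crit_one, crit_one, if_pos hitem, point_item h2.le le_rfl,
    point_hook (by omega)]
  simp only [hhook]
  split_ifs <;> rfl

theorem crit_item (h : Gapped c s t ε) {i : ℕ} (hs : s < i) (ht : i < t) :
    crit (hookedMap c s t ε) s t i 1 =
      if (c (i - 1) < c i ↔ c (i + 1) < c i) then [.item i] else [] := by
  have hl := h.hookedMap_ne (i - 1) (by omega) (by omega)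
  rw [Nat.sub_add_cancel (by omega)] at hl
  have hcrit := isCrit_iff_of_mem hs.le ht.le hl (h.hookedMap_ne i (by omega) ht.le)
  rw [hookedMap_item c ε hs.le ht.le, hookedMap_item c ε (by omega) ht,
    hookedMap_item c ε (by omega) (by omega)] at hcrit
  rw [crit_one, point_item hs.le ht.le]
  simp only [hcrit]

end Gapped

section

variable {c : ℕ → ℝ} {ℓ m : ℕ} {ε : ℝ}

/-- The critical points of the map of `c 1, …, c m` that belong to one of the two parts. -/
def innerList (c : ℕ → ℝ) (ℓ m : ℕ) (ε : ℝ) : Side → List Node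
  | .left => crit (hookedMap c 1 m ε) 1 m 0 (ℓ + 1)
  | .right => crit (hookedMap c 1 m ε) 1 m (ℓ + 1) (m + 1 - ℓ)

/-- The critical points of the map of one of the two parts. -/
def partCriticals (c : ℕ → ℝ) (ℓ m : ℕ) (ε : ℝ) (d : Side) : List Node :=
  criticals c (firstItem ℓ d) (lastItem ℓ m d) ε

/-- The values of the map of one of the two parts. -/
def partValue (c : ℕ → ℝ) (ℓ m : ℕ) (ε : ℝ) (d : Side) : Node → ℝ :=
  nodeValue (hookedMap c (firstItem ℓ d) (lastItem ℓ m d) ε)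

theorem criticals_eq_inner (hm : ℓ + 2 ≤ m) :
    criticals c 1 m ε = innerList c ℓ m ε .left ++ innerList c ℓ m ε .right := by
  have h := crit_add (hookedMap c 1 m ε) 1 m 0 (ℓ + 1) (m + 1 - ℓ)
  rw [show ℓ + 1 + (m + 1 - ℓ) = m + 3 - 1 by omega, Nat.zero_add] at h
  exact h

theorem hookedMap_left {i : ℕ} (hi : i ≤ ℓ) (hm : ℓ ≤ m) :
    hookedMap c 1 ℓ ε i = hookedMap c 1 m ε i := by
  unfold hookedMap
  split_ifs <;> first | rfl | omega

theorem hookedMap_right {i : ℕ} (hi : ℓ + 1 ≤ i) :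
    hookedMap c (ℓ + 1) m ε i = hookedMap c 1 m ε i := by
  unfold hookedMap
  split_ifs <;> first | rfl | omega

theorem Gapped.part (h : Gapped c 1 m ε) (hℓ : 2 ≤ ℓ) (hm : ℓ + 2 ≤ m) (d : Side) :
    Gapped c (firstItem ℓ d) (lastItem ℓ m d) ε := by
  cases d
  · exact h.mono le_rfl (show 1 < ℓ by omega) (show ℓ ≤ m by omega)
  · exact h.mono (show 1 ≤ ℓ + 1 by omega) (show ℓ + 1 < m by omega) (show m ≤ m from le_rfl)

theorem partCriticals_left (h : Gapped c 1 m ε) (hℓ : 2 ≤ ℓ) (hm : ℓ + 2 ≤ m) :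
    partCriticals c ℓ m ε .left = crit (hookedMap c 1 m ε) 1 m 0 ℓ ++
      if c (ℓ - 1) < c ℓ then [.item ℓ, .hook (ℓ + 1)] else [.item ℓ] := by
  have hcongr : crit (hookedMap c 1 ℓ ε) 1 ℓ 0 ℓ = crit (hookedMap c 1 m ε) 1 m 0 ℓ :=
    crit_congr (fun j _ _ => hookedMap_left (by omega) (by omega)) (fun _ _ _ => Iff.rfl)
      (fun j _ _ => by omega)
  refine Eq.trans ?_ (congrArg₂ (· ++ ·) hcongr (h.part hℓ hm .left).crit_last)
  have hsplit := crit_add (hookedMap c 1 ℓ ε) 1 ℓ 0 ℓ 2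
  rwa [Nat.zero_add] at hsplit

theorem partCriticals_right (h : Gapped c 1 m ε) (hℓ : 2 ≤ ℓ) (hm : ℓ + 2 ≤ m) :
    partCriticals c ℓ m ε .right =
      (if c (ℓ + 2) < c (ℓ + 1) then [.hook ℓ, .item (ℓ + 1)] else [.item (ℓ + 1)]) ++
        crit (hookedMap c 1 m ε) 1 m (ℓ + 2) (m - ℓ) := by
  have hcongr : crit (hookedMap c (ℓ + 1) m ε) (ℓ + 1) m (ℓ + 2) (m - ℓ) =
      crit (hookedMap c 1 m ε) 1 m (ℓ + 2) (m - ℓ) :=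
    crit_congr (fun j _ _ => hookedMap_right (by omega)) (fun j _ _ => by omega)
      (fun _ _ _ => Iff.rfl)
  refine Eq.trans ?_ (congrArg₂ (· ++ ·) (h.part hℓ hm .right).crit_first hcongr)
  have hsplit := crit_add (hookedMap c (ℓ + 1) m ε) (ℓ + 1) m ℓ 2 (m - ℓ)
  rwa [show 2 + (m - ℓ) = m + 3 - (ℓ + 1) by omega] at hsplit

theorem innerList_left (h : Gapped c 1 m ε) (hℓ : 2 ≤ ℓ) (hm : ℓ + 2 ≤ m) :
    innerList c ℓ m ε .left = crit (hookedMap c 1 m ε) 1 m 0 ℓ ++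
      if (c (ℓ - 1) < c ℓ ↔ c (ℓ + 1) < c ℓ) then [.item ℓ] else [] := by
  rw [innerList, crit_add, Nat.zero_add, h.crit_item (by omega) (by omega)]

theorem innerList_right (h : Gapped c 1 m ε) (hℓ : 2 ≤ ℓ) (hm : ℓ + 2 ≤ m) :
    innerList c ℓ m ε .right =
      (if (c ℓ < c (ℓ + 1) ↔ c (ℓ + 2) < c (ℓ + 1)) then [.item (ℓ + 1)] else []) ++
        crit (hookedMap c 1 m ε) 1 m (ℓ + 2) (m - ℓ) := by
  rw [innerList, show m + 1 - ℓ = 1 + (m - ℓ) by omega, crit_add, h.crit_item (by omega) (by omega),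
    Nat.add_sub_cancel]

theorem partCriticals_lower (h : Gapped c 1 m ε) (hℓ : 2 ≤ ℓ) (hm : ℓ + 2 ≤ m) {d : Side}
    (hlt : c (endItem ℓ d) < c (endItem ℓ d.opp)) :
    partCriticals c ℓ m ε d =
      if IsDownType c ℓ d then
        attach d (innerList c ℓ m ε d) [.item (endItem ℓ d), .hook (endHook ℓ d)]
      else innerList c ℓ m ε d := by
  cases d <;> simp only [endItem, Side.opp] at hlt
  · rw [partCriticals_left h hℓ hm, innerList_left h hℓ hm]
    simp only [IsDownType, attach, endItem, endHook, iff_false, hlt.not_gt]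
    split_ifs <;> simp
  · rw [partCriticals_right h hℓ hm, innerList_right h hℓ hm]
    simp only [IsDownType, attach, endItem, endHook, false_iff, hlt.not_gt]
    split_ifs <;> simp

theorem partCriticals_higher (h : Gapped c 1 m ε) (hℓ : 2 ≤ ℓ) (hm : ℓ + 2 ≤ m) {d : Side}
    (hlt : c (endItem ℓ d.opp) < c (endItem ℓ d)) :
    partCriticals c ℓ m ε d = attach d (innerList c ℓ m ε d) [dummyLeaf c ℓ d] := by
  cases d <;> simp only [endItem, Side.opp] at hlt
  · rw [partCriticals_left h hℓ hm, innerList_left h hℓ hm]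
    simp only [IsDownType, attach, endItem, endHook, dummyLeaf, iff_true, hlt]
    split_ifs with hd <;> simp [hd]
  · rw [partCriticals_right h hℓ hm, innerList_right h hℓ hm]
    simp only [IsDownType, attach, endItem, endHook, dummyLeaf, true_iff, hlt]
    split_ifs with hd <;> simp [hd]

theorem partValue_inner (hm : ℓ + 2 ≤ m) (d : Side) :
    ∀ x ∈ innerList c ℓ m ε d, partValue c ℓ m ε d x = nodeValue (hookedMap c 1 m ε) x := by
  intro x hx
  cases d <;>
  · obtain ⟨i, hi, rfl⟩ := List.mem_map.mp hx
    have hi := (List.mem_filter.mp hi).1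
    rw [List.mem_range'_1] at hi
    simp only [partValue, nodeValue_point, firstItem, lastItem]
    first | exact hookedMap_left (by omega) (by omega) | exact hookedMap_right (by omega)

theorem lowerPart_lt (h : Gapped c 1 m ε) (hℓ : 2 ≤ ℓ) (hm : ℓ + 2 ≤ m) :
    c (endItem ℓ (lowerPart c ℓ)) < c (endItem ℓ (lowerPart c ℓ).opp) := by
  have hne := h.ne (i := ℓ) (j := ℓ + 1) (by omega) (by omega) (by omega) (by omega) (by omega)
  unfold lowerPart
  split_ifs with hlt
  · exact hlt
  · exact (not_lt.mp hlt).lt_of_ne hne.symm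

theorem partValue_endHook (h : Gapped c 1 m ε) (hℓ : 2 ≤ ℓ) (hm : ℓ + 2 ≤ m) {d : Side}
    (hd : IsDownType c ℓ d) :
    partValue c ℓ m ε d (.hook (endHook ℓ d)) = c (endItem ℓ d) - ε := by
  cases d
  · exact (h.part hℓ hm .left).hook_right_of_gt hd
  · exact (h.part hℓ hm .right).hook_left_of_gt hd

theorem partValue_dummyLeaf_gt (h : Gapped c 1 m ε) (hℓ : 2 ≤ ℓ) (hm : ℓ + 2 ≤ m) {d : Side}
    (hlt : c (endItem ℓ d.opp) < c (endItem ℓ d)) :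
    c (endItem ℓ d.opp) < partValue c ℓ m ε d (dummyLeaf c ℓ d) := by
  unfold dummyLeaf
  split_ifs with hd
  · have hgap : ε < c (endItem ℓ d) - c (endItem ℓ d.opp) := by
      rw [← abs_of_pos (sub_pos.mpr hlt)]
      cases d <;> simp only [endItem, Side.opp] <;>
        exact h.gap _ (by omega) (by omega) _ (by omega) (by omega) (by omega)
    rw [partValue_endHook h hℓ hm hd]
    linarith
  · rw [partValue, nodeValue, hookedMap_item]
    · exact hlt
    · cases d <;> simp only [firstItem, endItem] <;> omega
    · cases d <;> simp only [lastItem, endItem] <;> omega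

end

/-! ### The minimum closest to the connection -/

theorem exists_valley_left {f : ℕ → ℝ} {s b : ℕ} (hsb : s ≤ b)
    (hne : ∀ i, s ≤ i → i ≤ b → f i ≠ f (i - 1)) (hs : f s < f (s + 1) → f s < f (s - 1))
    (hb : f b < f (b + 1)) :
    ∃ j, s ≤ j ∧ j ≤ b ∧ f j < f (j - 1) ∧ (∀ i, j ≤ i → i ≤ b → f i < f (i + 1)) ∧
      f j ≤ f b := by
  induction b, hsb using Nat.le_induction with
  | base =>
    refine ⟨s, le_rfl, le_rfl, hs hb, fun i hi hi' => ?_, le_rfl⟩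
    rwa [Nat.le_antisymm hi' hi]
  | succ b hsb ih =>
    rcases (hne (b + 1) (by omega) le_rfl).lt_or_gt with hlt | hgt
    · refine ⟨b + 1, by omega, le_rfl, hlt, fun i hi hi' => ?_, le_rfl⟩
      rwa [Nat.le_antisymm hi' hi]
    · obtain ⟨j, hsj, hjb, hprev, hup, hle⟩ := ih (fun i hi hi' => hne i hi (by omega)) hgt
      refine ⟨j, hsj, by omega, hprev, fun i hi hi' => ?_, hle.trans hgt.le⟩
      obtain rfl | hi' : i = b + 1 ∨ i ≤ b := by omega
      exacts [hb, hup i hi hi']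

theorem exists_valley_right {f : ℕ → ℝ} {b t : ℕ} (hbt : b ≤ t)
    (hne : ∀ i, b ≤ i → i ≤ t → f i ≠ f (i + 1)) (ht : f t < f (t - 1) → f t < f (t + 1))
    (hb : f b < f (b - 1)) :
    ∃ j, b ≤ j ∧ j ≤ t ∧ f j < f (j + 1) ∧ (∀ i, b ≤ i → i ≤ j → f i < f (i - 1)) ∧
      f j ≤ f b := by
  induction hbt using Nat.decreasingInduction with
  | self =>
    refine ⟨t, le_rfl, le_rfl, ht hb, fun i hi hi' => ?_, le_rfl⟩
    rwa [Nat.le_antisymm hi' hi]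
  | of_succ b hbt ih =>
    rcases (hne b le_rfl (by omega)).lt_or_gt with hlt | hgt
    · refine ⟨b, le_rfl, by omega, hlt, fun i hi hi' => ?_, le_rfl⟩
      rwa [Nat.le_antisymm hi' hi]
    · obtain ⟨j, hbj, hjt, hnext, hdown, hle⟩ := ih (fun i hi hi' => hne i (by omega) hi') hgt
      refine ⟨j, by omega, hjt, hnext, fun i hi hi' => ?_, hle.trans hgt.le⟩
      obtain rfl | hi : i = b ∨ b + 1 ≤ i := by omega
      exacts [hb, hdown i hi hi']

theorem range'_eq_append_cons {x n j : ℕ} (hx : x ≤ j) (hj : j < x + n) :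
    List.range' x n = List.range' x (j - x) ++ j :: List.range' (j + 1) (x + n - (j + 1)) := by
  obtain ⟨a, rfl⟩ := Nat.exists_eq_add_of_le hx
  rw [← List.range'_succ, Nat.add_sub_cancel_left, List.range'_append_1]
  congr 1
  omega

theorem getLast?_filter_range' {p : ℕ → Prop} [DecidablePred p] {x n j : ℕ} (hx : x ≤ j)
    (hj : j < x + n) (hp : p j) (hnp : ∀ i, j < i → i < x + n → ¬ p i) :
    ((List.range' x n).filter p).getLast? = some j := by
  have hnil : (List.range' (j + 1) (x + n - (j + 1))).filter p = [] := by
    simp only [List.filter_eq_nil_iff, List.mem_range'_1, decide_eq_true_eq]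
    exact fun i hi => hnp i (by omega) (by omega)
  rw [range'_eq_append_cons hx hj, List.filter_append, List.filter_cons_of_pos (by simpa), hnil]
  simp

theorem head?_filter_range' {p : ℕ → Prop} [DecidablePred p] {x n j : ℕ} (hx : x ≤ j)
    (hj : j < x + n) (hp : p j) (hnp : ∀ i, x ≤ i → i < j → ¬ p i) :
    ((List.range' x n).filter p).head? = some j := by
  have hnil : (List.range' x (j - x)).filter p = [] := by
    simp only [List.filter_eq_nil_iff, List.mem_range'_1, decide_eq_true_eq]
    exact fun i hi => hnp i hi.1 (by omega)
  rw [range'_eq_append_cons hx hj, List.filter_append, List.filter_cons_of_pos (by simpa), hnil]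
  simp

section

variable {c : ℕ → ℝ} {ℓ m : ℕ} {ε : ℝ}

theorem isMinAt_left_iff (h : Gapped c 1 m ε) (hm : ℓ + 2 ≤ m) (hlt : c ℓ < c (ℓ + 1)) {i : ℕ}
    (hi : 1 < ℓ) (hiℓ : i ≤ ℓ) :
    IsMinAt (hookedMap c 1 ℓ ε) 1 ℓ i ↔ IsMinAt (hookedMap c 1 m ε) 1 m i := by
  have hg : Gapped c 1 ℓ ε := h.mono le_rfl hi (by omega)
  have hpart {j : ℕ} (hj : j ≤ ℓ) : hookedMap c 1 ℓ ε j = hookedMap c 1 m ε j :=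
    hookedMap_left hj (by omega)
  obtain rfl | hiℓ' := hiℓ.eq_or_lt
  · have hnext : c i < hookedMap c 1 i ε (i + 1) ↔ c i < c (i - 1) := by
      rw [← hookedMap_item c ε hi.le le_rfl, ← not_iff_not, not_lt, not_lt,
        (hg.hookedMap_ne i (by omega) le_rfl).symm.le_iff_lt, hookedMap_item c ε hi.le le_rfl,
        hg.ne_second_last.le_iff_lt]
      simpa only [hookedMap_item c ε hi.le le_rfl] using hg.hook_right_lt_iff
    simp only [IsMinAt, hnext, hookedMap_item c ε hi.le le_rfl,
      hookedMap_item c ε (show 1 ≤ i - 1 by omega) (show i - 1 ≤ i by omega),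
      hookedMap_item c ε hi.le (show i ≤ m by omega),
      hookedMap_item c ε (show 1 ≤ i - 1 by omega) (show i - 1 ≤ m by omega),
      hookedMap_item c ε (show 1 ≤ i + 1 by omega) (show i + 1 ≤ m by omega), hlt, and_self,
      implies_true, and_true, hi.le, le_refl, forall_const]
  · simp only [IsMinAt, hiℓ, show i ≤ m by omega, forall_const, hpart hiℓ, hpart hiℓ',
      hpart (show i - 1 ≤ ℓ by omega)]

theorem isMinAt_right_iff (h : Gapped c 1 m ε) (hm : ℓ + 2 ≤ m) (hlt : c (ℓ + 1) < c ℓ) {i : ℕ}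
    (hℓ : 1 ≤ ℓ) (hi : ℓ + 1 ≤ i) (him : i ≤ m) :
    IsMinAt (hookedMap c (ℓ + 1) m ε) (ℓ + 1) m i ↔ IsMinAt (hookedMap c 1 m ε) 1 m i := by
  have hg : Gapped c (ℓ + 1) m ε := h.mono (by omega) (by omega) le_rfl
  have hpart {j : ℕ} (hj : ℓ + 1 ≤ j) : hookedMap c (ℓ + 1) m ε j = hookedMap c 1 m ε j :=
    hookedMap_right hj
  obtain rfl | hi' := hi.eq_or_lt
  · have hprev : c (ℓ + 1) < hookedMap c (ℓ + 1) m ε ℓ ↔ c (ℓ + 1) < c (ℓ + 1 + 1) := by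
      rw [← hookedMap_item c ε le_rfl him, ← not_iff_not, not_lt, not_lt,
        (hg.hookedMap_ne ℓ (by omega) (by omega)).le_iff_lt, hookedMap_item c ε le_rfl him,
        hg.ne_second.symm.le_iff_lt]
      simpa only [Nat.add_sub_cancel, hookedMap_item c ε le_rfl him] using hg.hook_left_lt_iff
    simp only [IsMinAt, Nat.add_sub_cancel, hprev, hookedMap_item c ε le_rfl him,
      hookedMap_item c ε (show ℓ + 1 ≤ ℓ + 1 + 1 by omega) (show ℓ + 1 + 1 ≤ m by omega),
      hookedMap_item c ε (show 1 ≤ ℓ + 1 by omega) him,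
      hookedMap_item c ε hℓ (show ℓ ≤ m by omega),
      hookedMap_item c ε (show 1 ≤ ℓ + 1 + 1 by omega) (show ℓ + 1 + 1 ≤ m by omega), hlt,
      implies_true, true_and, him, le_refl, forall_const, and_self]
  · simp only [IsMinAt, hi, show 1 ≤ i by omega, forall_const, hpart hi,
      hpart (show ℓ + 1 ≤ i + 1 by omega), hpart (show ℓ + 1 ≤ i - 1 by omega)]

theorem exists_last_min_left (h : Gapped c 1 m ε) (hℓ : 1 ≤ ℓ) (hm : ℓ < m)
    (hlt : c ℓ < c (ℓ + 1)) : ∃ j, 1 ≤ j ∧ j ≤ ℓ ∧ IsMinAt (hookedMap c 1 m ε) 1 m j ∧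
      (∀ i, j < i → i ≤ ℓ → ¬ IsCrit (hookedMap c 1 m ε) 1 m i) ∧ c j ≤ c ℓ := by
  have hf {i : ℕ} (hi : 1 ≤ i) (hi' : i ≤ m) : hookedMap c 1 m ε i = c i :=
    hookedMap_item c ε hi hi'
  have hne {i : ℕ} (hi : 1 ≤ i) (hi' : i ≤ m) :
      hookedMap c 1 m ε i ≠ hookedMap c 1 m ε (i - 1) := by
    have := h.hookedMap_ne (i - 1) (by omega) (by omega)
    rw [Nat.sub_add_cancel hi] at this
    exact this.symm
  obtain ⟨j, hj, hjℓ, hprev, hup, hle⟩ := exists_valley_left hℓ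
    (fun _ hi _ => hne hi (by omega))
    (fun hs => by
      rw [hf le_rfl (by omega), hf (by omega) (by omega)] at hs
      exact (not_lt.mp (mt h.hook_left_lt_iff.mp hs.not_gt)).lt_of_ne (hne le_rfl (by omega)))
    (by rwa [hf hℓ (by omega), hf (by omega) (by omega)])
  rw [hf hj (by omega), hf hℓ (by omega)] at hle
  refine ⟨j, hj, hjℓ, ⟨fun _ => hprev, fun _ => hup j le_rfl hjℓ⟩, fun i hi hi' => ?_, hle⟩
  have hbefore := hup (i - 1) (by omega) (by omega)
  rw [Nat.sub_add_cancel (by omega)] at hbefore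
  rw [isCrit_iff_of_mem (by omega) (by omega) hbefore.ne (hup i hi.le hi').ne]
  exact fun hiff => (hup i hi.le hi').not_gt (hiff.mp hbefore)

theorem exists_first_min_right (h : Gapped c 1 m ε) (hℓ : 1 ≤ ℓ) (hm : ℓ < m)
    (hlt : c (ℓ + 1) < c ℓ) : ∃ j, ℓ + 1 ≤ j ∧ j ≤ m ∧ IsMinAt (hookedMap c 1 m ε) 1 m j ∧
      (∀ i, ℓ + 1 ≤ i → i < j → ¬ IsCrit (hookedMap c 1 m ε) 1 m i) ∧ c j ≤ c (ℓ + 1) := by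
  have hf {i : ℕ} (hi : 1 ≤ i) (hi' : i ≤ m) : hookedMap c 1 m ε i = c i :=
    hookedMap_item c ε hi hi'
  obtain ⟨j, hj, hjm, hnext, hdown, hle⟩ := exists_valley_right (show ℓ + 1 ≤ m from hm)
    (fun i _ hi' => h.hookedMap_ne i (by omega) hi')
    (fun hs => by
      rw [hf (by omega) le_rfl, hf (by omega) (by omega)] at hs
      exact (not_lt.mp (mt h.hook_right_lt_iff.mp hs.not_gt)).lt_of_ne
        (h.hookedMap_ne m (by omega) le_rfl))
    (by rwa [hf (by omega) hm, hf (by omega) (by omega)])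
  rw [hf (by omega) hjm, hf (by omega) hm] at hle
  refine ⟨j, hj, hjm, ⟨fun _ => hdown j hj le_rfl, fun _ => hnext⟩, fun i hi hi' => ?_, hle⟩
  have hafter := hdown (i + 1) (by omega) hi'
  rw [Nat.add_sub_cancel] at hafter
  rw [isCrit_iff_of_mem (by omega) (by omega) (hdown i hi hi'.le).ne' hafter.ne']
  exact fun hiff => (hdown i hi hi'.le).not_gt (hiff.mpr hafter)

theorem exists_closestMin (h : Gapped c 1 m ε) (hℓ : 2 ≤ ℓ) (hm : ℓ + 2 ≤ m) {d : Side}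
    (hlt : c (endItem ℓ d) < c (endItem ℓ d.opp)) :
    ∃ j X, closestMin c ℓ m ε d = some j ∧ innerList c ℓ m ε d = attach d X [.item j] ∧
      c j ≤ c (endItem ℓ d) ∧ firstItem ℓ d ≤ j ∧ j ≤ lastItem ℓ m d ∧
      IsMinAt (hookedMap c 1 m ε) 1 m j := by
  cases d <;> dsimp only [endItem, firstItem, lastItem, attach, Side.opp] at hlt ⊢
  · obtain ⟨j, hj, hjℓ, hmin, hnc, hle⟩ := exists_last_min_left h (by omega) (by omega) hlt
    refine ⟨j, crit (hookedMap c 1 m ε) 1 m 0 j, ?_, ?_, hle, hj, hjℓ, hmin⟩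
    · refine getLast?_filter_range' hj (show j < 1 + (ℓ + 1 - 1) by omega)
        ((isMinAt_left_iff h hm hlt hℓ hjℓ).mpr hmin) fun i hi hi' hmin' => ?_
      have hiℓ : i ≤ ℓ := by change i < 1 + (ℓ + 1 - 1) at hi'; omega
      exact hnc i hi hiℓ (.inl ((isMinAt_left_iff h hm hlt hℓ hiℓ).mp hmin'))
    · rw [innerList, show ℓ + 1 = j + (1 + (ℓ - j)) by omega, crit_add, crit_add, crit_one,
        if_pos (.inl (by rwa [Nat.zero_add])), Nat.zero_add, point_item hj (by omega),
        crit_eq_nil fun i hi hi' => hnc i hi (by omega), List.append_nil]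
  · obtain ⟨j, hj, hjm, hmin, hnc, hle⟩ := exists_first_min_right h (by omega) (by omega) hlt
    refine ⟨j, crit (hookedMap c 1 m ε) 1 m (j + 1) (m + 1 - j), ?_, ?_, hle, hj, hjm, hmin⟩
    · refine head?_filter_range' hj (show j < ℓ + 1 + (m + 1 - (ℓ + 1)) by omega)
        ((isMinAt_right_iff h hm hlt (by omega) hj hjm).mpr hmin) fun i hi hi' hmin' => ?_
      exact hnc i hi hi'
        (.inl ((isMinAt_right_iff h hm hlt (by omega) hi (by omega)).mp hmin'))
    · rw [innerList, show m + 1 - ℓ = (j - (ℓ + 1)) + (1 + (m + 1 - j)) by omega, crit_add,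
        crit_add, Nat.add_sub_cancel' hj, crit_one, if_pos (.inl hmin),
        point_item (by omega) hjm, crit_eq_nil fun i hi hi' => hnc i hi (by omega),
        List.nil_append]
      rfl

theorem ne_endItem_of_isMinAt (hℓ : 2 ≤ ℓ) (hm : ℓ + 2 ≤ m) {d : Side} {j : ℕ}
    (hd : IsDownType c ℓ d) (hmin : IsMinAt (hookedMap c 1 m ε) 1 m j) : j ≠ endItem ℓ d := by
  rintro rfl
  cases d <;> dsimp only [IsDownType, endItem] at hd hmin
  · have := hmin.1 (by omega)
    rw [hookedMap_item c ε (by omega) (by omega), hookedMap_item c ε (by omega) (by omega)] at this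
    exact this.not_gt hd
  · have := hmin.2 (by omega)
    rw [hookedMap_item c ε (by omega) (by omega), hookedMap_item c ε (by omega) hm] at this
    exact this.not_gt hd

end

theorem BinTree.HeapOrdered.exists_build_join_eq {v : Node → ℝ} {T : BinTree}
    (hT : T.HeapOrdered v) {d : Side} {I : List Node} {b h : Node}
    (hI : T.inorder = attach d I [b, h]) :
    ∃ O W, build (.join d O b (.leaf h)) W = T ∧ (∀ e ∈ W, e.side = d) ∧
      (build O W).HeapOrdered v ∧ (build O W).inorder = I := by
  obtain ⟨k, W, rfl, hside⟩ := exists_build_eq d T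
  rw [inorder_build_of_side hside, attach_pair] at hI
  obtain ⟨houter, hk⟩ := attach_inj hI rfl
  obtain rfl : k = h := by simpa using hk
  cases W with
  | nil =>
    have := congrArg List.length houter
    cases d <;> simp [outer, attach] at this
  | cons e W =>
    have hW : ∀ e' ∈ W, e'.side = d := fun e' he' => hside e' (List.mem_cons_of_mem _ he')
    have hin : (build (.leaf k) (e :: W)).inorder =
        attach d (build e.tree W).inorder [e.node, k] := by
      rw [← inorder_build_join hW, ← hside e List.mem_cons_self]; rfl
    rw [inorder_build_of_side hside, houter, ← attach_pair] at hin
    obtain ⟨rfl, hb⟩ := attach_inj hin rfl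
    obtain rfl : e.node = b := by simpa using hb.symm
    obtain ⟨-, hheap, hrising⟩ := heapOrdered_build.mp hT
    obtain ⟨he, hrising⟩ := List.pairwise_cons.mp hrising
    obtain ⟨htop, htree, -⟩ := hheap e List.mem_cons_self
    refine ⟨e.tree, W, by rw [← hside e List.mem_cons_self]; rfl, hW,
      heapOrdered_build.mpr ⟨htree, fun e' he' => ?_, hrising⟩, rfl⟩
    obtain ⟨htop', htree', -⟩ := hheap e' (List.mem_cons_of_mem _ he')
    exact ⟨htop', htree', htop.trans (he e' he')⟩

theorem BinTree.HeapOrdered.exists_eraseBananas_eq {v : Node → ℝ} {T : BinTree}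
    (hT : T.HeapOrdered v) (hnd : (T.inorder.map v).Nodup) {d : Side} {X : List Node}
    {k b h : Node} (hin : T.inorder = attach d (attach d X [k]) [b, h]) (hlt : v k < v h)
    (β : Node) :
    ∃ T' : BinTree, T'.HeapOrdered v ∧ T'.inorder = attach d X [k] ∧
      eraseBananas b h ((deco v T).close β) = (deco v T').close β := by
  obtain ⟨O, W, rfl, hside, hheap, hX⟩ := hT.exists_build_join_eq hin
  refine ⟨build O W, hheap, hX, deco_build_erase ?_ ?_ β⟩
  · have hnodes : (attach d (build O W).inorder [b, h] : Multiset Node) =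
        b ::ₘ h ::ₘ (build O W).inorder := by
      rw [coe_attach, add_comm]; rfl
    rw [← inorder_build, ← hnodes, ← inorder_build_join hside]
    exact hnd
  · refine ((heapOrdered_build.mp hheap).1.minLeaf_le k ?_).trans_lt hlt
    exact mem_of_inorder_build_eq_attach hside hX

theorem heapOrdered_build_leaf_congr {v v' : Node → ℝ} {W : List Entry} {x k : Node}
    (hW : (build (.leaf x) W).HeapOrdered v') (hv : ∀ y ∈ nodes W, v' y = v y)
    (hk : v k ≤ v' x) : (build (.leaf k) W).HeapOrdered v := by
  rw [heapOrdered_build] at hW ⊢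
  obtain ⟨-, hheap, hrising⟩ := hW
  have hnode : ∀ e ∈ W, v' e.node = v e.node := fun e he => hv _ (e.node_mem_nodes he)
  have htree : ∀ e ∈ W, ∀ y ∈ e.tree.inorder, v' y = v y := fun e he y hy =>
    hv y (mem_nodes.mpr ⟨e, he, .inr hy⟩)
  refine ⟨trivial, fun e he => ?_, hrising.imp_of_mem fun ha hb hab => ?_⟩
  · obtain ⟨htop, hT, hx⟩ := hheap e he
    rw [hnode e he, htree e he _ e.tree.top_mem_inorder] at htop
    rw [hnode e he] at hx
    exact ⟨htop, hT.congr (htree e he), hk.trans_lt hx⟩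
  · rwa [hnode _ ha, hnode _ hb] at hab

theorem minLeaf_ne_of_nodup_build {v : Node → ℝ} {k : Node} {W : List Entry}
    (hnd : ((build (.leaf k) W).inorder.map v).Nodup) : ∀ e ∈ W, v (e.minLeaf v) ≠ v k := by
  rw [← Multiset.coe_nodup, ← Multiset.map_coe, inorder_build] at hnd
  exact fun e he =>
    (ne_of_nodup_map_add hnd (List.mem_singleton_self k) (e.minLeaf_mem_nodes v he)).symm

theorem close_deco_build_leaf {v : Node → ℝ} {k : Node} {W : List Entry} {s : Side}
    (hnd : ((build (.leaf k) W).inorder.map v).Nodup) (hside : ∀ e ∈ W, e.side = s) :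
    (deco v (build (.leaf k) W)).close (.root s) =
      (deco v (.leaf k)).1.endOn s (near v k W) (far v k W) ::ₘ
        (hang v (near v k W) + rest v s (far v k W)) := by
  have hne := minLeaf_ne_of_nodup_build hnd
  rw [← Multiset.coe_nodup, ← Multiset.map_coe, inorder_build] at hnd
  rw [deco_build hnd, foldl_step_close s _ hne, OpenPath.addAll_close_top,
    show (deco v (.leaf k)).2 = 0 from rfl, zero_add]
  · rfl
  · exact fun e he => hside e ((List.takeWhile_sublist _).mem he)

/-- The banana tree `M` of the part on side `d`, pre-processed for gluing at the leaf `k`: the path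
`p` passes the entries of `P` and ends at the first entry of `T`. -/
structure Prepared (v : Node → ℝ) (k : Node) (d : Side) (p : OpenPath) (P T : List Entry)
    (M : Multiset Banana) : Prop where
  side : ∀ e ∈ P ++ T, e.side = d
  heap : (build (.leaf k) (P ++ T)).HeapOrdered v
  passed : ∀ e ∈ P, v k < v (e.minLeaf v)
  bananas : M = p.endOn d P T ::ₘ (hang v P + rest v d T)

theorem exists_prepared_modify {v v' : Node → ℝ} {x k : Node} {W : List Entry} {d : Side}
    {S : List Banana} (hside : ∀ e ∈ W, e.side = d) (hheap : (build (.leaf x) W).HeapOrdered v')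
    (hnd : ((build (.leaf x) W).inorder.map v').Nodup)
    (hS : (S : Multiset Banana) = (deco v' (build (.leaf x) W)).close (.root d))
    (hv : ∀ y ∈ nodes W, v' y = v y) (hk : v k < v' x) :
    ∃ P T, P ++ T = W ∧
      Prepared v k d dummyPath P T (modify S x fun B => { B with lower := .dummy }) := by
  have hsplit := near_append_far v' x W
  have htree : ∀ e ∈ W, ∀ y ∈ e.tree.inorder, v' y = v y := fun e he y hy =>
    hv y (mem_nodes.mpr ⟨e, he, .inr hy⟩)
  have hnear : ∀ e ∈ near v' x W, e ∈ W := fun e he => hsplit ▸ List.mem_append_left _ he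
  have hfar : ∀ e ∈ far v' x W, e ∈ W := fun e he => hsplit ▸ List.mem_append_right _ he
  refine ⟨near v' x W, far v' x W, hsplit, hsplit.symm ▸ hside,
    hsplit.symm ▸ heapOrdered_build_leaf_congr hheap hv hk.le, fun e he => ?_, ?_⟩
  · exact (hk.trans (lt_of_mem_near he)).trans_eq (BinTree.minLeaf_congr (htree e (hnear e he)))
  · have hfeet : (feet (S : Multiset Banana)).Nodup := by
      rw [hS, Deco.close, feet_cons, OpenPath.foot_close, feet_deco]
      exact hnd.of_map
    rw [close_deco_build_leaf hnd hside] at hS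
    rw [hS] at hfeet
    refine (modify_cons (a := x) hS rfl (lower_ne_of_feet_nodup hfeet) _).trans ?_
    rw [hang_congr fun e he => htree e (hnear e he), rest_congr d fun e he => htree e (hfar e he)]
    rfl

theorem exists_prepared_deco {v : Node → ℝ} {k : Node} {W : List Entry} {d : Side}
    (hside : ∀ e ∈ W, e.side = d) (hheap : (build (.leaf k) W).HeapOrdered v)
    (hnd : ((build (.leaf k) W).inorder.map v).Nodup) :
    ∃ P T, P ++ T = W ∧ EndsCore v k [] T ∧
      Prepared v k d (deco v (.leaf k)).1 P T ((deco v (build (.leaf k) W)).close (.root d)) := by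
  have hsplit := near_append_far v k W
  exact ⟨near v k W, far v k W, hsplit,
    fun e he => lt_of_mem_head_far (minLeaf_ne_of_nodup_build hnd) he, hsplit.symm ▸ hside,
    hsplit.symm ▸ hheap, fun e he => lt_of_mem_near he, close_deco_build_leaf hnd hside⟩

section

variable {c : ℕ → ℝ} {ℓ m : ℕ} {ε : ℝ} {d : Side} {S : List Banana}

theorem exists_partTree (h : Gapped c 1 m ε) (hℓ : 2 ≤ ℓ) (hm : ℓ + 2 ≤ m)
    (hS : S.Perm (upTree c (firstItem ℓ d) (lastItem ℓ m d) ε (.root d))) :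
    ∃ T : BinTree, T.HeapOrdered (partValue c ℓ m ε d) ∧ T.inorder = partCriticals c ℓ m ε d ∧
      (T.inorder.map (partValue c ℓ m ε d)).Nodup ∧
      (S : Multiset Banana) = (deco (partValue c ℓ m ε d) T).close (.root d) := by
  obtain ⟨hheap, hin⟩ := (h.part hℓ hm d).binaryTree_spec
  exact ⟨_, hheap, hin, hin.symm ▸ (h.part hℓ hm d).nodup_values,
    (Multiset.coe_eq_coe.mpr hS).trans rfl⟩

theorem coe_prepareLower_of_isDownType (hd : IsDownType c ℓ d) :
    (prepareLower c ℓ d S : Multiset Banana) =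
      eraseBananas (.item (endItem ℓ d)) (.hook (endHook ℓ d)) S := by
  rw [prepareLower, if_pos hd, eraseBananas, Multiset.filter_coe, Multiset.map_coe]
  rfl

theorem nodup_innerList_values (h : Gapped c 1 m ε) (hm : ℓ + 2 ≤ m) (d : Side) :
    ((innerList c ℓ m ε d).map (nodeValue (hookedMap c 1 m ε))).Nodup := by
  have hnd := h.nodup_values
  rw [criticals_eq_inner hm, List.map_append, List.nodup_append] at hnd
  cases d
  exacts [hnd.1, hnd.2.1]

theorem partValue_item {j : ℕ} (hj : firstItem ℓ d ≤ j) (hj' : j ≤ lastItem ℓ m d) :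
    partValue c ℓ m ε d (.item j) = c j :=
  hookedMap_item c ε hj hj'

theorem firstItem_le_endItem (hℓ : 2 ≤ ℓ) (d : Side) : firstItem ℓ d ≤ endItem ℓ d := by
  cases d <;> simp only [firstItem, endItem] <;> omega

theorem endItem_le_lastItem (hm : ℓ + 2 ≤ m) (d : Side) : endItem ℓ d ≤ lastItem ℓ m d := by
  cases d <;> simp only [lastItem, endItem] <;> omega

theorem partValue_lt_endHook (h : Gapped c 1 m ε) (hℓ : 2 ≤ ℓ) (hm : ℓ + 2 ≤ m) {j : ℕ}
    (hd : IsDownType c ℓ d) (hle : c j ≤ c (endItem ℓ d)) (hne : j ≠ endItem ℓ d)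
    (hj : firstItem ℓ d ≤ j) (hj' : j ≤ lastItem ℓ m d) :
    partValue c ℓ m ε d (.item j) < partValue c ℓ m ε d (.hook (endHook ℓ d)) := by
  have hgap := (h.part hℓ hm d).gap j hj hj' (endItem ℓ d) (firstItem_le_endItem hℓ d)
    (endItem_le_lastItem hm d) hne
  rw [abs_sub_comm, abs_of_nonneg (sub_nonneg.mpr hle)] at hgap
  rw [partValue_endHook h hℓ hm hd, partValue_item hj hj']
  linarith

theorem exists_lowerTree (h : Gapped c 1 m ε) (hℓ : 2 ≤ ℓ) (hm : ℓ + 2 ≤ m)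
    (hlt : c (endItem ℓ d) < c (endItem ℓ d.opp))
    (hS : S.Perm (upTree c (firstItem ℓ d) (lastItem ℓ m d) ε (.root d))) :
    ∃ T : BinTree, T.HeapOrdered (nodeValue (hookedMap c 1 m ε)) ∧
      T.inorder = innerList c ℓ m ε d ∧ (prepareLower c ℓ d S : Multiset Banana) =
        (deco (nodeValue (hookedMap c 1 m ε)) T).close (.root d) := by
  obtain ⟨T, hheap, hin, hnd, hbananas⟩ := exists_partTree h hℓ hm hS
  obtain ⟨j, X, -, hX, hle, hj, hj', hmin⟩ := exists_closestMin h hℓ hm hlt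
  rw [partCriticals_lower h hℓ hm hlt] at hin
  have hvalue {T : BinTree} (hT : T.inorder = innerList c ℓ m ε d) : ∀ x ∈ T.inorder,
      partValue c ℓ m ε d x = nodeValue (hookedMap c 1 m ε) x := hT ▸ partValue_inner hm d
  by_cases hd : IsDownType c ℓ d
  · rw [if_pos hd, hX] at hin
    obtain ⟨T', hheap', hin', herase⟩ := hheap.exists_eraseBananas_eq hnd hin
      (partValue_lt_endHook h hℓ hm hd hle (ne_endItem_of_isMinAt hℓ hm hd hmin) hj hj')
      (.root d)
    rw [← hX] at hin'
    refine ⟨T', hheap'.congr (hvalue hin'), hin', ?_⟩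
    rw [coe_prepareLower_of_isDownType hd, hbananas, herase, deco_congr (hvalue hin')]
  · rw [if_neg hd] at hin
    exact ⟨T, hheap.congr (hvalue hin), hin,
      by rw [prepareLower, if_neg hd, hbananas, deco_congr (hvalue hin)]⟩

theorem exists_prepared_lower (h : Gapped c 1 m ε) (hℓ : 2 ≤ ℓ) (hm : ℓ + 2 ≤ m)
    (hlt : c (endItem ℓ d) < c (endItem ℓ d.opp))
    (hS : S.Perm (upTree c (firstItem ℓ d) (lastItem ℓ m d) ε (.root d))) :
    ∃ (j : ℕ) (P T : List Entry), closestMin c ℓ m ε d = some j ∧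
      nodeValue (hookedMap c 1 m ε) (.item j) ≤ c (endItem ℓ d) ∧
      attach d (outer d (P ++ T)) [.item j] = innerList c ℓ m ε d ∧
      EndsCore (nodeValue (hookedMap c 1 m ε)) (.item j) [] T ∧
      Prepared (nodeValue (hookedMap c 1 m ε)) (.item j) d ⟨.item j, fun _ => []⟩ P T
        (prepareLower c ℓ d S : Multiset Banana) := by
  obtain ⟨R, hheap, hin, hbananas⟩ := exists_lowerTree h hℓ hm hlt hS
  obtain ⟨j, X, hclosest, hX, hle, hj, hj', -⟩ := exists_closestMin h hℓ hm hlt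
  obtain ⟨k, W, rfl, hside⟩ := exists_build_eq d R
  have hk := hin
  rw [inorder_build_of_side hside, hX] at hk
  obtain rfl : k = .item j := by simpa using (attach_inj hk rfl).2
  obtain ⟨P, T, rfl, hends, hprep⟩ := exists_prepared_deco hside hheap
    (hin.symm ▸ nodup_innerList_values h hm d)
  refine ⟨j, P, T, hclosest, ?_, by rw [← hin, inorder_build_of_side hside], hends,
    hbananas ▸ hprep⟩
  rw [← partValue_inner hm d (.item j) (hX ▸ by cases d <;> simp [attach]), partValue_item hj hj']
  exact hle

theorem exists_prepared_higher (h : Gapped c 1 m ε) (hℓ : 2 ≤ ℓ) (hm : ℓ + 2 ≤ m)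
    (hlt : c (endItem ℓ d.opp) < c (endItem ℓ d)) {k : Node}
    (hk : nodeValue (hookedMap c 1 m ε) k ≤ c (endItem ℓ d.opp))
    (hS : S.Perm (upTree c (firstItem ℓ d) (lastItem ℓ m d) ε (.root d))) :
    ∃ P T : List Entry, outer d (P ++ T) = innerList c ℓ m ε d ∧
      Prepared (nodeValue (hookedMap c 1 m ε)) k d dummyPath P T
        (modify S (dummyLeaf c ℓ d) fun B => { B with lower := .dummy } : Multiset Banana) := by
  obtain ⟨R, hheap, hin, hnd, hbananas⟩ := exists_partTree h hℓ hm hS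
  obtain ⟨x, W, rfl, hside⟩ := exists_build_eq d R
  rw [partCriticals_higher h hℓ hm hlt, inorder_build_of_side hside] at hin
  obtain ⟨houter, hx⟩ := attach_inj hin rfl
  obtain rfl : x = dummyLeaf c ℓ d := by simpa using hx
  obtain ⟨P, T, rfl, hprep⟩ := exists_prepared_modify (v := nodeValue (hookedMap c 1 m ε))
    (k := k) hside hheap hnd hbananas
    (fun y hy => partValue_inner hm d y (by rwa [nodes_eq_outer hside, houter] at hy))
    (hk.trans_lt (partValue_dummyLeaf_gt h hℓ hm hlt))
  exact ⟨P, T, houter, hprep⟩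

end

section

variable {v : Node → ℝ} {k : Node} {W : Side → List Entry}

theorem Side.exists_fun {α : Type*} (s : Side) (a b : α) : ∃ F : Side → α, F s = a ∧ F s.opp = b :=
  ⟨fun d => if d = s then a else b, if_pos rfl, if_neg (Side.opp_ne s)⟩

theorem cons_nodes_eq_outer (hside : ∀ d, ∀ e ∈ W d, e.side = d) (k : Node) :
    k ::ₘ (nodes (W .left) + nodes (W .right)) =
      (outer .left (W .left) ++ [k] ++ outer .right (W .right) : List Node) := by
  rw [nodes_eq_outer (hside .left), nodes_eq_outer (hside .right), ← Multiset.coe_add,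
    ← Multiset.coe_add, Multiset.coe_singleton, ← Multiset.singleton_add]
  abel

theorem Frame.of_heapOrdered (hside : ∀ d, ∀ e ∈ W d, e.side = d)
    (hreal : ∀ x ∈ k ::ₘ (nodes (W .left) + nodes (W .right)), x.IsReal)
    (hnd : ((k ::ₘ (nodes (W .left) + nodes (W .right))).map v).Nodup)
    (hheap : ∀ d, (build (.leaf k) (W d)).HeapOrdered v) : Frame v k W where
  side := hside
  real := hreal
  nodup := hnd
  rising d := (heapOrdered_build.mp (hheap d)).2.2
  heap d e he _ hx :=
    have ⟨htop, htree, _⟩ := (heapOrdered_build.mp (hheap d)).2.1 e he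
    (htree.le_top hx).trans_lt htop
  leaf d e he := ((heapOrdered_build.mp (hheap d)).2.1 e he).2.2

theorem Stage.of_prepared {s : Side} {P T : Side → List Entry} {S S' : List Banana}
    (h : Prepared v k s ⟨k, fun _ => []⟩ (P s) (T s) S)
    (h' : Prepared v k s.opp dummyPath (P s.opp) (T s.opp) S') :
    Stage v k (fun d => P d ++ T d) (S ++ S' : List Banana) (S ++ S') s [] P T where
  split _ := rfl
  rising := List.Pairwise.nil
  sep _ hu := absurd hu List.not_mem_nil
  passed := (Side.forall_iff s).mpr ⟨h.passed, h'.passed⟩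
  bananas := by
    rw [stageBananas, remainder_eq v k [] P T s, ← Multiset.coe_add, h.bananas, h'.bananas]
    change _ = dummyPath.endOn s.opp _ _ ::ₘ OpenPath.endOn ⟨k, fun _ => []⟩ s _ _ ::ₘ (0 + _ + _)
    simp only [← Multiset.singleton_add]
    abel
  rest_le_init := by
    rw [← Multiset.coe_add]
    refine (Side.forall_iff s).mpr ⟨?_, ?_⟩
    · rw [h.bananas]
      exact (Multiset.le_add_left _ _).trans
        ((Multiset.le_cons_self _ _).trans (Multiset.le_add_right _ _))
    · rw [h'.bananas]
      exact (Multiset.le_add_left _ _).trans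
        ((Multiset.le_cons_self _ _).trans (Multiset.le_add_left _ _))

end

section

variable {c : ℕ → ℝ} {ℓ m : ℕ} {ε : ℝ}

theorem outer_append_eq_criticals (hm : ℓ + 2 ≤ m) {W : Side → List Entry} {k : Node} {s : Side}
    (hs : attach s (outer s (W s)) [k] = innerList c ℓ m ε s)
    (hs' : outer s.opp (W s.opp) = innerList c ℓ m ε s.opp) :
    outer .left (W .left) ++ [k] ++ outer .right (W .right) = criticals c 1 m ε := by
  rw [criticals_eq_inner hm]
  cases s
  · rw [← hs, ← show _ = innerList c ℓ m ε .right from hs']; rfl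
  · rw [← hs, ← show _ = innerList c ℓ m ε .left from hs', List.append_assoc]; rfl

theorem Frame.of_criticals (h : Gapped c 1 m ε) {W : Side → List Entry} {k : Node}
    (hside : ∀ d, ∀ e ∈ W d, e.side = d)
    (hcrit : outer .left (W .left) ++ [k] ++ outer .right (W .right) = criticals c 1 m ε)
    (hheap : ∀ d, (build (.leaf k) (W d)).HeapOrdered (nodeValue (hookedMap c 1 m ε))) :
    Frame (nodeValue (hookedMap c 1 m ε)) k W := by
  refine .of_heapOrdered hside ?_ ?_ hheap <;> rw [cons_nodes_eq_outer hside, hcrit]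
  · exact fun x hx => isReal_of_mem_criticals hx
  · exact h.nodup_values

theorem build_eq_binaryTree (h : Gapped c 1 m ε) {W : Side → List Entry} {U : List Entry} {k : Node}
    (hcrit : outer .left (W .left) ++ [k] ++ outer .right (W .right) = criticals c 1 m ε)
    (hheap : ∀ d, (build (.leaf k) (W d)).HeapOrdered (nodeValue (hookedMap c 1 m ε)))
    (hU : ∀ d, (U.filter fun e => e.side = d) = W d)
    (hrising : Rising (nodeValue (hookedMap c 1 m ε)) U) :
    build (.leaf k) U = binaryTree (nodeValue (hookedMap c 1 m ε)) (criticals c 1 m ε) := by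
  obtain ⟨hheap', hin⟩ := h.binaryTree_spec
  refine BinTree.HeapOrdered.eq_of_inorder_eq ?_ hheap' ?_
  · refine heapOrdered_build.mpr ⟨trivial, fun e he => ?_, hrising⟩
    have hmem : e ∈ W e.side := hU e.side ▸ List.mem_filter.mpr ⟨he, by simp⟩
    exact (heapOrdered_build.mp (hheap e.side)).2.1 e hmem
  · rw [hin, ← hcrit, inorder_build_eq, ← hU .left, ← hU .right, outer_filter, outer_filter]
    rfl

theorem glueInit_eq_some {R : Side → List Banana} {s : Side} {j : ℕ} {b b' : Node}
    (hs : lowerPart c ℓ = s) (hj : closestMin c ℓ m ε s = some j)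
    (hb : dth (prepareLower c ℓ s (R s) ++ modify (R s.opp) (dummyLeaf c ℓ s.opp)
      fun B => { B with lower := .dummy }) (.item j) = some b)
    (hb' : dth (prepareLower c ℓ s (R s) ++ modify (R s.opp) (dummyLeaf c ℓ s.opp)
      fun B => { B with lower := .dummy }) .dummy = some b') :
    ∃ σ, glueInit c ℓ m ε R = some σ ∧ σ.bananas = prepareLower c ℓ s (R s) ++
        modify (R s.opp) (dummyLeaf c ℓ s.opp) (fun B => { B with lower := .dummy }) ∧
      σ.cur s = b ∧ σ.cur s.opp = b' := by
  rw [glueInit, hs]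
  simp only [hj, hb, hb', Option.bind_eq_bind, Option.bind_some, Option.pure_def]
  exact ⟨_, rfl, rfl, if_pos rfl, if_neg (Side.opp_ne s)⟩

theorem exists_glueInit (h : Gapped c 1 m ε) (hℓ : 2 ≤ ℓ) (hm : ℓ + 2 ≤ m)
    {R : Side → List Banana}
    (hR : ∀ d, (R d).Perm (upTree c (firstItem ℓ d) (lastItem ℓ m d) ε (.root d))) :
    ∃ (k : Node) (W : Side → List Entry) (σ : GlueState) (n : ℕ),
      Frame (nodeValue (hookedMap c 1 m ε)) k W ∧
      (∀ d, (build (.leaf k) (W d)).HeapOrdered (nodeValue (hookedMap c 1 m ε))) ∧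
      outer .left (W .left) ++ [k] ++ outer .right (W .right) = criticals c 1 m ε ∧
      glueInit c ℓ m ε R = some σ ∧ GlueInv (hookedMap c 1 m ε) k W σ.bananas σ n := by
  have hlt := lowerPart_lt h hℓ hm
  generalize hs : lowerPart c ℓ = s at hlt
  obtain ⟨j, P₁, T₁, hclosest, hj, hinner, hends, hlower⟩ :=
    exists_prepared_lower h hℓ hm hlt (hR s)
  obtain ⟨P₂, T₂, hinner', hhigher⟩ :=
    exists_prepared_higher h hℓ hm (by rwa [Side.opp_opp]) (by rwa [Side.opp_opp]) (hR s.opp)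
  obtain ⟨P, rfl, rfl⟩ := Side.exists_fun s P₁ P₂
  obtain ⟨T, rfl, rfl⟩ := Side.exists_fun s T₁ T₂
  have hcrit := outer_append_eq_criticals (W := fun d => P d ++ T d) hm hinner hinner'
  have hheap : ∀ d, (build (.leaf (.item j)) (P d ++ T d)).HeapOrdered _ :=
    (Side.forall_iff s).mpr ⟨hlower.heap, hhigher.heap⟩
  have hF := Frame.of_criticals h ((Side.forall_iff s).mpr ⟨hlower.side, hhigher.side⟩) hcrit hheap
  have hstage := Stage.of_prepared hlower hhigher
  obtain ⟨σ, hσ, hS, hcur, hcur'⟩ := glueInit_eq_some hs hclosest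
    (dth_lower (hstage.feet_nodup hF) hstage.core_mem)
    (dth_lower (hstage.feet_nodup hF) hstage.dummy_mem)
  rw [← hS] at hstage
  exact ⟨.item j, _, σ, _, hF, hheap, hcrit, hσ, s, [], P, T, hstage, hends,
    (Side.forall_iff s).mpr ⟨hcur, hcur'⟩, rfl⟩

end

end BananaTree

end

open BananaTree in
theorem theoremB6 (c : ℕ → ℝ) (ℓ m : ℕ) (hℓ : 2 ≤ ℓ) (hm : ℓ + 2 ≤ m)
    (hc : Set.InjOn c (Set.Icc 1 m)) (ε : ℝ) (hε : 0 < ε)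
    (hgap : ∀ i ∈ Set.Icc 1 m, ∀ j ∈ Set.Icc 1 m, i ≠ j → ε < |c i - c j|)
    (T : Side → List Banana)
    (hg : (T .left).Perm (upTree c 1 ℓ ε (.root .left)))
    (hh : (T .right).Perm (upTree c (ℓ + 1) m ε (.root .right))) :
    ∃ (N : ℕ) (run : ℕ → GlueState),
      IsGlueRun c ℓ m ε T N run ∧
      (∀ i < N, ∀ s : Side,
        InSpine (run 0).bananas (.root s) s.opp ((run i).cur s) ∧
        InSpine (run i).bananas (.root s) s.opp ((run i).cur s)) ∧
      ((run N).result).Perm (upTree c 1 m ε (.root (run N).survivor)) := by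
  have h : Gapped c 1 m ε :=
    ⟨le_rfl, by omega, hε, fun i hi hi' j hj hj' => hgap i ⟨hi, hi'⟩ j ⟨hj, hj'⟩⟩
  obtain ⟨k, W, σ, n, hF, hheap, hcrit, hinit, hinv⟩ :=
    exists_glueInit h hℓ hm (Side.forall_iff .left |>.mpr ⟨hg, hh⟩)
  obtain ⟨N, run, rfl, hN, hstep, hcont, hempty, hrun⟩ := hinv.exists_run hF ε
  refine ⟨N, run, ⟨hinit, hN, hstep, hcont, hempty⟩,
    fun i hi s => (hrun i hi.le).choose_spec.inSpine hF s, ?_⟩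
  obtain ⟨U, hU, hrising, hresult⟩ := (hrun N le_rfl).choose_spec.exists_result_eq hF hempty
  rw [build_eq_binaryTree h hcrit hheap hU hrising] at hresult
  rw [← Multiset.coe_eq_coe, hresult]
  rfl
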